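/- Let $n\ge 3$ and let $\overline M$ be a compact smooth $n$-dimensional manifold with boundary $\partial M$ and interior $M$. Let $l\ge 2$ be an integer and $\beta\in[0,1)$, and let $g$ be a $C^{l,\beta}$-asymptotically hyperbolic metric on $M$: there is a smooth function $\rho\ge 0$ on $\overline M$ with $\rho^{-1}(0)=\partial M$ and $d\rho\ne 0$ on $\partial M$, such that $\overline g=\rho^2 g$ extends to a $C^{l,\beta}$ Riemannian metric on $\overline M$ with $|d\rho|_{\overline g}=1$ on $\partial M$. Let $\mathrm{Scal}$ be the scalar curvature and $\mu^g$ the Riemannian volume measure of $g$. Let $W^{1,2}_0(M,\mathbb R)$ be the (unweighted, i.e. weight $0$) Sobolev space of all $u\in W^{1,2}_{loc}(M,\mathbb R)$ with finite norm $$\|u\|=\Big(\int_M u^2\,d\mu^g\Big)^{1/2}+\Big(\int_M|du|_g^2\,d\mu^g\Big)^{1/2}.$$ Then for every $u\in W^{1,2}_0(M,\mathbb R)$ the function $\frac{4(n-1)}{n-2}|du|_g^2+\mathrm{Scal}\,u^2$ is $\mu^g$-integrable, and the functional $$G_g(u)=\int_M\Big[\frac{4(n-1)}{n-2}|du|_g^2+\mathrm{Scal}\,u^2\Big]d\mu^g$$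 is sequentially weakly lower semicontinuous on $W^{1,2}_0(M,\mathbb R)$: for every sequence $(u_k)_k$ converging weakly in $W^{1,2}_0(M,\mathbb R)$ to $u_\infty\in W^{1,2}_0(M,\mathbb R)$, $$\liminf_{k\to\infty}G_g(u_k)\ge G_g(u_\infty).$$ -/

import Mathlib

open scoped Manifold ContDiff NNReal ENNReal
open MeasureTheory Filter Topology

noncomputable section

namespace AsympHyp

/-! ### Metrics in charts

`M` is a smooth manifold with boundary (written `M̄` on paper), modelled on the Euclidean half-space
of dimension `n`. Its manifold interior is the open manifold on which the asymptotically hyperbolic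
metric lives. -/

section Basic

variable {n : ℕ} [NeZero n] {M : Type*} [TopologicalSpace M]
  [ChartedSpace (EuclideanHalfSpace n) M]

variable (n M) in
/-- A field of bilinear forms on the tangent spaces. A Riemannian metric on the interior of `M` is
such a field, of which only the values at interior points are ever used. -/
abbrev BilinField : Type _ :=
  ∀ x : M, TangentSpace (𝓡∂ n) x →L[ℝ] TangentSpace (𝓡∂ n) x →L[ℝ] ℝ

variable (n M) in
/-- A field of covectors (a `1`-form, with no regularity). -/
abbrev CovectorField : Type _ := ∀ x : M, TangentSpace (𝓡∂ n) x →L[ℝ] ℝ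

/-- The `i`-th standard basis vector of `ℝⁿ`. -/
abbrev stdVec (i : Fin n) : EuclideanSpace ℝ (Fin n) := EuclideanSpace.single i (1 : ℝ)

/-- The `i`-th coordinate vector field `∂ᵢ` of the chart around `x₀`, at the point with
coordinates `y`. -/
def coordVec (x₀ : M) (y : EuclideanSpace ℝ (Fin n)) (i : Fin n) :
    TangentSpace (𝓡∂ n) ((extChartAt (𝓡∂ n) x₀).symm y) :=
  mfderivWithin 𝓘(ℝ, EuclideanSpace ℝ (Fin n)) (𝓡∂ n) (extChartAt (𝓡∂ n) x₀).symm
    (Set.range (𝓡∂ n)) y (stdVec i)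

/-- The matrix `(g(∂ᵢ, ∂ⱼ))ᵢⱼ` of a field of bilinear forms in the chart around `x₀`, at the point
with coordinates `y`. -/
def coeffMatrix (g : BilinField n M) (x₀ : M) (y : EuclideanSpace ℝ (Fin n)) :
    Matrix (Fin n) (Fin n) ℝ :=
  fun i j => g ((extChartAt (𝓡∂ n) x₀).symm y) (coordVec x₀ y i) (coordVec x₀ y j)

/-- The coordinate domain, an open subset of `ℝⁿ`, of the interior part of the chart around `x₀`. -/
def chartDomain (x₀ : M) : Set (EuclideanSpace ℝ (Fin n)) :=
  interior (extChartAt (𝓡∂ n) x₀).target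

/-- The norm of a covector with respect to a bilinear form (an inner product in all uses):
`|α| = sup {|α(v)| : g(v, v) ≤ 1}`. -/
def covectorNorm (g : BilinField n M) (x : M) (α : TangentSpace (𝓡∂ n) x →L[ℝ] ℝ) : ℝ :=
  sSup {r : ℝ | ∃ v : TangentSpace (𝓡∂ n) x, g x v v ≤ 1 ∧ r = |α v|}

end Basic

/-! ### Asymptotically hyperbolic metrics -/

/-- `f` is of class `C^{l,β}` on `s ⊆ ℝⁿ`: it is `C^l` up to the part of the boundary contained in
`s`, and its derivative of order `l` is locally Hölder continuous with exponent `β`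
(for `β = 0` the last condition is implied by the continuity of that derivative). -/
def IsHolderClassOn {n : ℕ} (l : ℕ) (β : ℝ≥0) (f : EuclideanSpace ℝ (Fin n) → ℝ)
    (s : Set (EuclideanSpace ℝ (Fin n))) : Prop :=
  ContDiffOn ℝ l f s ∧
    ∀ y ∈ s, ∃ U ∈ 𝓝[s] y, ∃ C : ℝ≥0, HolderOnWith C β (iteratedFDerivWithin ℝ l f s) (U ∩ s)

section AH

variable {n : ℕ} [NeZero n] {M : Type*} [TopologicalSpace M]
  [ChartedSpace (EuclideanHalfSpace n) M]

/-- `ρ` is a defining function for the boundary of `M`: a smooth nonnegative function, vanishing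
exactly on the boundary, and whose differential does not vanish at any boundary point. -/
structure IsDefiningFunction (ρ : M → ℝ) : Prop where
  contMDiff : ContMDiff (𝓡∂ n) 𝓘(ℝ, ℝ) ∞ ρ
  nonneg : ∀ x, 0 ≤ ρ x
  eq_zero_iff : ∀ x, ρ x = 0 ↔ x ∈ (𝓡∂ n).boundary M
  mfderiv_ne_zero : ∀ x ∈ (𝓡∂ n).boundary M, mfderiv (𝓡∂ n) 𝓘(ℝ, ℝ) ρ x ≠ 0

/-- The differential of a real function, as a field of covectors. -/
def differential (ρ : M → ℝ) : CovectorField n M := fun x => mfderiv (𝓡∂ n) 𝓘(ℝ, ℝ) ρ x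

/-- `g` is a `C^{l,β}`-asymptotically hyperbolic metric on the interior of `M`: for some defining
function `ρ`, `ρ² g` extends to a Riemannian metric `gbar` of class `C^{l,β}` on the whole of `M`,
such that `|dρ|_gbar = 1` on the boundary. (As `ρ > 0` on the interior, `g` is there a Riemannian
metric of the same class.) -/
def IsAsymptoticallyHyperbolic (l : ℕ) (β : ℝ≥0) (g : BilinField n M) : Prop :=
  ∃ (ρ : M → ℝ) (gbar : Bundle.RiemannianMetric (fun x : M => TangentSpace (𝓡∂ n) x)),
    IsDefiningFunction (n := n) ρ ∧
    (∀ (x₀ : M) (i j : Fin n),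
      IsHolderClassOn l β (fun y => coeffMatrix gbar.inner x₀ y i j)
        (extChartAt (𝓡∂ n) x₀).target) ∧
    (∀ x ∈ (𝓡∂ n).interior M, ∀ v w : TangentSpace (𝓡∂ n) x,
      gbar.inner x v w = ρ x ^ 2 * g x v w) ∧
    ∀ x ∈ (𝓡∂ n).boundary M, covectorNorm gbar.inner x (differential ρ x) = 1

end AH

/-! ### Scalar curvature -/

section Curvature

variable {n : ℕ}

/-- The partial derivative `∂ₖ f`. -/
def partialDeriv (k : Fin n) (f : EuclideanSpace ℝ (Fin n) → ℝ) (y : EuclideanSpace ℝ (Fin n)) :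
    ℝ :=
  fderiv ℝ f y (stdVec k)

/-- The Christoffel symbol `Γᵏᵢⱼ = ½ ∑ₗ Gᵏˡ (∂ᵢ Gⱼₗ + ∂ⱼ Gᵢₗ - ∂ₗ Gᵢⱼ)` of a metric with
coefficients `G`. -/
def christoffel (G : EuclideanSpace ℝ (Fin n) → Matrix (Fin n) (Fin n) ℝ) (k i j : Fin n)
    (y : EuclideanSpace ℝ (Fin n)) : ℝ :=
  (1 / 2) * ∑ l, (G y)⁻¹ k l *
    (partialDeriv i (fun z => G z j l) y + partialDeriv j (fun z => G z i l) y
      - partialDeriv l (fun z => G z i j) y)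

/-- The Ricci curvature
`Ricᵢⱼ = ∑ₖ (∂ₖ Γᵏᵢⱼ - ∂ⱼ Γᵏᵢₖ) + ∑ₖₗ (Γᵏₖₗ Γˡᵢⱼ - Γᵏⱼₗ Γˡᵢₖ)` of a metric with
coefficients `G`. -/
def ricciCoeff (G : EuclideanSpace ℝ (Fin n) → Matrix (Fin n) (Fin n) ℝ) (i j : Fin n)
    (y : EuclideanSpace ℝ (Fin n)) : ℝ :=
  ∑ k, (partialDeriv k (christoffel G k i j) y - partialDeriv j (christoffel G k i k) y)
    + ∑ k, ∑ l, (christoffel G k k l y * christoffel G l i j y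
        - christoffel G k j l y * christoffel G l i k y)

/-- The scalar curvature `∑ᵢⱼ Gⁱʲ Ricᵢⱼ` of a metric with coefficients `G`. -/
def scalarCoeff (G : EuclideanSpace ℝ (Fin n) → Matrix (Fin n) (Fin n) ℝ)
    (y : EuclideanSpace ℝ (Fin n)) : ℝ :=
  ∑ i, ∑ j, (G y)⁻¹ i j * ricciCoeff G i j y

/-- The scalar curvature of the metric `g` at an interior point `x`, computed in the preferred chart
around `x` (the result does not depend on the chart). -/
def scalarCurvature [NeZero n] {M : Type*} [TopologicalSpace M]
    [ChartedSpace (EuclideanHalfSpace n) M] (g : BilinField n M) (x : M) : ℝ :=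
  scalarCoeff (coeffMatrix g x) (extChartAt (𝓡∂ n) x x)

end Curvature

/-! ### Riemannian volume, Sobolev space, conformal energy -/

section Sobolev

variable {n : ℕ} [NeZero n] {M : Type*} [TopologicalSpace M]
  [ChartedSpace (EuclideanHalfSpace n) M] [MeasurableSpace M]

/-- The Riemannian volume on the interior part of the chart around `x₀`: the image by the inverse
of the chart of the measure `√(det g) dy`. -/
def chartVolume (g : BilinField n M) (x₀ : M) : Measure M :=
  ((volume.restrict (chartDomain x₀)).withDensity
    fun y => ENNReal.ofReal (Real.sqrt (coeffMatrix g x₀ y).det)).map (extChartAt (𝓡∂ n) x₀).symm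

/-- The Riemannian volume measure of the interior of `M` (seen as a measure on `M` which does not
charge the boundary): the smallest measure dominating the volume in every chart. As the volumes
in any two charts agree on the overlap, it restricts to the volume of each chart. -/
def riemVolume (g : BilinField n M) : Measure M := ⨆ x₀ : M, chartVolume g x₀

variable (n M) in
/-- A pair `(u, α)` of a function and a field of covectors, to be thought of as a function
together with its weak differential `α = du`. -/
abbrev FunctionWithDiff : Type _ := (M → ℝ) × CovectorField n M

/-- The function `u`, read in the chart around `x₀`. -/
def inChart (u : M → ℝ) (x₀ : M) (y : EuclideanSpace ℝ (Fin n)) : ℝ :=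
  u ((extChartAt (𝓡∂ n) x₀).symm y)

/-- The component `α(∂ᵢ)` of a field of covectors, read in the chart around `x₀`. -/
def covectorInChart (α : CovectorField n M) (x₀ : M) (i : Fin n)
    (y : EuclideanSpace ℝ (Fin n)) : ℝ :=
  α ((extChartAt (𝓡∂ n) x₀).symm y) (coordVec x₀ y i)

/-- `u ∈ W^{1,2}_loc` on the interior of `M`, with weak differential `α`: in the interior part of
every chart, `u` and the components of `α` are locally square integrable, and `α(∂ᵢ)` is the weak
partial derivative `∂ᵢ u`. -/
def IsLocallySobolev (U : FunctionWithDiff n M) : Prop :=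
  ∀ x₀ : M,
    (∀ K ⊆ chartDomain x₀, IsCompact K →
      MemLp (inChart (n := n) U.1 x₀) 2 (volume.restrict K) ∧
      ∀ i : Fin n, MemLp (covectorInChart U.2 x₀ i) 2 (volume.restrict K)) ∧
    ∀ η : EuclideanSpace ℝ (Fin n) → ℝ, ContDiff ℝ ∞ η → HasCompactSupport η →
      tsupport η ⊆ chartDomain x₀ → ∀ i : Fin n,
        ∫ y, inChart (n := n) U.1 x₀ y * partialDeriv i η y
          = -∫ y, covectorInChart U.2 x₀ i y * η y

/-- The pointwise norm `|α|_g`. -/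
def diffNorm (g : BilinField n M) (α : CovectorField n M) (x : M) : ℝ := covectorNorm g x (α x)

/-- The Sobolev space `W^{1,2}` of the metric `g`: the functions `u ∈ W^{1,2}_loc`, paired with
their weak differential `du`, such that `u` and `|du|_g` are square integrable. -/
def sobolevSpace (g : BilinField n M) : Set (FunctionWithDiff n M) :=
  {U | IsLocallySobolev U ∧ MemLp U.1 2 (riemVolume g) ∧ MemLp (diffNorm g U.2) 2 (riemVolume g)}

/-- The Sobolev norm `(∫ u² dμ)^{1/2} + (∫ |du|² dμ)^{1/2}`. -/
def sobolevNorm (g : BilinField n M) (U : FunctionWithDiff n M) : ℝ :=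
  (eLpNorm U.1 2 (riemVolume g)).toReal + (eLpNorm (diffNorm g U.2) 2 (riemVolume g)).toReal

/-- `ℓ` restricts to a bounded linear functional on the Sobolev space of `g` (its values outside
that space are irrelevant). -/
structure IsBoundedFunctional (g : BilinField n M) (ℓ : FunctionWithDiff n M → ℝ) : Prop where
  map_add : ∀ U ∈ sobolevSpace g, ∀ V ∈ sobolevSpace g, ℓ (U + V) = ℓ U + ℓ V
  map_smul : ∀ c : ℝ, ∀ U ∈ sobolevSpace g, ℓ (c • U) = c * ℓ U
  bound : ∃ C : ℝ, ∀ U ∈ sobolevSpace g, |ℓ U| ≤ C * sobolevNorm g U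

/-- Weak convergence in the Sobolev space of `g`. -/
structure WeaklyConverges (g : BilinField n M) (U : ℕ → FunctionWithDiff n M)
    (V : FunctionWithDiff n M) : Prop where
  mem : ∀ k, U k ∈ sobolevSpace g
  mem_limit : V ∈ sobolevSpace g
  tendsto : ∀ ℓ : FunctionWithDiff n M → ℝ, IsBoundedFunctional g ℓ →
    Tendsto (fun k => ℓ (U k)) atTop (𝓝 (ℓ V))

/-- The integrand `4(n-1)/(n-2) |du|² + Scal u²` of the conformal energy. -/
def energyDensity (g : BilinField n M) (U : FunctionWithDiff n M) (x : M) : ℝ :=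
  4 * ((n : ℝ) - 1) / ((n : ℝ) - 2) * diffNorm g U.2 x ^ 2 + scalarCurvature g x * U.1 x ^ 2

/-- The conformal energy `∫ (4(n-1)/(n-2) |du|² + Scal u²) dμ`. -/
def conformalEnergy (g : BilinField n M) (U : FunctionWithDiff n M) : ℝ :=
  ∫ x, energyDensity g U x ∂(riemVolume g)

end Sobolev

end AsympHyp

end

/-! Write `G` for the conformal energy, `c = 4(n-1)/(n-2)`, and `B` for the symmetric bilinear form
with `B(u,u) = G(u)`. Then `G(u_k) = G(u) + 2 B(u, u_k - u) + G(u_k - u)`. The middle term tends to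
zero because `B(u, ·)` is a bounded functional. Since `Scal` is negative near infinity, `G` is not a
nonnegative form, so the task is to bound the last term below by something that tends to zero.

The bound is `G(w) ≥ ∫ W w²` with `W` continuous on the compact manifold with boundary and positive
on the boundary (`exists_energy_lower_bound`). The set where `W ≤ 0` is then a compact subset `K` of
the interior, so `G(w) ≥ -sup|W| ∫_K w²`, and `∫_K (u_k - u)²` tends to zero by Rellich's theorem
(`tendsto_setIntegral_sq`, which rests on `tendsto_integral_sq_of_hasWeakGrad`).

`W = c V + Scal` comes from two facts about the boundary at infinity.

(1) `Scal` extends continuously to the boundary with value `-n(n-1)`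
(`exists_continuous_scalarCurvature`). In a chart, the connection of `r⁻² G` times `r`, and its
curvature times `r²`, are regular up to `r = 0`, where only the curvature of a space of constant
curvature `-|dr|² = -1` survives. As the scalar curvature is defined at each point by the preferred
chart of that point, its independence of coordinates must be proved too (`scalarCoeff_transform`).

(2) `∫ |dw|² ≥ ∫ V w²` with `V` continuous and equal to `((n-1)/2)²` on the boundary
(`exists_dirichlet_lower_bound`). For a vector field `X`, expanding `|dw + w X|² ≥ 0` and
integrating `2 w dw(X) = d(w²)(X)` by parts gives `∫ |dw|² ≥ ∫ (div X - |X|²) w²`. With `X = -a ρ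
∇ρ`, the gradient being that of `ρ² g`, one has `|X|² = a² |dρ|²` and `div X = a(n-1)|dρ|²` up to
terms carrying a factor `ρ`. Localising with a partition of unity only adds derivatives of the
cutoffs, which also carry a factor `ρ`. The boundary value `a(n-1) - a²` is largest at `a =
(n-1)/2`. Integration by parts is legitimate although `X` does not vanish near the boundary, by a
cutoff in `ρ` whose error is dominated (`HasLocalWeakGrad.integral_div_eq_zero`).

On the boundary `W = c((n-1)/2)² - n(n-1) = (n-1)/(n-2) > 0`: the spectral gap at infinity beats the
negative curvature. -/

noncomputable section

set_option maxSynthPendingDepth 3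

namespace AsympHyp

/-! ### Mollification in `L²` -/

section Mollify

variable {n : ℕ}

/-- The convolution of `f` with a normalised bump function. -/
def mollify (φ : ContDiffBump (0 : EuclideanSpace ℝ (Fin n))) (f : EuclideanSpace ℝ (Fin n) → ℝ) :
    EuclideanSpace ℝ (Fin n) → ℝ :=
  convolution (φ.normed volume) f (ContinuousLinearMap.lsmul ℝ ℝ) volume

lemma mollify_apply (φ : ContDiffBump (0 : EuclideanSpace ℝ (Fin n)))
    (f : EuclideanSpace ℝ (Fin n) → ℝ) (x : EuclideanSpace ℝ (Fin n)) :
    mollify φ f x = ∫ t, φ.normed volume t * f (x - t) := by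
  simp [mollify, convolution_def]

lemma lintegral_ofReal_normed (φ : ContDiffBump (0 : EuclideanSpace ℝ (Fin n))) :
    ∫⁻ t, ENNReal.ofReal (φ.normed volume t) = 1 := by
  have h := ofReal_integral_eq_lintegral_ofReal (φ.integrable_normed (μ := volume))
    (Eventually.of_forall fun x => φ.nonneg_normed (μ := volume) x)
  rw [← h, φ.integral_normed, ENNReal.ofReal_one]

lemma locallyIntegrable_of_memLp_two {f : EuclideanSpace ℝ (Fin n) → ℝ} (hf : MemLp f 2) :
    LocallyIntegrable f :=
  hf.locallyIntegrable (by norm_num)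

lemma contDiff_mollify (φ : ContDiffBump (0 : EuclideanSpace ℝ (Fin n)))
    {f : EuclideanSpace ℝ (Fin n) → ℝ} (hf : LocallyIntegrable f) :
    ContDiff ℝ ∞ (mollify φ f) :=
  φ.hasCompactSupport_normed.contDiff_convolution_left _ φ.contDiff_normed hf

lemma mollify_sub (φ : ContDiffBump (0 : EuclideanSpace ℝ (Fin n)))
    {f g : EuclideanSpace ℝ (Fin n) → ℝ} (hf : LocallyIntegrable f) (hg : LocallyIntegrable g) :
    mollify φ (f - g) = mollify φ f - mollify φ g := by
  have h1 := (φ.hasCompactSupport_normed (μ := volume)).convolutionExists_left (ContinuousLinearMap.lsmul ℝ ℝ)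
    φ.continuous_normed hf
  have h2 := (φ.hasCompactSupport_normed (μ := volume)).convolutionExists_left (ContinuousLinearMap.lsmul ℝ ℝ)
    φ.continuous_normed hg
  ext x
  have h := integral_sub (h1 x).integrable (h2 x).integrable
  simp only [ContinuousLinearMap.lsmul_apply, smul_eq_mul] at h
  simp only [mollify_apply, Pi.sub_apply, mul_sub]
  exact h

/-- The kernel is a probability density `P`, so the `L¹(P)` norm of `t ↦ f (x - t)` is at most its
`L²(P)` norm. Squaring, integrating in `x`, exchanging the integrals and using translation
invariance gives the contraction. -/
lemma eLpNorm_mollify_le (φ : ContDiffBump (0 : EuclideanSpace ℝ (Fin n)))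
    {f : EuclideanSpace ℝ (Fin n) → ℝ} (hf : AEStronglyMeasurable f volume) :
    eLpNorm (mollify φ f) 2 volume ≤ eLpNorm f 2 volume := by
  set P : Measure (EuclideanSpace ℝ (Fin n)) :=
    volume.withDensity (fun t => ENNReal.ofReal (φ.normed volume t)) with hP
  have hmeas : Measurable (fun t => ENNReal.ofReal (φ.normed volume t)) :=
    φ.continuous_normed.measurable.ennreal_ofReal
  have hprob : IsProbabilityMeasure P := by
    constructor
    rw [hP, withDensity_apply _ MeasurableSet.univ, Measure.restrict_univ]
    exact lintegral_ofReal_normed φ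
  have hsub : ∀ x, AEStronglyMeasurable (fun t => f (x - t)) volume := fun x =>
    hf.comp_quasiMeasurePreserving (quasiMeasurePreserving_sub_left volume x)
  have hPac : P ≪ volume := withDensity_absolutelyContinuous _ _
  have key : ∀ x, (‖mollify φ f x‖ₑ) ^ (2 : ℝ) ≤
      ∫⁻ t, ENNReal.ofReal (φ.normed volume t) * ‖f (x - t)‖ₑ ^ (2 : ℝ) := by
    intro x
    have h1 : ‖mollify φ f x‖ₑ ≤ ∫⁻ t, ‖f (x - t)‖ₑ ∂P := by
      rw [mollify_apply, hP, lintegral_withDensity_eq_lintegral_mul₀ hmeas.aemeasurable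
        (hsub x).enorm]
      refine (enorm_integral_le_lintegral_enorm _).trans (le_of_eq ?_)
      refine lintegral_congr fun t => ?_
      simp only [Pi.mul_apply, enorm_mul]
      rw [Real.enorm_eq_ofReal (φ.nonneg_normed t)]
    have h2 : (∫⁻ t, ‖f (x - t)‖ₑ ∂P) ≤ (∫⁻ t, ‖f (x - t)‖ₑ ^ (2 : ℝ) ∂P) ^ (1 / 2 : ℝ) := by
      have := eLpNorm_le_eLpNorm_of_exponent_le (μ := P) (p := 1) (q := 2)
        (f := fun t => f (x - t)) (by norm_num) ((hsub x).mono_ac hPac)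
      rw [eLpNorm_one_eq_lintegral_enorm, eLpNorm_eq_lintegral_rpow_enorm_toReal (by norm_num)
        (by norm_num)] at this
      simpa using this
    have h3 : (∫⁻ t, ‖f (x - t)‖ₑ ^ (2 : ℝ) ∂P) =
        ∫⁻ t, ENNReal.ofReal (φ.normed volume t) * ‖f (x - t)‖ₑ ^ (2 : ℝ) := by
      rw [hP, lintegral_withDensity_eq_lintegral_mul₀ hmeas.aemeasurable
        ((hsub x).enorm.pow_const _)]
      rfl
    calc (‖mollify φ f x‖ₑ) ^ (2 : ℝ)
        ≤ ((∫⁻ t, ‖f (x - t)‖ₑ ^ (2 : ℝ) ∂P) ^ (1 / 2 : ℝ)) ^ (2 : ℝ) :=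
          ENNReal.rpow_le_rpow (h1.trans h2) (by norm_num)
      _ = _ := by rw [← ENNReal.rpow_mul, h3]; norm_num
  rw [eLpNorm_eq_lintegral_rpow_enorm_toReal (by norm_num) (by norm_num),
    eLpNorm_eq_lintegral_rpow_enorm_toReal (by norm_num) (by norm_num)]
  refine ENNReal.rpow_le_rpow ?_ (by norm_num)
  simp only [ENNReal.toReal_ofNat]
  calc ∫⁻ x, ‖mollify φ f x‖ₑ ^ (2 : ℝ)
      ≤ ∫⁻ x, ∫⁻ t, ENNReal.ofReal (φ.normed volume t) * ‖f (x - t)‖ₑ ^ (2 : ℝ) :=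
        lintegral_mono key
    _ = ∫⁻ t, ∫⁻ x, ENNReal.ofReal (φ.normed volume t) * ‖f (x - t)‖ₑ ^ (2 : ℝ) := by
        refine lintegral_lintegral_swap ?_
        refine AEMeasurable.mul (hmeas.comp measurable_snd).aemeasurable ?_
        refine AEMeasurable.pow_const ?_ _
        exact (hf.comp_quasiMeasurePreserving
          (quasiMeasurePreserving_sub_of_right_invariant volume volume)).enorm
    _ = ∫⁻ t, ENNReal.ofReal (φ.normed volume t) * ∫⁻ x, ‖f x‖ₑ ^ (2 : ℝ) := by
        refine lintegral_congr fun t => ?_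
        rw [lintegral_const_mul' _ _ ENNReal.ofReal_ne_top,
          lintegral_sub_right_eq_self (fun x => ‖f x‖ₑ ^ (2 : ℝ)) t]
    _ = _ := by
        rw [lintegral_mul_const _ hmeas, lintegral_ofReal_normed, one_mul]

lemma support_mollify_subset (φ : ContDiffBump (0 : EuclideanSpace ℝ (Fin n)))
    (f : EuclideanSpace ℝ (Fin n) → ℝ) :
    tsupport (mollify φ f) ⊆ Metric.cthickening φ.rOut (tsupport f) := by
  refine closure_minimal ?_ Metric.isClosed_cthickening
  intro x hx
  obtain ⟨a, ha, b, hb, rfl⟩ := support_convolution_subset _ hx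
  rw [φ.support_normed_eq] at ha
  refine Metric.mem_cthickening_of_dist_le _ b _ _ (subset_tsupport _ hb) ?_
  simpa using (mem_ball_zero_iff.1 ha).le

/-- A sequence of bump functions shrinking to the origin. -/
def shrinkingBump (k : ℕ) : ContDiffBump (0 : EuclideanSpace ℝ (Fin n)) where
  rIn := 1 / (2 * (k + 1))
  rOut := 1 / (k + 1)
  rIn_pos := by positivity
  rIn_lt_rOut := by
    have : (0 : ℝ) < k + 1 := by positivity
    rw [div_lt_div_iff₀ (by positivity) this]; linarith

lemma shrinkingBump_rOut (k : ℕ) :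
    (shrinkingBump k : ContDiffBump (0 : EuclideanSpace ℝ (Fin n))).rOut = 1 / ((k : ℝ) + 1) := rfl

lemma shrinkingBump_rOut_le_one (k : ℕ) :
    (shrinkingBump k : ContDiffBump (0 : EuclideanSpace ℝ (Fin n))).rOut ≤ 1 := by
  rw [shrinkingBump_rOut, div_le_one (by positivity)]; linarith [(Nat.cast_nonneg k : (0:ℝ) ≤ k)]

lemma eLpNorm_le_of_bound_of_support {f : EuclideanSpace ℝ (Fin n) → ℝ}
    {K : Set (EuclideanSpace ℝ (Fin n))} (hK : MeasurableSet K) {C : ℝ} (hC : ∀ x, |f x| ≤ C)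
    (hf : ∀ x ∉ K, f x = 0) :
    eLpNorm f 2 volume ≤ volume K ^ (1 / 2 : ℝ) * ENNReal.ofReal C := by
  have : f = K.indicator f := by
    ext x; by_cases hx : x ∈ K <;> simp [hx, hf]
  rw [this, eLpNorm_indicator_eq_eLpNorm_restrict hK]
  refine (eLpNorm_le_of_ae_bound (C := C) (Eventually.of_forall hC)).trans ?_
  simp

/-- Uniform continuity makes the convergence uniform, and since all radii are at most `1` the
differences live in one compact set, of finite volume. -/
lemma tendsto_eLpNorm_mollify_sub_of_contDiff {g : EuclideanSpace ℝ (Fin n) → ℝ}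
    (hg : Continuous g) (hgc : HasCompactSupport g) :
    Tendsto (fun k => eLpNorm (mollify (shrinkingBump k) g - g) 2 volume) atTop (𝓝 0) := by
  set K := Metric.cthickening 1 (tsupport g)
  have hK : IsCompact K := hgc.isCompact.cthickening
  have hKv : volume K ^ (1 / 2 : ℝ) ≠ ⊤ :=
    ENNReal.rpow_ne_top_of_nonneg (by norm_num) hK.measure_lt_top.ne
  rw [ENNReal.tendsto_nhds_zero]
  intro ε hε
  obtain ⟨δ, hδ, hδε⟩ : ∃ δ : ℝ, 0 < δ ∧ volume K ^ (1 / 2 : ℝ) * ENNReal.ofReal δ ≤ ε := by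
    have : Tendsto (fun δ : ℝ => volume K ^ (1 / 2 : ℝ) * ENNReal.ofReal δ) (𝓝[>] 0) (𝓝 0) := by
      have h := ENNReal.Tendsto.const_mul (a := volume K ^ (1 / 2 : ℝ))
        (ENNReal.continuous_ofReal.tendsto 0) (Or.inr hKv)
      simp only [ENNReal.ofReal_zero, mul_zero] at h
      exact h.mono_left nhdsWithin_le_nhds
    have h2 := (this.eventually (ge_mem_nhds hε)).and self_mem_nhdsWithin
    obtain ⟨δ, h3, h4⟩ := h2.exists
    exact ⟨δ, h4, h3⟩
  obtain ⟨r, hr, hgr⟩ := Metric.uniformContinuous_iff.1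
    (hg.uniformContinuous_of_tendsto_cocompact (hgc.is_zero_at_infty)) δ hδ
  have hev : ∀ᶠ k : ℕ in atTop, 1 / ((k : ℝ) + 1) < r :=
    tendsto_one_div_add_atTop_nhds_zero_nat.eventually (gt_mem_nhds hr)
  filter_upwards [hev] with k hk
  refine (eLpNorm_le_of_bound_of_support hK.measurableSet (C := δ) ?_ ?_).trans hδε
  · intro x
    rw [Pi.sub_apply, ← Real.dist_eq]
    refine ContDiffBump.dist_normed_convolution_le hg.aestronglyMeasurable fun y hy => ?_
    refine (hgr ?_).le
    rw [Metric.mem_ball, shrinkingBump_rOut] at hy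
    exact hy.trans hk
  · intro x hx
    have h1 : x ∉ tsupport g := fun h => hx (Metric.self_subset_cthickening _ h)
    have h2 : x ∉ tsupport (mollify (shrinkingBump k) g) := fun h =>
      hx (Metric.cthickening_mono (shrinkingBump_rOut_le_one k) _
        (support_mollify_subset _ _ h))
    rw [Pi.sub_apply, image_eq_zero_of_notMem_tsupport h1, image_eq_zero_of_notMem_tsupport h2,
      sub_zero]

/-- The mollifications of an `L²` function converge to it in `L²`. -/
lemma tendsto_eLpNorm_mollify_sub {f : EuclideanSpace ℝ (Fin n) → ℝ} (hf : MemLp f 2 volume) :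
    Tendsto (fun k => eLpNorm (mollify (shrinkingBump k) f - f) 2 volume) atTop (𝓝 0) := by
  rw [ENNReal.tendsto_nhds_zero]
  intro ε hε
  obtain ⟨δ, hδ, hδε⟩ : ∃ δ : ℝ, 0 < δ ∧ ENNReal.ofReal δ ≤ ε / 3 := by
    rcases eq_or_ne ε ⊤ with rfl | h
    · exact ⟨1, one_pos, by simp [ENNReal.top_div]⟩
    · refine ⟨(ε / 3).toReal, ?_, ?_⟩
      · exact ENNReal.toReal_pos (by simp [hε.ne']) (ENNReal.div_ne_top h (by norm_num))
      · exact ENNReal.ofReal_toReal_le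
  obtain ⟨g, hgc, hg, hfg⟩ := hf.exist_eLpNorm_sub_le (by norm_num) (by norm_num) hδ
  have hgL : MemLp g 2 volume := hg.continuous.memLp_of_hasCompactSupport hgc
  have hfi := locallyIntegrable_of_memLp_two hf
  have hgi := locallyIntegrable_of_memLp_two hgL
  have h3 : (0 : ℝ≥0∞) < ε / 3 := by simp [hε.ne']
  filter_upwards [ENNReal.tendsto_nhds_zero.1
    (tendsto_eLpNorm_mollify_sub_of_contDiff hg.continuous hgc) _ h3] with k hk
  -- With `g` continuous, compactly supported and close to `f` in `L²`, the first term is as small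
  -- as `f - g` because mollification is a contraction.
  have hdec : mollify (shrinkingBump k) f - f =
      (mollify (shrinkingBump k) (f - g) + (mollify (shrinkingBump k) g - g)) - (f - g) := by
    rw [mollify_sub _ hfi hgi]; abel
  have m1 : ∀ h : EuclideanSpace ℝ (Fin n) → ℝ, LocallyIntegrable h →
      AEStronglyMeasurable (mollify (shrinkingBump k) h) volume := fun h hh =>
    (contDiff_mollify _ hh).continuous.aestronglyMeasurable
  have m2 : AEStronglyMeasurable (mollify (shrinkingBump k) g - g) volume :=
    (m1 g hgi).sub hgL.1
  have m3 := m1 _ (hfi.sub hgi)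
  calc eLpNorm (mollify (shrinkingBump k) f - f) 2 volume
      ≤ eLpNorm (mollify (shrinkingBump k) (f - g) + (mollify (shrinkingBump k) g - g)) 2 volume
        + eLpNorm (f - g) 2 volume := by
        rw [hdec]; exact eLpNorm_sub_le (m3.add m2) (hf.1.sub hgL.1) (by norm_num)
    _ ≤ (eLpNorm (mollify (shrinkingBump k) (f - g)) 2 volume +
          eLpNorm (mollify (shrinkingBump k) g - g) 2 volume) + eLpNorm (f - g) 2 volume := by
        gcongr; exact eLpNorm_add_le m3 m2 (by norm_num)
    _ ≤ (ε / 3 + ε / 3) + ε / 3 := by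
        gcongr
        · exact (eLpNorm_mollify_le _ (hf.1.sub hgL.1)).trans (hfg.trans hδε)
        · exact hfg.trans hδε
    _ = ε := ENNReal.add_thirds ε

end Mollify

/-! ### Weak gradients on `ℝⁿ` -/

section WeakGrad

variable {n : ℕ}

/-- `dw` is the weak gradient of `w`, both being square integrable on `ℝⁿ`. -/
structure HasWeakGrad (w : EuclideanSpace ℝ (Fin n) → ℝ)
    (dw : Fin n → EuclideanSpace ℝ (Fin n) → ℝ) : Prop where
  memLp : MemLp w 2
  memLp_grad : ∀ i, MemLp (dw i) 2
  weak : ∀ η : EuclideanSpace ℝ (Fin n) → ℝ, ContDiff ℝ ∞ η → HasCompactSupport η → ∀ i,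
    ∫ y, w y * partialDeriv i η y = -∫ y, dw i y * η y

/-- The derivative of the convolution falls on the kernel, and `s ↦ φ (x - s)` is an admissible test
function for the weak gradient. The sign from reflecting the kernel cancels the sign of the weak
formulation. -/
lemma partialDeriv_mollify {w : EuclideanSpace ℝ (Fin n) → ℝ}
    {dw : Fin n → EuclideanSpace ℝ (Fin n) → ℝ} (h : HasWeakGrad w dw)
    (φ : ContDiffBump (0 : EuclideanSpace ℝ (Fin n))) (i : Fin n) (x : EuclideanSpace ℝ (Fin n)) :
    partialDeriv i (mollify φ w) x = mollify φ (dw i) x := by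
  have hw := locallyIntegrable_of_memLp_two h.memLp
  have hφ : ContDiff ℝ ∞ (φ.normed (volume : Measure (EuclideanSpace ℝ (Fin n)))) :=
    φ.contDiff_normed
  have hφc : HasCompactSupport (φ.normed (volume : Measure (EuclideanSpace ℝ (Fin n)))) :=
    φ.hasCompactSupport_normed
  have hd := hφc.hasFDerivAt_convolution_left (μ := volume) (ContinuousLinearMap.lsmul ℝ ℝ)
    (hφ.of_le (by simp)) hw x
  have hex := (hφc.fderiv ℝ).convolutionExists_left (μ := volume)
    ((ContinuousLinearMap.lsmul ℝ ℝ).precompL (EuclideanSpace ℝ (Fin n)) :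
      _ →L[ℝ] ℝ →L[ℝ] _) (hφ.continuous_fderiv (by simp)) hw x
  have hη : ContDiff ℝ ∞ (fun s => φ.normed volume (x - s)) := hφ.comp (contDiff_const.sub contDiff_id)
  have hηc : HasCompactSupport (fun s => φ.normed volume (x - s)) :=
    hφc.comp_homeomorph (Homeomorph.subLeft x)
  have hηd : ∀ s, partialDeriv i (fun s => φ.normed volume (x - s)) s =
      - partialDeriv i (φ.normed volume) (x - s) := by
    intro s
    have h1 := ((hφ.differentiable (by simp)).differentiableAt (x := x - s)).hasFDerivAt
    have h2 : HasFDerivAt (fun s => x - s) (-ContinuousLinearMap.id ℝ (EuclideanSpace ℝ (Fin n))) s := by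
      simpa using (hasFDerivAt_id s).const_sub x
    have h3 := (h1.comp s h2).fderiv
    simp only [partialDeriv]
    have h4 : ((φ.normed volume) ∘ fun s => x - s) = fun s => φ.normed volume (x - s) := rfl
    rw [h4] at h3
    rw [h3]; simp
  have hweak := h.weak _ hη hηc i
  simp only [hηd] at hweak
  have e1 : partialDeriv i (mollify φ w) x =
      ∫ t, partialDeriv i (φ.normed volume) t * w (x - t) := by
    simp only [partialDeriv, mollify]
    rw [hd.fderiv, convolution_def, ContinuousLinearMap.integral_apply hex]
    simp [ContinuousLinearMap.precompL_apply]
  rw [e1, mollify_apply]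
  have e2 : ∫ t, partialDeriv i (φ.normed volume) t * w (x - t) =
      ∫ s, w s * partialDeriv i (φ.normed volume) (x - s) := by
    rw [← integral_sub_left_eq_self _ volume x]
    simp [mul_comm]
  have e3 : ∫ t, φ.normed volume t * dw i (x - t) = ∫ s, dw i s * φ.normed volume (x - s) := by
    rw [← integral_sub_left_eq_self _ volume x]
    simp [mul_comm]
  rw [e2, e3]
  have : ∫ y, w y * -partialDeriv i (φ.normed volume) (x - y) =
      - ∫ y, w y * partialDeriv i (φ.normed volume) (x - y) := by
    rw [← integral_neg]; simp
  linarith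

/-- Functions in `W^{1,2}(ℝⁿ)` are limits of smooth functions supported nearby. -/
lemma HasWeakGrad.exists_approx {w : EuclideanSpace ℝ (Fin n) → ℝ}
    {dw : Fin n → EuclideanSpace ℝ (Fin n) → ℝ} (h : HasWeakGrad w dw) :
    ∃ f : ℕ → EuclideanSpace ℝ (Fin n) → ℝ, (∀ k, ContDiff ℝ ∞ (f k)) ∧
      (∀ k, tsupport (f k) ⊆ Metric.cthickening 1 (tsupport w)) ∧
      Tendsto (fun k => eLpNorm (f k - w) 2 volume) atTop (𝓝 0) ∧
      ∀ i, Tendsto (fun k => eLpNorm (partialDeriv i (f k) - dw i) 2 volume) atTop (𝓝 0) := by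
  refine ⟨fun k => mollify (shrinkingBump k) w, fun k => contDiff_mollify _
    (locallyIntegrable_of_memLp_two h.memLp), fun k => ?_, tendsto_eLpNorm_mollify_sub h.memLp,
    fun i => ?_⟩
  · exact (support_mollify_subset _ _).trans
      (Metric.cthickening_mono (shrinkingBump_rOut_le_one k) _)
  · have : ∀ k, partialDeriv i (mollify (shrinkingBump k) w) = mollify (shrinkingBump k) (dw i) :=
      fun k => funext fun x => partialDeriv_mollify h _ i x
    simp only [this]
    exact tendsto_eLpNorm_mollify_sub (h.memLp_grad i)

lemma abs_integral_mul_le {α : Type*} [MeasurableSpace α] {μ : Measure α} {f g : α → ℝ}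
    (hf : MemLp f 2 μ) (hg : MemLp g 2 μ) :
    |∫ x, f x * g x ∂μ| ≤ (eLpNorm f 2 μ).toReal * (eLpNorm g 2 μ).toReal := by
  have h := abs_real_inner_le_norm (hg.toLp g) (hf.toLp f)
  rw [L2.inner_def, Lp.norm_toLp, Lp.norm_toLp, mul_comm] at h
  refine le_trans (le_of_eq ?_) h
  congr 1
  refine integral_congr_ae ?_
  filter_upwards [hf.coeFn_toLp, hg.coeFn_toLp] with x h1 h2
  simp [h1, h2]

lemma toReal_eLpNorm_sq {α : Type*} [MeasurableSpace α] {μ : Measure α} {f : α → ℝ}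
    (hf : MemLp f 2 μ) : (eLpNorm f 2 μ).toReal ^ 2 = ∫ x, f x ^ 2 ∂μ := by
  rw [hf.eLpNorm_eq_integral_rpow_norm (by norm_num) (by norm_num), ENNReal.toReal_ofReal (by positivity),
    ← Real.rpow_natCast, ← Real.rpow_mul (by positivity)]
  norm_num

lemma tendsto_integral_mul_of_tendsto_eLpNorm {α : Type*} [MeasurableSpace α] {μ : Measure α}
    {f g : ℕ → α → ℝ} {f₀ g₀ : α → ℝ} (hf : ∀ k, MemLp (f k) 2 μ) (hg : ∀ k, MemLp (g k) 2 μ)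
    (hf₀ : MemLp f₀ 2 μ) (hg₀ : MemLp g₀ 2 μ)
    (hfl : Tendsto (fun k => eLpNorm (f k - f₀) 2 μ) atTop (𝓝 0))
    (hgl : Tendsto (fun k => eLpNorm (g k - g₀) 2 μ) atTop (𝓝 0)) :
    Tendsto (fun k => ∫ x, f k x * g k x ∂μ) atTop (𝓝 (∫ x, f₀ x * g₀ x ∂μ)) := by
  have h1 : Tendsto (fun k => (hf k).toLp (f k)) atTop (𝓝 (hf₀.toLp f₀)) :=
    (Lp.tendsto_Lp_iff_tendsto_eLpNorm'' _ hf _ hf₀).2 hfl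
  have h2 : Tendsto (fun k => (hg k).toLp (g k)) atTop (𝓝 (hg₀.toLp g₀)) :=
    (Lp.tendsto_Lp_iff_tendsto_eLpNorm'' _ hg _ hg₀).2 hgl
  have h3 := h2.inner h1 (𝕜 := ℝ)
  have h4 : ∀ {a b : α → ℝ} (ha : MemLp a 2 μ) (hb : MemLp b 2 μ),
      inner ℝ (hb.toLp b) (ha.toLp a) = ∫ x, a x * b x ∂μ := by
    intro a b ha hb
    rw [L2.inner_def]
    refine integral_congr_ae ?_
    filter_upwards [ha.coeFn_toLp, hb.coeFn_toLp] with x h1 h2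
    simp [h1, h2]
  simpa only [h4] using h3

end WeakGrad

/-! ### Weak gradients on open sets: localisation and integration by parts -/

section LocalWeakGrad

variable {n : ℕ}

/-- `du` is the weak gradient of `u` on `Ω`, both being locally square integrable there. -/
structure HasLocalWeakGrad (Ω : Set (EuclideanSpace ℝ (Fin n)))
    (u : EuclideanSpace ℝ (Fin n) → ℝ) (du : Fin n → EuclideanSpace ℝ (Fin n) → ℝ) : Prop where
  memLp : ∀ K ⊆ Ω, IsCompact K →
    MemLp u 2 (volume.restrict K) ∧ ∀ i, MemLp (du i) 2 (volume.restrict K)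
  weak : ∀ η : EuclideanSpace ℝ (Fin n) → ℝ, ContDiff ℝ ∞ η → HasCompactSupport η →
    tsupport η ⊆ Ω → ∀ i, ∫ y, u y * partialDeriv i η y = -∫ y, du i y * η y

lemma exists_smooth_cutoff {K Ω : Set (EuclideanSpace ℝ (Fin n))} (hK : IsCompact K)
    (hΩ : IsOpen Ω) (hKΩ : K ⊆ Ω) :
    ∃ ζ : EuclideanSpace ℝ (Fin n) → ℝ, ContDiff ℝ ∞ ζ ∧ HasCompactSupport ζ ∧ tsupport ζ ⊆ Ω ∧
      (∀ᶠ y in 𝓝ˢ K, ζ y = 1) ∧ ∀ y, ζ y ∈ Set.Icc (0 : ℝ) 1 := by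
  obtain ⟨L, hL, hKL, hLΩ⟩ := exists_compact_between hK hΩ hKΩ
  obtain ⟨f, h1, h2, h3⟩ := exists_contMDiffMap_one_nhds_of_subset_interior
    𝓘(ℝ, EuclideanSpace ℝ (Fin n)) (n := (⊤ : ℕ∞)) hK.isClosed hKL
  have hsupp : tsupport f ⊆ L := closure_minimal
    (fun x hx => by by_contra h; exact hx (h2 x h)) hL.isClosed
  exact ⟨f, f.contMDiff.contDiff, HasCompactSupport.of_support_subset_isCompact hL
    ((subset_tsupport _).trans hsupp), hsupp.trans hLΩ, h1, h3⟩

lemma continuous_partialDeriv {f : EuclideanSpace ℝ (Fin n) → ℝ} (hf : ContDiff ℝ 1 f) (i : Fin n) :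
    Continuous (partialDeriv i f) :=
  (hf.continuous_fderiv one_ne_zero).clm_apply continuous_const

lemma contDiff_partialDeriv {f : EuclideanSpace ℝ (Fin n) → ℝ} (hf : ContDiff ℝ ∞ f) (i : Fin n) :
    ContDiff ℝ ∞ (partialDeriv i f) :=
  (hf.fderiv_right (m := ∞) (by simp)).clm_apply contDiff_const

lemma tsupport_partialDeriv_subset (f : EuclideanSpace ℝ (Fin n) → ℝ) (i : Fin n) :
    tsupport (partialDeriv i f) ⊆ tsupport f := by
  refine closure_minimal (fun x hx => ?_) (isClosed_tsupport f)
  refine support_fderiv_subset ℝ (f := f) ?_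
  intro h
  exact hx (by simp [partialDeriv, h])

lemma partialDeriv_mul {f g : EuclideanSpace ℝ (Fin n) → ℝ} {y : EuclideanSpace ℝ (Fin n)}
    (hf : DifferentiableAt ℝ f y) (hg : DifferentiableAt ℝ g y) (i : Fin n) :
    partialDeriv i (fun z => f z * g z) y = f y * partialDeriv i g y + partialDeriv i f y * g y := by
  simp only [partialDeriv]
  rw [fderiv_fun_mul hf hg]
  simp; ring

lemma memLp_mul_of_tsupport {b u : EuclideanSpace ℝ (Fin n) → ℝ} (hb : Continuous b)
    (hc : HasCompactSupport b) (hu : MemLp u 2 (volume.restrict (tsupport b))) :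
    MemLp (fun y => b y * u y) 2 volume := by
  obtain ⟨C, hC⟩ := hb.bounded_above_of_compact_support hc
  have h1 : MemLp (fun y => b y * u y) 2 (volume.restrict (tsupport b)) :=
    hu.of_le_mul (c := C) (hb.aestronglyMeasurable.mul hu.1)
      (Eventually.of_forall fun y => by
        rw [norm_mul]; exact mul_le_mul_of_nonneg_right (hC y) (norm_nonneg _))
  have h2 : (fun y => b y * u y) = (tsupport b).indicator (fun y => b y * u y) := by
    ext y
    by_cases hy : y ∈ tsupport b
    · simp [hy]
    · simp [hy, image_eq_zero_of_notMem_tsupport hy]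
  rw [h2, memLp_indicator_iff_restrict (isClosed_tsupport b).measurableSet]
  exact h1

lemma HasLocalWeakGrad.integrable_mul {Ω : Set (EuclideanSpace ℝ (Fin n))}
    {u : EuclideanSpace ℝ (Fin n) → ℝ} {du : Fin n → EuclideanSpace ℝ (Fin n) → ℝ}
    (hu : HasLocalWeakGrad Ω u du) {b : EuclideanSpace ℝ (Fin n) → ℝ} (hb : Continuous b)
    (hc : HasCompactSupport b) (hs : tsupport b ⊆ Ω) :
    Integrable (fun y => b y * u y) ∧ ∀ i, Integrable (fun y => b y * du i y) := by
  have key : ∀ v : EuclideanSpace ℝ (Fin n) → ℝ, MemLp v 2 (volume.restrict (tsupport b)) →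
      Integrable (fun y => b y * v y) := by
    intro v hv
    have h := memLp_mul_of_tsupport hb hc hv
    have h2 : (fun y => b y * v y) = (tsupport b).indicator (fun y => b y * v y) := by
      ext y
      by_cases hy : y ∈ tsupport b
      · simp [hy]
      · simp [hy, image_eq_zero_of_notMem_tsupport hy]
    rw [h2, integrable_indicator_iff (isClosed_tsupport b).measurableSet]
    have : IsFiniteMeasure (volume.restrict (tsupport b)) :=
      ⟨by rw [Measure.restrict_apply_univ]; exact hc.isCompact.measure_lt_top⟩
    exact (h.restrict _).integrable (by norm_num)
  exact ⟨key u (hu.memLp _ hs hc).1, fun i => key _ ((hu.memLp _ hs hc).2 i)⟩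

/-- For any test function `η` on the whole space, `ζ η` is supported in `Ω` and may be tested
against `u`; the Leibniz rule moves `∂ᵢ ζ` to the other side. -/
lemma HasLocalWeakGrad.cutoff {Ω : Set (EuclideanSpace ℝ (Fin n))}
    {u : EuclideanSpace ℝ (Fin n) → ℝ} {du : Fin n → EuclideanSpace ℝ (Fin n) → ℝ}
    (hu : HasLocalWeakGrad Ω u du) {ζ : EuclideanSpace ℝ (Fin n) → ℝ} (hζ : ContDiff ℝ ∞ ζ)
    (hc : HasCompactSupport ζ) (hs : tsupport ζ ⊆ Ω) :
    HasWeakGrad (fun y => ζ y * u y) (fun i y => ζ y * du i y + partialDeriv i ζ y * u y) := by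
  have hm := hu.memLp _ hs hc
  have hpc : ∀ i, HasCompactSupport (partialDeriv i ζ) := fun i =>
    hc.of_isClosed_subset (isClosed_tsupport _) (tsupport_partialDeriv_subset ζ i)
  have hpm : ∀ i, MemLp u 2 (volume.restrict (tsupport (partialDeriv i ζ))) := fun i =>
    hm.1.mono_measure (Measure.restrict_mono (tsupport_partialDeriv_subset ζ i) le_rfl)
  refine ⟨memLp_mul_of_tsupport hζ.continuous hc hm.1, fun i =>
    (memLp_mul_of_tsupport hζ.continuous hc (hm.2 i)).add
      (memLp_mul_of_tsupport (contDiff_partialDeriv hζ i).continuous (hpc i) (hpm i)), ?_⟩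
  intro η hη hηc i
  have hs1 : tsupport (fun y => ζ y * η y) ⊆ Ω := (tsupport_mul_subset_left).trans hs
  have h1 := hu.weak (fun y => ζ y * η y) (hζ.mul hη) hc.mul_right hs1 i
  have hd : ∀ y, partialDeriv i (fun z => ζ z * η z) y =
      ζ y * partialDeriv i η y + partialDeriv i ζ y * η y := fun y =>
    partialDeriv_mul (hζ.differentiable (by simp)).differentiableAt
      (hη.differentiable (by simp)).differentiableAt i
  simp only [hd] at h1
  have i1 := (hu.integrable_mul (b := fun y => ζ y * partialDeriv i η y)
    (hζ.continuous.mul (contDiff_partialDeriv hη i).continuous) hc.mul_right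
    ((tsupport_mul_subset_left).trans hs)).1
  have i2 := (hu.integrable_mul (b := fun y => partialDeriv i ζ y * η y)
    ((contDiff_partialDeriv hζ i).continuous.mul hη.continuous) (hpc i).mul_right
    ((tsupport_mul_subset_left).trans ((tsupport_partialDeriv_subset ζ i).trans hs))).1
  have i3 := (hu.integrable_mul (b := fun y => ζ y * η y) (hζ.mul hη).continuous hc.mul_right
    hs1).2 i
  have e1 : ∫ y, u y * (ζ y * partialDeriv i η y + partialDeriv i ζ y * η y) =
      (∫ y, ζ y * partialDeriv i η y * u y) + ∫ y, partialDeriv i ζ y * η y * u y := by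
    rw [← integral_add i1 i2]; congr 1; ext y; ring
  have e2 : ∫ y, (ζ y * du i y + partialDeriv i ζ y * u y) * η y =
      (∫ y, ζ y * η y * du i y) + ∫ y, partialDeriv i ζ y * η y * u y := by
    rw [← integral_add i3 i2]; congr 1; ext y; ring
  have e3 : ∫ y, ζ y * u y * partialDeriv i η y = ∫ y, ζ y * partialDeriv i η y * u y := by
    congr 1; ext y; ring
  have e4 : ∫ y, du i y * (ζ y * η y) = ∫ y, ζ y * η y * du i y := by
    congr 1; ext y; ring
  rw [e2, e3]; rw [e1, e4] at h1; linarith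

lemma tendsto_eLpNorm_mul_sub {b : EuclideanSpace ℝ (Fin n) → ℝ} (hb : Continuous b)
    (hc : HasCompactSupport b) {g : ℕ → EuclideanSpace ℝ (Fin n) → ℝ}
    {g₀ : EuclideanSpace ℝ (Fin n) → ℝ}
    (h : Tendsto (fun k => eLpNorm (g k - g₀) 2 volume) atTop (𝓝 0)) :
    Tendsto (fun k => eLpNorm ((fun y => b y * g k y) - fun y => b y * g₀ y) 2 volume) atTop
      (𝓝 0) := by
  obtain ⟨C, hC⟩ := hb.bounded_above_of_compact_support hc
  have h1 : Tendsto (fun k => ENNReal.ofReal C * eLpNorm (g k - g₀) 2 volume) atTop (𝓝 0) := by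
    simpa using ENNReal.Tendsto.const_mul h (Or.inr ENNReal.ofReal_ne_top)
  refine tendsto_of_tendsto_of_tendsto_of_le_of_le tendsto_const_nhds h1 (fun _ => zero_le)
    fun k => ?_
  refine eLpNorm_le_mul_eLpNorm_of_ae_le_mul (Eventually.of_forall fun y => ?_) 2
  simp only [Pi.sub_apply, ← mul_sub, norm_mul]
  exact mul_le_mul_of_nonneg_right (hC y) (norm_nonneg _)

/-- Integration by parts of `F ∂ᵢ(u²)` for a Sobolev function `u`. -/
lemma HasLocalWeakGrad.integral_sq_mul_partialDeriv {Ω : Set (EuclideanSpace ℝ (Fin n))}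
    (hΩ : IsOpen Ω)
    {u : EuclideanSpace ℝ (Fin n) → ℝ} {du : Fin n → EuclideanSpace ℝ (Fin n) → ℝ}
    (hu : HasLocalWeakGrad Ω u du) {F : EuclideanSpace ℝ (Fin n) → ℝ} (hF : ContDiff ℝ 1 F)
    (hc : HasCompactSupport F) (hs : tsupport F ⊆ Ω) (i : Fin n) :
    Integrable (fun y => 2 * u y * du i y * F y + u y ^ 2 * partialDeriv i F y) ∧
      ∫ y, (2 * u y * du i y * F y + u y ^ 2 * partialDeriv i F y) = 0 := by
  -- As `ζ = 1` near the support of `F`, replacing `u` by `ζ u` changes neither integrand, and `ζ u`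
  -- is a limit of smooth functions in `W^{1,2}(ℝⁿ)`.
  obtain ⟨ζ, hζ, hζc, hζs, hζ1, -⟩ := exists_smooth_cutoff hc.isCompact hΩ hs
  have hw := hu.cutoff hζ hζc hζs
  set w := fun y => ζ y * u y with hwdef
  set dw := fun (i : Fin n) y => ζ y * du i y + partialDeriv i ζ y * u y with hdwdef
  obtain ⟨f, hf, hfs, hfw, hfdw⟩ := hw.exists_approx
  have hwc : HasCompactSupport w := hζc.mul_right
  have hfc : ∀ k, HasCompactSupport (f k) := fun k =>
    (hwc.isCompact.cthickening (r := 1)).of_isClosed_subset (isClosed_tsupport _) (hfs k)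
  have hpF : Continuous (partialDeriv i F) := continuous_partialDeriv hF i
  have hpFc : HasCompactSupport (partialDeriv i F) :=
    hc.of_isClosed_subset (isClosed_tsupport _) (tsupport_partialDeriv_subset F i)
  have hpf : ∀ k, Continuous (partialDeriv i (f k)) := fun k =>
    (contDiff_partialDeriv (hf k) i).continuous
  have hpfc : ∀ k, HasCompactSupport (partialDeriv i (f k)) := fun k =>
    (hfc k).of_isClosed_subset (isClosed_tsupport _) (tsupport_partialDeriv_subset _ i)
  have mf : ∀ k, MemLp (f k) 2 volume := fun k =>
    (hf k).continuous.memLp_of_hasCompactSupport (hfc k)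
  have mFf : ∀ k, MemLp (fun y => F y * partialDeriv i (f k) y) 2 volume := fun k =>
    (hF.continuous.mul (hpf k)).memLp_of_hasCompactSupport hc.mul_right
  have mPf : ∀ k, MemLp (fun y => partialDeriv i F y * f k y) 2 volume := fun k =>
    (hpF.mul (hf k).continuous).memLp_of_hasCompactSupport hpFc.mul_right
  have mF : MemLp (fun y => F y * dw i y) 2 volume :=
    memLp_mul_of_tsupport hF.continuous hc ((hw.memLp_grad i).restrict _)
  have mP : MemLp (fun y => partialDeriv i F y * w y) 2 volume :=
    memLp_mul_of_tsupport hpF hpFc (hw.memLp.restrict _)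
  have l1 := tendsto_integral_mul_of_tendsto_eLpNorm mf mFf hw.memLp mF hfw
    (tendsto_eLpNorm_mul_sub hF.continuous hc (hfdw i))
  have l2 := tendsto_integral_mul_of_tendsto_eLpNorm mf mPf hw.memLp mP hfw
    (tendsto_eLpNorm_mul_sub hpF hpFc hfw)
  -- For smooth `f`, this is `∫ ∂ᵢ(f² F) = 0`, obtained by integrating `(f F) ∂ᵢ f` by parts. Each
  -- integrand is a product of two factors converging in `L²`, so the identity passes to the limit.
  have hzero : ∀ k, 2 * (∫ y, f k y * (F y * partialDeriv i (f k) y)) +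
      ∫ y, f k y * (partialDeriv i F y * f k y) = 0 := by
    intro k
    have hd : ∀ y, fderiv ℝ (fun z => f k z * F z) y (stdVec i) =
        f k y * partialDeriv i F y + partialDeriv i (f k) y * F y := fun y =>
      partialDeriv_mul ((hf k).differentiable (by simp)).differentiableAt
        (hF.differentiable (by simp)).differentiableAt i
    have i1 : Integrable fun y => f k y * (F y * partialDeriv i (f k) y) :=
      ((hf k).continuous.mul (hF.continuous.mul (hpf k))).integrable_of_hasCompactSupport
        (hfc k).mul_right
    have i2 : Integrable fun y => f k y * (partialDeriv i F y * f k y) :=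
      ((hf k).continuous.mul (hpF.mul (hf k).continuous)).integrable_of_hasCompactSupport
        (hfc k).mul_right
    have h := integral_mul_fderiv_eq_neg_fderiv_mul_of_integrable (μ := volume)
      (f := fun z => f k z * F z) (g := f k) (v := stdVec i)
      (by
        simp only [hd]
        convert! i2.add i1 using 1
        ext y; simp only [Pi.add_apply]; ring)
      (by convert! i1 using 1; ext y; simp only [partialDeriv]; ring)
      (((hf k).continuous.mul hF.continuous).mul (hf k).continuous
        |>.integrable_of_hasCompactSupport (hfc k).mul_left)
      (fun x _ => (((hf k).differentiable (by simp)).mul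
        (hF.differentiable (by simp))).differentiableAt)
      (fun x _ => ((hf k).differentiable (by simp)).differentiableAt)
    simp only [hd] at h
    have e1 : ∫ y, f k y * F y * fderiv ℝ (f k) y (stdVec i) =
        ∫ y, f k y * (F y * partialDeriv i (f k) y) := by
      congr 1; ext y; simp only [partialDeriv]; ring
    have e2 : ∫ y, (f k y * partialDeriv i F y + partialDeriv i (f k) y * F y) * f k y =
        (∫ y, f k y * (partialDeriv i F y * f k y)) +
          ∫ y, f k y * (F y * partialDeriv i (f k) y) := by
      rw [← integral_add i2 i1]; congr 1; ext y; ring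
    rw [e1, e2] at h; linarith
  have hlim := (l1.const_mul 2).add l2
  simp only [hzero] at hlim
  have hz := tendsto_nhds_unique hlim tendsto_const_nhds
  have i1 : Integrable fun y => w y * (F y * dw i y) := hw.memLp.integrable_mul mF
  have i2 : Integrable fun y => w y * (partialDeriv i F y * w y) := hw.memLp.integrable_mul mP
  rw [← integral_const_mul, ← integral_add (i1.const_mul 2) i2] at hz
  suffices hfun : (fun y => 2 * u y * du i y * F y + u y ^ 2 * partialDeriv i F y) =
      fun y => 2 * (w y * (F y * dw i y)) + w y * (partialDeriv i F y * w y) by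
    rw [hfun]
    exact ⟨(i1.const_mul 2).add i2, hz⟩
  ext y
  by_cases hy : y ∈ tsupport F
  · have h1 : ∀ᶠ z in 𝓝 y, ζ z = 1 := hζ1.filter_mono (nhds_le_nhdsSet hy)
    have h2 : partialDeriv i ζ y = 0 := by
      have : ζ =ᶠ[𝓝 y] fun _ => (1 : ℝ) := h1
      simp [partialDeriv, this.fderiv_eq]
    simp only [hwdef, hdwdef, h1.self_of_nhds, h2]; ring
  · have h1 : y ∉ tsupport (partialDeriv i F) := fun h => hy (tsupport_partialDeriv_subset F i h)
    simp [image_eq_zero_of_notMem_tsupport hy, image_eq_zero_of_notMem_tsupport h1]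

end LocalWeakGrad

/-! ### Rellich's compactness theorem by the Fourier transform -/

section Rellich

variable {n : ℕ}

open scoped FourierTransform SchwartzMap LineDeriv

/-- A real test function as a complex Schwartz function. -/
def testSchwartz (f : EuclideanSpace ℝ (Fin n) → ℝ) (hf : ContDiff ℝ ∞ f)
    (hc : HasCompactSupport f) : 𝓢(EuclideanSpace ℝ (Fin n), ℂ) :=
  HasCompactSupport.toSchwartzMap (f := fun y => (f y : ℂ))
    (hc.comp_left Complex.ofReal_zero) (Complex.ofRealCLM.contDiff.comp hf)

lemma testSchwartz_apply (f : EuclideanSpace ℝ (Fin n) → ℝ) (hf : ContDiff ℝ ∞ f)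
    (hc : HasCompactSupport f) (y : EuclideanSpace ℝ (Fin n)) :
    testSchwartz f hf hc y = (f y : ℂ) := rfl

lemma lineDeriv_testSchwartz (f : EuclideanSpace ℝ (Fin n) → ℝ) (hf : ContDiff ℝ ∞ f)
    (hc : HasCompactSupport f) (i : Fin n) (y : EuclideanSpace ℝ (Fin n)) :
    (∂_{stdVec i} (testSchwartz f hf hc)) y = (partialDeriv i f y : ℂ) := by
  rw [SchwartzMap.lineDerivOp_apply_eq_fderiv]
  have h1 : HasFDerivAt (fun y => (f y : ℂ)) (Complex.ofRealCLM.comp (fderiv ℝ f y)) y :=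
    Complex.ofRealCLM.hasFDerivAt.comp y (hf.differentiable (by simp)).differentiableAt.hasFDerivAt
  have h2 : (testSchwartz f hf hc : EuclideanSpace ℝ (Fin n) → ℂ) = fun y => (f y : ℂ) := rfl
  rw [h2, h1.fderiv]
  rfl

lemma integral_norm_sq_fourier_testSchwartz (f : EuclideanSpace ℝ (Fin n) → ℝ)
    (hf : ContDiff ℝ ∞ f) (hc : HasCompactSupport f) :
    ∫ ξ, ‖𝓕 (testSchwartz f hf hc) ξ‖ ^ 2 = ∫ y, f y ^ 2 := by
  rw [SchwartzMap.integral_norm_sq_fourier]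
  simp [testSchwartz_apply]

lemma integral_mul_norm_sq_fourier_testSchwartz (f : EuclideanSpace ℝ (Fin n) → ℝ)
    (hf : ContDiff ℝ ∞ f) (hc : HasCompactSupport f) (i : Fin n) :
    Integrable (fun ξ : EuclideanSpace ℝ (Fin n) =>
      (2 * Real.pi) ^ 2 * ξ i ^ 2 * ‖𝓕 (testSchwartz f hf hc) ξ‖ ^ 2) ∧
    ∫ ξ : EuclideanSpace ℝ (Fin n),
      (2 * Real.pi) ^ 2 * ξ i ^ 2 * ‖𝓕 (testSchwartz f hf hc) ξ‖ ^ 2 =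
      ∫ y, partialDeriv i f y ^ 2 := by
  have htg : (fun ξ : EuclideanSpace ℝ (Fin n) => inner ℝ ξ (stdVec i)).HasTemperateGrowth :=
    ((innerSL ℝ).flip (stdVec i)).hasTemperateGrowth
  have hF : ∀ ξ : EuclideanSpace ℝ (Fin n),
      ‖𝓕 (∂_{stdVec i} (testSchwartz f hf hc)) ξ‖ ^ 2 =
      (2 * Real.pi) ^ 2 * ξ i ^ 2 * ‖𝓕 (testSchwartz f hf hc) ξ‖ ^ 2 := by
    intro ξ
    rw [SchwartzMap.fourier_lineDerivOp_eq, _root_.smul_apply,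
      SchwartzMap.smulLeftCLM_apply_apply htg]
    simp only [norm_smul, mul_pow, norm_mul, Complex.norm_I, Complex.norm_real]
    simp [EuclideanSpace.inner_single_right]
    ring
  constructor
  · have h := (SchwartzMap.memLp (𝓕 (∂_{stdVec i} (testSchwartz f hf hc))) 2
      (volume : Measure (EuclideanSpace ℝ (Fin n)))).integrable_norm_pow (by norm_num)
    simpa only [hF, ENNReal.toReal_ofNat] using h
  · simp only [← hF]
    rw [SchwartzMap.integral_norm_sq_fourier]
    simp [lineDeriv_testSchwartz]

/-- At a fixed frequency the Fourier transform is a pairing with the real and imaginary parts of a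
character. These are not in `L²`, but their truncations to `K` are, and the truncation is invisible
to functions supported in `K`. -/
lemma tendsto_fourier_testSchwartz {K : Set (EuclideanSpace ℝ (Fin n))} (hK : IsCompact K)
    {f : ℕ → EuclideanSpace ℝ (Fin n) → ℝ} (hf : ∀ k, ContDiff ℝ ∞ (f k))
    (hc : ∀ k, HasCompactSupport (f k)) (hs : ∀ k, tsupport (f k) ⊆ K)
    (hweak : ∀ g : EuclideanSpace ℝ (Fin n) → ℝ, MemLp g 2 volume →
      Tendsto (fun k => ∫ y, f k y * g y) atTop (𝓝 0)) (ξ : EuclideanSpace ℝ (Fin n)) :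
    Tendsto (fun k => 𝓕 (testSchwartz (f k) (hf k) (hc k)) ξ) atTop (𝓝 0) := by
  set e : EuclideanSpace ℝ (Fin n) → ℂ := fun v => (Real.fourierChar (-inner ℝ v ξ) : ℂ) with he
  have hecont : Continuous e := by
    rw [he]
    exact continuous_induced_dom.comp (Real.continuous_fourierChar.comp
      ((continuous_id.inner continuous_const).neg))
  have hmem : ∀ h : EuclideanSpace ℝ (Fin n) → ℝ, Continuous h →
      MemLp (K.indicator h) 2 volume := by
    intro h hh
    rw [memLp_indicator_iff_restrict hK.measurableSet]
    have : IsFiniteMeasure (volume.restrict K) :=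
      ⟨by rw [Measure.restrict_apply_univ]; exact hK.measure_lt_top⟩
    obtain ⟨D, hD⟩ := hK.exists_bound_of_continuousOn hh.continuousOn
    exact MemLp.of_bound hh.aestronglyMeasurable D
      ((ae_restrict_iff' hK.measurableSet).2 (Eventually.of_forall hD))
  have h1 := hweak _ (hmem _ (Complex.continuous_re.comp hecont))
  have h2 := hweak _ (hmem _ (Complex.continuous_im.comp hecont))
  have key : ∀ k, 𝓕 (testSchwartz (f k) (hf k) (hc k)) ξ =
      ((∫ y, f k y * K.indicator (Complex.re ∘ e) y : ℝ) : ℂ) +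
      ((∫ y, f k y * K.indicator (Complex.im ∘ e) y : ℝ) : ℂ) * Complex.I := by
    intro k
    have hint : ∀ h : EuclideanSpace ℝ (Fin n) → ℝ, Continuous h →
        Integrable fun y => ((f k y * h y : ℝ) : ℂ) := fun h hh =>
      (((hf k).continuous.mul hh).integrable_of_hasCompactSupport (hc k).mul_right).ofReal
    have hind : ∀ h : EuclideanSpace ℝ (Fin n) → ℝ,
        (∫ y, f k y * K.indicator h y) = ∫ y, f k y * h y := by
      intro h
      congr 1; ext y
      by_cases hy : y ∈ K
      · simp [hy]
      · simp [image_eq_zero_of_notMem_tsupport fun h => hy (hs k h)]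
    rw [hind, hind, ← integral_complex_ofReal, ← integral_complex_ofReal, ← integral_mul_const,
      ← integral_add (hint _ (Complex.continuous_re.comp hecont))
        ((hint _ (Complex.continuous_im.comp hecont)).mul_const _),
      SchwartzMap.fourier_coe, Real.fourier_eq]
    congr 1; ext y
    rw [Circle.smul_def, testSchwartz_apply]
    have : e y = ((e y).re : ℂ) + ((e y).im : ℂ) * Complex.I := (Complex.re_add_im _).symm
    change e y * (f k y : ℂ) = _
    rw [this]
    push_cast
    simp only [Function.comp]
    ring
  simp only [key]
  have h3 := (Complex.continuous_ofReal.tendsto 0).comp h1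
  have h4 := ((Complex.continuous_ofReal.tendsto 0).comp h2).mul_const Complex.I
  simpa using h3.add h4

lemma norm_fourier_testSchwartz_le (f : EuclideanSpace ℝ (Fin n) → ℝ)
    (hf : ContDiff ℝ ∞ f) (hc : HasCompactSupport f) (ξ : EuclideanSpace ℝ (Fin n)) :
    ‖𝓕 (testSchwartz f hf hc) ξ‖ ≤ ∫ y, |f y| := by
  rw [SchwartzMap.fourier_coe, Real.fourier_eq]
  refine (norm_integral_le_integral_norm _).trans (le_of_eq ?_)
  congr 1; ext y
  simp [testSchwartz_apply]

/-- By Plancherel it suffices to treat the Fourier transforms. On a ball of radius `R` they are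
uniformly bounded and tend to zero pointwise, so dominated convergence applies. Outside it, the
bound on the gradients gives at most `n C / (2πR)²`, uniformly in `k`. -/
lemma tendsto_integral_sq_of_contDiff {K : Set (EuclideanSpace ℝ (Fin n))} (hK : IsCompact K)
    {f : ℕ → EuclideanSpace ℝ (Fin n) → ℝ} (hf : ∀ k, ContDiff ℝ ∞ (f k))
    (hs : ∀ k, tsupport (f k) ⊆ K) {C : ℝ} (hC : ∀ k, ∫ y, f k y ^ 2 ≤ C)
    (hCd : ∀ k i, ∫ y, partialDeriv i (f k) y ^ 2 ≤ C)
    (hweak : ∀ g : EuclideanSpace ℝ (Fin n) → ℝ, MemLp g 2 volume →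
      Tendsto (fun k => ∫ y, f k y * g y) atTop (𝓝 0)) :
    Tendsto (fun k => ∫ y, f k y ^ 2) atTop (𝓝 0) := by
  have hc : ∀ k, HasCompactSupport (f k) := fun k =>
    hK.of_isClosed_subset (isClosed_tsupport _) (hs k)
  have hC0 : 0 ≤ C := (integral_nonneg fun y => sq_nonneg (f 0 y)).trans (hC 0)
  set F : ℕ → EuclideanSpace ℝ (Fin n) → ℂ := fun k ξ => 𝓕 (testSchwartz (f k) (hf k) (hc k)) ξ
    with hFdef
  have hFint : ∀ k, Integrable fun ξ => ‖F k ξ‖ ^ 2 := by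
    intro k
    have h := (SchwartzMap.memLp (𝓕 (testSchwartz (f k) (hf k) (hc k))) 2
      (volume : Measure (EuclideanSpace ℝ (Fin n)))).integrable_norm_pow (by norm_num)
    simpa only [ENNReal.toReal_ofNat] using h
  have hFcont : ∀ k, Continuous (F k) := fun k =>
    (𝓕 (testSchwartz (f k) (hf k) (hc k))).continuous
  -- Cauchy–Schwarz on `K` bounds the `L¹` norm of `f k`, hence its Fourier transform everywhere.
  set B : ℝ := Real.sqrt C * (eLpNorm (K.indicator fun _ => (1 : ℝ)) 2 volume).toReal
  have hone : MemLp (K.indicator fun _ => (1 : ℝ)) 2 (volume : Measure (EuclideanSpace ℝ (Fin n))) :=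
    memLp_indicator_const 2 hK.measurableSet 1 (Or.inr hK.measure_lt_top.ne)
  have hB : ∀ k ξ, ‖F k ξ‖ ≤ B := by
    intro k ξ
    refine (norm_fourier_testSchwartz_le _ _ _ ξ).trans ?_
    have hm : MemLp (fun y => |f k y|) 2 volume :=
      ((hf k).continuous.abs).memLp_of_hasCompactSupport
        ((hc k).comp_left (g := fun t : ℝ => |t|) abs_zero)
    have h1 : ∫ y, |f k y| = ∫ y, |f k y| * K.indicator (fun _ => (1 : ℝ)) y := by
      congr 1; ext y
      by_cases hy : y ∈ K
      · simp [hy]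
      · simp [image_eq_zero_of_notMem_tsupport fun h => hy (hs k h)]
    rw [h1]
    refine (le_abs_self _).trans ((abs_integral_mul_le hm hone).trans ?_)
    refine mul_le_mul_of_nonneg_right ?_ ENNReal.toReal_nonneg
    refine Real.le_sqrt_of_sq_le ?_
    rw [toReal_eLpNorm_sq hm]
    simpa using hC k
  have hball : ∀ R : ℝ, Tendsto (fun k => ∫ ξ in Metric.ball (0 : EuclideanSpace ℝ (Fin n)) R,
      ‖F k ξ‖ ^ 2) atTop (𝓝 0) := by
    intro R
    have : Tendsto (fun k => ∫ ξ in Metric.ball (0 : EuclideanSpace ℝ (Fin n)) R,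
        ‖F k ξ‖ ^ 2) atTop (𝓝 (∫ ξ in Metric.ball (0 : EuclideanSpace ℝ (Fin n)) R, (0 : ℝ))) := by
      refine tendsto_integral_of_dominated_convergence (fun _ => B ^ 2)
        (fun k => ((hFcont k).norm.pow 2).aestronglyMeasurable) ?_ ?_ ?_
      · have : IsFiniteMeasure ((volume : Measure (EuclideanSpace ℝ (Fin n))).restrict
            (Metric.ball 0 R)) :=
          ⟨by rw [Measure.restrict_apply_univ]; exact measure_ball_lt_top⟩
        exact integrable_const _
      · intro k
        refine Eventually.of_forall fun ξ => ?_
        rw [Real.norm_of_nonneg (by positivity)]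
        exact pow_le_pow_left₀ (norm_nonneg _) (hB k ξ) 2
      · refine Eventually.of_forall fun ξ => ?_
        have := (tendsto_fourier_testSchwartz hK hf hc hs hweak ξ).norm.pow 2
        simpa using this
    simpa using this
  have hout : ∀ R : ℝ, 0 < R → ∀ k,
      ∫ ξ in (Metric.ball (0 : EuclideanSpace ℝ (Fin n)) R)ᶜ, ‖F k ξ‖ ^ 2 ≤
        n * C / ((2 * Real.pi) ^ 2 * R ^ 2) := by
    intro R hR k
    have hI : ∀ i : Fin n, Integrable fun ξ : EuclideanSpace ℝ (Fin n) =>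
        (2 * Real.pi) ^ 2 * ξ i ^ 2 * ‖F k ξ‖ ^ 2 := fun i =>
      (integral_mul_norm_sq_fourier_testSchwartz (f k) (hf k) (hc k) i).1
    have hS : Integrable fun ξ : EuclideanSpace ℝ (Fin n) =>
        ∑ i, (2 * Real.pi) ^ 2 * ξ i ^ 2 * ‖F k ξ‖ ^ 2 := integrable_finsetSum _ fun i _ => hI i
    have hpos : 0 < (2 * Real.pi) ^ 2 * R ^ 2 := by positivity
    rw [le_div_iff₀ hpos, ← integral_mul_const]
    calc ∫ ξ in (Metric.ball (0 : EuclideanSpace ℝ (Fin n)) R)ᶜ,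
          ‖F k ξ‖ ^ 2 * ((2 * Real.pi) ^ 2 * R ^ 2)
        ≤ ∫ ξ in (Metric.ball (0 : EuclideanSpace ℝ (Fin n)) R)ᶜ,
          ∑ i, (2 * Real.pi) ^ 2 * ξ i ^ 2 * ‖F k ξ‖ ^ 2 := by
          refine setIntegral_mono_on ((hFint k).mul_const _).integrableOn hS.integrableOn
            Metric.isOpen_ball.measurableSet.compl fun ξ hξ => ?_
          have h1 : R ≤ ‖ξ‖ := by simpa using hξ
          have h2 : R ^ 2 ≤ ‖ξ‖ ^ 2 := pow_le_pow_left₀ hR.le h1 2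
          rw [EuclideanSpace.real_norm_sq_eq] at h2
          rw [← Finset.sum_mul, ← Finset.mul_sum, mul_comm]
          refine mul_le_mul_of_nonneg_right ?_ (by positivity)
          exact mul_le_mul_of_nonneg_left h2 (by positivity)
      _ ≤ ∫ ξ, ∑ i, (2 * Real.pi) ^ 2 * ξ i ^ 2 * ‖F k ξ‖ ^ 2 :=
          setIntegral_le_integral hS (Eventually.of_forall fun ξ =>
            Finset.sum_nonneg fun i _ => by positivity)
      _ = ∑ i, ∫ y, partialDeriv i (f k) y ^ 2 := by
          rw [integral_finsetSum _ fun i _ => hI i]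
          exact Finset.sum_congr rfl fun i _ =>
            (integral_mul_norm_sq_fourier_testSchwartz (f k) (hf k) (hc k) i).2
      _ ≤ n * C := by
          refine (Finset.sum_le_sum fun i _ => hCd k i).trans (le_of_eq ?_)
          simp
  rw [Metric.tendsto_atTop]
  intro ε hε
  obtain ⟨R, hR, hRε⟩ : ∃ R : ℝ, 0 < R ∧ n * C / ((2 * Real.pi) ^ 2 * R ^ 2) < ε / 2 := by
    have h1 : Tendsto (fun R : ℝ => n * C / ((2 * Real.pi) ^ 2 * R ^ 2)) atTop (𝓝 0) := by
      refine Tendsto.div_atTop tendsto_const_nhds ?_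
      exact (tendsto_pow_atTop two_ne_zero).const_mul_atTop (by positivity)
    obtain ⟨R, h2, h3⟩ := ((h1.eventually (gt_mem_nhds (half_pos hε))).and
      (eventually_gt_atTop 0)).exists
    exact ⟨R, h3, h2⟩
  obtain ⟨N, hN⟩ := (Metric.tendsto_atTop.1 (hball R)) (ε / 2) (half_pos hε)
  refine ⟨N, fun k hk => ?_⟩
  have h1 := hN k hk
  rw [Real.dist_eq, sub_zero] at h1 ⊢
  rw [abs_of_nonneg (integral_nonneg fun _ => by positivity)] at h1 ⊢
  rw [← integral_norm_sq_fourier_testSchwartz (f k) (hf k) (hc k),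
    ← integral_add_compl Metric.isOpen_ball.measurableSet (hFint k)]
  linarith [hout R hR k]

/-- **Rellich's theorem**: a sequence which is bounded in `W^{1,2}(ℝⁿ)`, supported in a fixed compact
set and weakly null in `L²` converges to zero in `L²`. -/
theorem tendsto_integral_sq_of_hasWeakGrad {K : Set (EuclideanSpace ℝ (Fin n))} (hK : IsCompact K)
    {w : ℕ → EuclideanSpace ℝ (Fin n) → ℝ} {dw : ℕ → Fin n → EuclideanSpace ℝ (Fin n) → ℝ}
    (hw : ∀ k, HasWeakGrad (w k) (dw k)) (hs : ∀ k, tsupport (w k) ⊆ K) {C : ℝ}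
    (hC : ∀ k, (eLpNorm (w k) 2 volume).toReal ≤ C)
    (hCd : ∀ k i, (eLpNorm (dw k i) 2 volume).toReal ≤ C)
    (hweak : ∀ g : EuclideanSpace ℝ (Fin n) → ℝ, MemLp g 2 volume →
      Tendsto (fun k => ∫ y, w k y * g y) atTop (𝓝 0)) :
    Tendsto (fun k => ∫ y, w k y ^ 2) atTop (𝓝 0) := by
  set K' := Metric.cthickening 1 K
  have hK' : IsCompact K' := hK.cthickening
  -- One smooth approximation per index, with `L²` error tending to zero. For the gradients only a
  -- uniform bound is needed, so an error of `1` is good enough.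
  have hex : ∀ k : ℕ, ∃ f : EuclideanSpace ℝ (Fin n) → ℝ, ContDiff ℝ ∞ f ∧ tsupport f ⊆ K' ∧
      (eLpNorm (f - w k) 2 volume).toReal ≤ 1 / ((k : ℝ) + 1) ∧
      ∀ i, (eLpNorm (partialDeriv i f - dw k i) 2 volume).toReal ≤ 1 := by
    intro k
    obtain ⟨f, h1, h2, h3, h4⟩ := (hw k).exists_approx
    have e3 := ((ENNReal.tendsto_toReal ENNReal.zero_ne_top).comp h3).eventually
      (ge_mem_nhds (show (0 : ℝ≥0∞).toReal < 1 / ((k : ℝ) + 1) by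
        rw [ENNReal.toReal_zero]; positivity))
    have e4 : ∀ i, ∀ᶠ j in atTop, (eLpNorm (partialDeriv i (f j) - dw k i) 2 volume).toReal ≤ 1 :=
      fun i => ((ENNReal.tendsto_toReal ENNReal.zero_ne_top).comp (h4 i)).eventually
        (ge_mem_nhds (by simp))
    obtain ⟨j, hj, hj'⟩ := (e3.and (eventually_all.2 e4)).exists
    exact ⟨f j, h1 j, (h2 j).trans (Metric.cthickening_subset_of_subset 1 (hs k)), hj, hj'⟩
  choose f hf hfs hfw hfdw using hex
  have hfc : ∀ k, HasCompactSupport (f k) := fun k =>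
    hK'.of_isClosed_subset (isClosed_tsupport _) (hfs k)
  have mf : ∀ k, MemLp (f k) 2 volume := fun k =>
    (hf k).continuous.memLp_of_hasCompactSupport (hfc k)
  have mdf : ∀ k i, MemLp (partialDeriv i (f k)) 2 volume := fun k i =>
    (contDiff_partialDeriv (hf k) i).continuous.memLp_of_hasCompactSupport
      ((hfc k).of_isClosed_subset (isClosed_tsupport _) (tsupport_partialDeriv_subset _ i))
  have tri : ∀ {a b : EuclideanSpace ℝ (Fin n) → ℝ}, MemLp a 2 volume → MemLp b 2 volume →
      (eLpNorm a 2 volume).toReal ≤ (eLpNorm (a - b) 2 volume).toReal +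
        (eLpNorm b 2 volume).toReal := by
    intro a b ha hb
    rw [← ENNReal.toReal_add (ha.sub hb).eLpNorm_ne_top hb.eLpNorm_ne_top]
    refine ENNReal.toReal_mono (ENNReal.add_ne_top.2
      ⟨(ha.sub hb).eLpNorm_ne_top, hb.eLpNorm_ne_top⟩) ?_
    have := eLpNorm_add_le (ha.sub hb).1 hb.1 (p := 2) (by norm_num)
    simpa using this
  have hone : ∀ k : ℕ, 1 / ((k : ℝ) + 1) ≤ 1 := fun k => by
    rw [div_le_one (by positivity)]; linarith [(Nat.cast_nonneg k : (0:ℝ) ≤ k)]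
  have hsq : ∀ {a : EuclideanSpace ℝ (Fin n) → ℝ}, MemLp a 2 volume →
      (eLpNorm a 2 volume).toReal ≤ 1 + C → ∫ y, a y ^ 2 ≤ (1 + C) ^ 2 := by
    intro a ha h
    rw [← toReal_eLpNorm_sq ha]
    exact pow_le_pow_left₀ ENNReal.toReal_nonneg h 2
  have hdiff : Tendsto (fun k => (eLpNorm (f k - w k) 2 volume).toReal) atTop (𝓝 0) :=
    squeeze_zero (fun _ => ENNReal.toReal_nonneg) hfw tendsto_one_div_add_atTop_nhds_zero_nat
  have hfweak : ∀ g : EuclideanSpace ℝ (Fin n) → ℝ, MemLp g 2 volume →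
      Tendsto (fun k => ∫ y, f k y * g y) atTop (𝓝 0) := by
    intro g hg
    have h1 : Tendsto (fun k => ∫ y, (f k - w k) y * g y) atTop (𝓝 0) := by
      refine squeeze_zero_norm (fun k => abs_integral_mul_le ((mf k).sub (hw k).memLp) hg) ?_
      simpa using hdiff.mul_const (eLpNorm g 2 volume).toReal
    have h2 := h1.add (hweak g hg)
    rw [add_zero] at h2
    refine h2.congr fun k => ?_
    have i1 := ((mf k).sub (hw k).memLp).integrable_mul hg
    have i2 := (hw k).memLp.integrable_mul hg
    have := integral_add i1 i2
    simp only [Pi.mul_apply] at this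
    rw [← this]
    congr 1; ext y; simp only [Pi.sub_apply]; ring
  have hlim := tendsto_integral_sq_of_contDiff hK' hf hfs (C := (1 + C) ^ 2)
    (fun k => hsq (mf k) ((tri (mf k) (hw k).memLp).trans
      (add_le_add ((hfw k).trans (hone k)) (hC k))))
    (fun k i => hsq (mdf k i) ((tri (mdf k i) ((hw k).memLp_grad i)).trans
      (add_le_add (hfdw k i) (hCd k i)))) hfweak
  have hlim2 : Tendsto (fun k => (eLpNorm (f k) 2 volume).toReal) atTop (𝓝 0) := by
    have := hlim.sqrt
    rw [Real.sqrt_zero] at this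
    refine this.congr fun k => ?_
    rw [← toReal_eLpNorm_sq (mf k), Real.sqrt_sq ENNReal.toReal_nonneg]
  have hlim3 : Tendsto (fun k => (eLpNorm (w k) 2 volume).toReal) atTop (𝓝 0) := by
    refine squeeze_zero (fun _ => ENNReal.toReal_nonneg)
      (fun k => tri (hw k).memLp (mf k)) ?_
    have h : ∀ k, eLpNorm (w k - f k) 2 volume = eLpNorm (f k - w k) 2 volume := fun k =>
      eLpNorm_sub_comm _ _ _ _
    simp only [h]
    simpa using hdiff.add hlim2
  have := hlim3.pow 2
  rw [zero_pow two_ne_zero] at this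
  refine this.congr fun k => toReal_eLpNorm_sq (hw k).memLp

end Rellich

/-! ### The Levi-Civita connection in coordinates -/

section LeviCivita

variable {n : ℕ}

/-- The Euclidean space `ℝⁿ`. -/
abbrev Euc (n : ℕ) : Type := EuclideanSpace ℝ (Fin n)

/-- Used to verify identities between multilinear maps on basis vectors only. -/
lemma euc_induction {P : Euc n → Prop} (h0 : P 0) (hadd : ∀ u v, P u → P v → P (u + v))
    (hsmul : ∀ (c : ℝ) u, P u → P (c • u)) (he : ∀ i, P (stdVec i)) (u : Euc n) : P u := by
  have h : u = ∑ i, u i • stdVec i := by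
    ext j
    simp [Finset.sum_apply, Pi.single_apply]
  rw [h]
  exact Finset.sum_induction _ P hadd h0 fun i _ => hsmul _ _ (he i)

/-- The bilinear form with matrix `A`. -/
def bilinOf (A : Matrix (Fin n) (Fin n) ℝ) : Euc n →L[ℝ] Euc n →L[ℝ] ℝ :=
  ∑ i, ∑ j, A i j • (EuclideanSpace.proj i : Euc n →L[ℝ] ℝ).smulRight
    (EuclideanSpace.proj j : Euc n →L[ℝ] ℝ)

lemma bilinOf_apply (A : Matrix (Fin n) (Fin n) ℝ) (u v : Euc n) :
    bilinOf A u v = ∑ i, ∑ j, A i j * (u i * v j) := by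
  simp [bilinOf]

lemma bilinOf_stdVec (A : Matrix (Fin n) (Fin n) ℝ) (i j : Fin n) :
    bilinOf A (stdVec i) (stdVec j) = A i j := by
  simp [bilinOf_apply]

lemma bilinOf_stdVec_right (A : Matrix (Fin n) (Fin n) ℝ) (u : Euc n) (j : Fin n) :
    bilinOf A u (stdVec j) = ∑ i, A i j * u i := by
  simp [bilinOf_apply]

lemma bilinOf_symm {A : Matrix (Fin n) (Fin n) ℝ} (hA : A.IsSymm) (u v : Euc n) :
    bilinOf A u v = bilinOf A v u := by
  rw [bilinOf_apply, bilinOf_apply, Finset.sum_comm]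
  refine Finset.sum_congr rfl fun i _ => Finset.sum_congr rfl fun j _ => ?_
  rw [hA.apply, mul_comm (u j)]

lemma bilinOf_smul (c : ℝ) (A : Matrix (Fin n) (Fin n) ℝ) : bilinOf (c • A) = c • bilinOf A := by
  ext u v
  simp [bilinOf_apply, Finset.mul_sum, mul_assoc]

/-- The vector-valued bilinear map with components `c k i j`. -/
def connOf (c : Fin n → Fin n → Fin n → ℝ) : Euc n →L[ℝ] Euc n →L[ℝ] Euc n :=
  ∑ k, ∑ i, ∑ j, c k i j • (EuclideanSpace.proj i : Euc n →L[ℝ] ℝ).smulRight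
    ((EuclideanSpace.proj j : Euc n →L[ℝ] ℝ).smulRight (stdVec k))

lemma connOf_stdVec (c : Fin n → Fin n → Fin n → ℝ) (i j k : Fin n) :
    connOf c (stdVec i) (stdVec j) k = c k i j := by
  simp [connOf, Pi.single_apply, Finset.sum_apply]

/-- A symmetric bilinear map `Γ` is compatible with a bilinear form `g` of derivative `D`. -/
structure IsLeviCivita (g : Euc n →L[ℝ] Euc n →L[ℝ] ℝ) (D : Euc n →L[ℝ] Euc n →L[ℝ] Euc n →L[ℝ] ℝ)
    (Γ : Euc n → Euc n → Euc n) : Prop where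
  symm : ∀ u v, Γ u v = Γ v u
  compat : ∀ u v w, D u v w = g (Γ u v) w + g v (Γ u w)

lemma IsLeviCivita.koszul {g : Euc n →L[ℝ] Euc n →L[ℝ] ℝ}
    {D : Euc n →L[ℝ] Euc n →L[ℝ] Euc n →L[ℝ] ℝ} {Γ : Euc n → Euc n → Euc n}
    (h : IsLeviCivita g D Γ) (hg : ∀ u v, g u v = g v u) (u v w : Euc n) :
    2 * g (Γ u v) w = D u v w + D v u w - D w u v := by
  rw [h.compat, h.compat, h.compat, h.symm v u, h.symm w u, h.symm w v, hg (Γ u w) v]; ring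

/-- The Koszul formula determines `g (Γ u v)` and `g` is nondegenerate. Linearity of `Γ` is not
required, so a candidate may be built with a plain set-theoretic inverse. -/
lemma IsLeviCivita.unique {g : Euc n →L[ℝ] Euc n →L[ℝ] ℝ}
    {D : Euc n →L[ℝ] Euc n →L[ℝ] Euc n →L[ℝ] ℝ} {Γ Γ' : Euc n → Euc n → Euc n}
    (h : IsLeviCivita g D Γ) (h' : IsLeviCivita g D Γ') (hg : ∀ u v, g u v = g v u)
    (hnd : ∀ v, (∀ w, g v w = 0) → v = 0) (u v : Euc n) : Γ u v = Γ' u v := by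
  rw [← sub_eq_zero]
  refine hnd _ fun w => ?_
  have h1 := h.koszul hg u v w
  have h2 := h'.koszul hg u v w
  simp only [map_sub, _root_.sub_apply]
  linarith

lemma bilinOf_nondegenerate {A : Matrix (Fin n) (Fin n) ℝ} (hA : A.det ≠ 0) (v : Euc n)
    (h : ∀ w, bilinOf A v w = 0) : v = 0 := by
  have h1 : Matrix.vecMul (v : Fin n → ℝ) A = 0 := by
    ext j
    have := h (stdVec j)
    rw [bilinOf_stdVec_right] at this
    simpa [Matrix.vecMul, dotProduct, mul_comm] using this
  have h2 : (v : Fin n → ℝ) = 0 := by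
    have := congrArg (fun x => Matrix.vecMul x A⁻¹) h1
    simpa [Matrix.vecMul_vecMul, Matrix.mul_nonsing_inv A (isUnit_iff_ne_zero.2 hA)] using this
  ext j
  exact congrFun h2 j

/-- The connection coefficients determined by a metric with matrix `A` and derivatives `D`. -/
def koszulCoeff (A : Matrix (Fin n) (Fin n) ℝ) (D : Fin n → Fin n → Fin n → ℝ) (k i j : Fin n) : ℝ :=
  (1 / 2) * ∑ l, A⁻¹ k l * (D i j l + D j i l - D l i j)

lemma isLeviCivita_koszulCoeff {A : Matrix (Fin n) (Fin n) ℝ} (hA : A.det ≠ 0) (hs : A.IsSymm)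
    {D : Euc n →L[ℝ] Euc n →L[ℝ] Euc n →L[ℝ] ℝ} (hD : ∀ u v w, D u v w = D u w v) :
    IsLeviCivita (bilinOf A) D (fun u v => connOf
      (koszulCoeff A fun i j l => D (stdVec i) (stdVec j) (stdVec l)) u v) := by
  set c := koszulCoeff A fun i j l => D (stdVec i) (stdVec j) (stdVec l) with hc
  have hsymm : ∀ k i j, c k i j = c k j i := by
    intro k i j
    simp only [hc, koszulCoeff]
    congr 1
    refine Finset.sum_congr rfl fun l _ => ?_
    rw [hD (stdVec l) (stdVec i)]; ring
  -- Lowering the index with `A` cancels `A⁻¹` and leaves the Koszul expression, from which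
  -- compatibility follows by adding two instances.
  have hlow : ∀ i j l, bilinOf A (connOf c (stdVec i) (stdVec j)) (stdVec l) =
      (1 / 2) * (D (stdVec i) (stdVec j) (stdVec l) + D (stdVec j) (stdVec i) (stdVec l)
        - D (stdVec l) (stdVec i) (stdVec j)) := by
    intro i j l
    rw [bilinOf_stdVec_right]
    simp only [connOf_stdVec, hc, koszulCoeff]
    set d : Fin n → ℝ := fun l => D (stdVec i) (stdVec j) (stdVec l) +
      D (stdVec j) (stdVec i) (stdVec l) - D (stdVec l) (stdVec i) (stdVec j) with hd
    have h1 : (A * A⁻¹) = 1 := Matrix.mul_nonsing_inv A (isUnit_iff_ne_zero.2 hA)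
    have h2 : ∑ m, A m l * ∑ p, A⁻¹ m p * d p = d l := by
      have h3 : Matrix.mulVec (A * A⁻¹) d l = d l := by rw [h1, Matrix.one_mulVec]
      rw [← h3, ← Matrix.mulVec_mulVec]
      simp only [Matrix.mulVec, dotProduct]
      refine Finset.sum_congr rfl fun m _ => ?_
      rw [hs.apply]
    change ∑ m, A m l * (1 / 2 * ∑ p, A⁻¹ m p * d p) = 1 / 2 * d l
    rw [← h2, Finset.mul_sum]
    refine Finset.sum_congr rfl fun m _ => ?_
    ring
  refine ⟨fun u v => ?_, fun u v w => ?_⟩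
  · induction u using euc_induction with
    | h0 => simp
    | hadd a b ha hb => simp [ha, hb]
    | hsmul a b hb => simp [hb]
    | he i =>
      induction v using euc_induction with
      | h0 => simp
      | hadd a b ha hb => simp [ha, hb]
      | hsmul a b hb => simp [hb]
      | he j => ext k; rw [connOf_stdVec, connOf_stdVec, hsymm]
  · induction u using euc_induction with
    | h0 => simp
    | hadd a b ha hb => simp only [map_add, _root_.add_apply, ha, hb]; ring
    | hsmul a b hb =>
      simp only [map_smul, _root_.smul_apply, hb, smul_eq_mul]; ring
    | he i =>
      induction v using euc_induction with
      | h0 => simp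
      | hadd a b ha hb => simp only [map_add, _root_.add_apply, ha, hb]; ring
      | hsmul a b hb =>
        simp only [map_smul, _root_.smul_apply, hb, smul_eq_mul]; ring
      | he j =>
        induction w using euc_induction with
        | h0 => simp
        | hadd a b ha hb => simp only [map_add, ha, hb]; ring
        | hsmul a b hb =>
          simp only [map_smul, hb, smul_eq_mul]; ring
        | he l =>
          rw [bilinOf_symm hs (stdVec j), hlow, hlow, hD (stdVec i) (stdVec l), hD (stdVec l)]
          ring

end LeviCivita

/-! ### Christoffel symbols and curvature in coordinate-free form -/

section Christoffel

variable {n : ℕ}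

lemma contDiffOn_smul_fixed {F : Type*} [NormedAddCommGroup F] [NormedSpace ℝ F] {f : Euc n → ℝ}
    {T : Set (Euc n)} {m : ℕ∞ω} (hf : ContDiffOn ℝ m f T) (b : F) :
    ContDiffOn ℝ m (fun y => f y • b) T :=
  hf.smul contDiffOn_const

lemma contDiffOn_bilinOf {G : Euc n → Matrix (Fin n) (Fin n) ℝ} {T : Set (Euc n)} {m : ℕ∞ω}
    (hG : ∀ i j, ContDiffOn ℝ m (fun y => G y i j) T) :
    ContDiffOn ℝ m (fun y => bilinOf (G y)) T := by
  unfold bilinOf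
  exact ContDiffOn.sum fun i _ => ContDiffOn.sum fun j _ => 
    contDiffOn_smul_fixed (hG i j) _

lemma contDiffOn_connOf {c : Euc n → Fin n → Fin n → Fin n → ℝ} {T : Set (Euc n)} {m : ℕ∞ω}
    (hc : ∀ k i j, ContDiffOn ℝ m (fun y => c y k i j) T) :
    ContDiffOn ℝ m (fun y => connOf (c y)) T := by
  unfold connOf
  exact ContDiffOn.sum fun k _ => ContDiffOn.sum fun i _ => ContDiffOn.sum fun j _ =>
    contDiffOn_smul_fixed (hc k i j) _

lemma contDiffOn_det {ι : Type*} [Fintype ι] [DecidableEq ι] {G : Euc n → Matrix ι ι ℝ}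
    {T : Set (Euc n)} {m : ℕ∞ω} (hG : ∀ i j, ContDiffOn ℝ m (fun y => G y i j) T) :
    ContDiffOn ℝ m (fun y => (G y).det) T := by
  simp only [Matrix.det_apply]
  exact ContDiffOn.sum fun σ _ => (contDiffOn_prod fun i _ => hG _ _).const_smul _

/-- Cramer's rule: each entry of the inverse is a quotient of polynomials in the entries of `G`. -/
lemma contDiffOn_inv {G : Euc n → Matrix (Fin n) (Fin n) ℝ}
    {T : Set (Euc n)} {m : ℕ∞ω} (hG : ∀ i j, ContDiffOn ℝ m (fun y => G y i j) T)
    (hdet : ∀ y ∈ T, (G y).det ≠ 0) (i j : Fin n) :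
    ContDiffOn ℝ m (fun y => (G y)⁻¹ i j) T := by
  have h : ∀ y, (G y)⁻¹ i j = ((G y).det)⁻¹ * ((G y).updateRow j (Pi.single i 1)).det := by
    intro y
    rw [Matrix.inv_def, Ring.inverse_eq_inv', Matrix.smul_apply, Matrix.adjugate_apply, smul_eq_mul]
  simp only [h]
  refine ((contDiffOn_det hG).inv hdet).mul (contDiffOn_det fun a b => ?_)
  by_cases hab : a = j
  · subst hab
    simp only [Matrix.updateRow_self]
    exact contDiffOn_const
  · simp only [Matrix.updateRow_ne hab]
    exact hG a b

/-- The derivative within `T` of the bilinear form with matrix `G`. -/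
def metricDeriv (T : Set (Euc n)) (G : Euc n → Matrix (Fin n) (Fin n) ℝ) (y : Euc n) :
    Euc n →L[ℝ] Euc n →L[ℝ] Euc n →L[ℝ] ℝ :=
  fderivWithin ℝ (fun z => bilinOf (G z)) T y

/-- The Levi-Civita connection of `G`, with derivatives taken within `T`. -/
def leviCivita (T : Set (Euc n)) (G : Euc n → Matrix (Fin n) (Fin n) ℝ) (y : Euc n) :
    Euc n →L[ℝ] Euc n →L[ℝ] Euc n :=
  connOf (koszulCoeff (G y) fun i j l => metricDeriv T G y (stdVec i) (stdVec j) (stdVec l))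

/-- `G` is a `C²` field of symmetric invertible matrices on `T`. -/
structure IsMetricOn (T : Set (Euc n)) (G : Euc n → Matrix (Fin n) (Fin n) ℝ) : Prop where
  uniqueDiffOn : UniqueDiffOn ℝ T
  contDiffOn : ∀ i j, ContDiffOn ℝ 2 (fun y => G y i j) T
  det_ne_zero : ∀ y ∈ T, (G y).det ≠ 0
  symm : ∀ y ∈ T, (G y).IsSymm

lemma IsMetricOn.mono_open {T Ω : Set (Euc n)} {G : Euc n → Matrix (Fin n) (Fin n) ℝ}
    (h : IsMetricOn T G) (hΩ : IsOpen Ω) (hs : Ω ⊆ T) : IsMetricOn Ω G :=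
  ⟨hΩ.uniqueDiffOn, fun i j => (h.contDiffOn i j).mono hs, fun y hy => h.det_ne_zero y (hs hy),
    fun y hy => h.symm y (hs hy)⟩

variable {T : Set (Euc n)} {G : Euc n → Matrix (Fin n) (Fin n) ℝ}

lemma IsMetricOn.contDiffOn_bilin (h : IsMetricOn T G) :
    ContDiffOn ℝ 2 (fun y => bilinOf (G y)) T := contDiffOn_bilinOf h.contDiffOn

lemma IsMetricOn.hasFDerivWithinAt (h : IsMetricOn T G) {y : Euc n} (hy : y ∈ T) :
    HasFDerivWithinAt (fun z => bilinOf (G z)) (metricDeriv T G y) T y :=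
  (h.contDiffOn_bilin.differentiableOn (by norm_num) y hy).hasFDerivWithinAt

lemma IsMetricOn.hasFDerivAt (h : IsMetricOn T G) {y : Euc n} (hy : T ∈ 𝓝 y) :
    HasFDerivAt (fun z => bilinOf (G z)) (metricDeriv T G y) y :=
  (h.hasFDerivWithinAt (mem_of_mem_nhds hy)).hasFDerivAt hy

/-- The functions `G(v,w)` and `G(w,v)` agree on `T`, and derivatives within `T` are unique, even at
boundary points of `T`. -/
lemma IsMetricOn.metricDeriv_symm (h : IsMetricOn T G) {y : Euc n} (hy : y ∈ T) (u v w : Euc n) :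
    metricDeriv T G y u v w = metricDeriv T G y u w v := by
  have key : ∀ v w, HasFDerivWithinAt (fun z => bilinOf (G z) v w)
      (((metricDeriv T G y).flip v).flip w) T y := by
    intro v w
    have h1 := ((h.hasFDerivWithinAt hy).clm_apply (hasFDerivWithinAt_const v y T)).clm_apply
      (hasFDerivWithinAt_const w y T)
    refine h1.congr_fderiv ?_
    ext u; simp
  have h2 := (key w v).congr (f₁ := fun z => bilinOf (G z) v w)
    (fun z hz => bilinOf_symm (h.symm z hz) v w) (bilinOf_symm (h.symm y hy) v w)
  have h3 := (h.uniqueDiffOn y hy).eq (key v w) h2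
  exact congrArg (fun L => L u) h3

lemma IsMetricOn.isLeviCivita (h : IsMetricOn T G) {y : Euc n} (hy : y ∈ T) :
    IsLeviCivita (bilinOf (G y)) (metricDeriv T G y) (fun u v => leviCivita T G y u v) :=
  isLeviCivita_koszulCoeff (h.det_ne_zero y hy) (h.symm y hy) (h.metricDeriv_symm hy)

lemma IsMetricOn.contDiffOn_leviCivita (h : IsMetricOn T G) :
    ContDiffOn ℝ 1 (leviCivita T G) T := by
  have hD : ∀ i j l, ContDiffOn ℝ 1
      (fun y => metricDeriv T G y (stdVec i) (stdVec j) (stdVec l)) T := fun i j l =>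
    (((h.contDiffOn_bilin.fderivWithin h.uniqueDiffOn (by norm_num)).clm_apply
      contDiffOn_const).clm_apply contDiffOn_const).clm_apply contDiffOn_const
  refine contDiffOn_connOf fun k i j => ?_
  unfold koszulCoeff
  refine contDiffOn_const.mul (ContDiffOn.sum fun l _ => ContDiffOn.mul ?_ ?_)
  · exact contDiffOn_inv (fun i j => (h.contDiffOn i j).of_le (by norm_num)) h.det_ne_zero k l
  · exact ((hD i j l).add (hD j i l)).sub (hD l i j)

/-- `christoffel` uses full derivatives and `leviCivita` derivatives within `T`, so that the latter
makes sense up to the boundary; the two are compared where `T` is a neighbourhood. -/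
lemma IsMetricOn.christoffel_eq (h : IsMetricOn T G) {y : Euc n} (hy : T ∈ 𝓝 y) (k i j : Fin n) :
    christoffel G k i j y = leviCivita T G y (stdVec i) (stdVec j) k := by
  have hp : ∀ i j l, partialDeriv i (fun z => G z j l) y =
      metricDeriv T G y (stdVec i) (stdVec j) (stdVec l) := by
    intro i j l
    have h1 := ((h.hasFDerivAt hy).clm_apply (hasFDerivAt_const (stdVec j) y)).clm_apply
      (hasFDerivAt_const (stdVec l) y)
    simp only [bilinOf_stdVec] at h1
    rw [partialDeriv, h1.fderiv]
    simp
  rw [leviCivita, connOf_stdVec, christoffel, koszulCoeff]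
  simp only [hp]

/-- The curvature tensor `R(u,v)w` of a connection `Γ`. -/
def curvatureOf (Γ : Euc n → Euc n →L[ℝ] Euc n →L[ℝ] Euc n) (y u v w : Euc n) : Euc n :=
  fderiv ℝ Γ y u v w - fderiv ℝ Γ y v u w + Γ y u (Γ y v w) - Γ y v (Γ y u w)

/-- The Ricci tensor of a connection `Γ`. -/
def ricciOf (Γ : Euc n → Euc n →L[ℝ] Euc n →L[ℝ] Euc n) (y v w : Euc n) : ℝ :=
  ∑ k, curvatureOf Γ y (stdVec k) v w k

lemma IsMetricOn.differentiableAt_leviCivita (h : IsMetricOn T G) {y : Euc n} (hy : T ∈ 𝓝 y) :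
    DifferentiableAt ℝ (leviCivita T G) y :=
  (h.contDiffOn_leviCivita.contDiffAt hy).differentiableAt (by norm_num)

lemma IsMetricOn.ricciCoeff_eq (h : IsMetricOn T G) {y : Euc n} (hy : T ∈ 𝓝 y) (i j : Fin n) :
    ricciCoeff G i j y = ricciOf (leviCivita T G) y (stdVec j) (stdVec i) := by
  have hd := h.differentiableAt_leviCivita hy
  have hp : ∀ m k i j, partialDeriv m (christoffel G k i j) y =
      fderiv ℝ (leviCivita T G) y (stdVec m) (stdVec i) (stdVec j) k := by
    intro m k i j
    have h1 := (hd.hasFDerivAt.clm_apply (hasFDerivAt_const (stdVec i) y)).clm_apply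
      (hasFDerivAt_const (stdVec j) y)
    have h2 := (EuclideanSpace.proj k : Euc n →L[ℝ] ℝ).hasFDerivAt.comp y h1
    have h3 : christoffel G k i j =ᶠ[𝓝 y] (EuclideanSpace.proj k : Euc n →L[ℝ] ℝ) ∘
        fun z => leviCivita T G z (stdVec i) (stdVec j) := by
      filter_upwards [eventually_mem_nhds_iff.2 hy] with z hz
      exact h.christoffel_eq hz k i j
    rw [partialDeriv, h3.fderiv_eq, h2.fderiv]
    simp
  have hsymm := (h.isLeviCivita (mem_of_mem_nhds hy)).symm
  have hexp : ∀ a b c (k : Fin n), leviCivita T G y (stdVec a) (leviCivita T G y (stdVec b) (stdVec c)) k =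
      ∑ l, leviCivita T G y (stdVec a) (stdVec l) k * leviCivita T G y (stdVec b) (stdVec c) l := by
    intro a b c k
    have hx : ∀ x : Euc n, leviCivita T G y (stdVec a) x k =
        ∑ l, leviCivita T G y (stdVec a) (stdVec l) k * x l := by
      intro x
      induction x using euc_induction with
      | h0 => simp
      | hadd u v hu hv => simp [hu, hv, mul_add, Finset.sum_add_distrib]
      | hsmul c u hu =>
        simp only [map_smul, PiLp.smul_apply, smul_eq_mul, hu, Finset.mul_sum]
        exact Finset.sum_congr rfl fun l _ => by ring
      | he i => simp
    exact hx _
  rw [ricciCoeff, ricciOf, ← Finset.sum_add_distrib]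
  refine Finset.sum_congr rfl fun k _ => ?_
  simp only [curvatureOf, PiLp.add_apply, PiLp.sub_apply, hexp, hp, h.christoffel_eq hy,
    Finset.sum_sub_distrib]
  -- `ricciCoeff` and the trace of `u ↦ R(u, eⱼ)eᵢ` differ only in the order of the lower indices of
  -- `Γ`. The symmetry of `Γ` holds in a neighbourhood, so it passes to the derivatives.
  have e1 : fderiv ℝ (leviCivita T G) y (stdVec k) (stdVec i) (stdVec j) k =
      fderiv ℝ (leviCivita T G) y (stdVec k) (stdVec j) (stdVec i) k := by
    rw [← hp, ← hp]
    have : christoffel G k i j =ᶠ[𝓝 y] christoffel G k j i := by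
      filter_upwards [eventually_mem_nhds_iff.2 hy] with z hz
      rw [h.christoffel_eq hz, h.christoffel_eq hz,
        (h.isLeviCivita (mem_of_mem_nhds hz)).symm]
    rw [partialDeriv, partialDeriv, this.fderiv_eq]
  have e2 : fderiv ℝ (leviCivita T G) y (stdVec j) (stdVec i) (stdVec k) k =
      fderiv ℝ (leviCivita T G) y (stdVec j) (stdVec k) (stdVec i) k := by
    rw [← hp, ← hp]
    have : christoffel G k i k =ᶠ[𝓝 y] christoffel G k k i := by
      filter_upwards [eventually_mem_nhds_iff.2 hy] with z hz
      rw [h.christoffel_eq hz, h.christoffel_eq hz,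
        (h.isLeviCivita (mem_of_mem_nhds hz)).symm]
    rw [partialDeriv, partialDeriv, this.fderiv_eq]
  rw [e1, e2, hsymm (stdVec i) (stdVec j), hsymm (stdVec i) (stdVec k)]
  ring

/-- The trace of a bilinear form with respect to a metric. -/
def metricTrace (A : Matrix (Fin n) (Fin n) ℝ) (B : Euc n → Euc n → ℝ) : ℝ :=
  ∑ i, ∑ j, A⁻¹ i j * B (stdVec j) (stdVec i)

lemma IsMetricOn.scalarCoeff_eq (h : IsMetricOn T G) {y : Euc n} (hy : T ∈ 𝓝 y) :
    scalarCoeff G y = metricTrace (G y) (ricciOf (leviCivita T G) y) := by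
  simp only [scalarCoeff, metricTrace, h.ricciCoeff_eq hy]

end Christoffel

/-! ### Independence of the scalar curvature from coordinates -/

section Invariance

variable {n : ℕ}

lemma sum_apply_stdVec_eq_trace (L : Euc n →L[ℝ] Euc n) :
    ∑ k, L (stdVec k) k = LinearMap.trace ℝ (Euc n) L.toLinearMap := by
  rw [LinearMap.trace_eq_sum_inner _ (EuclideanSpace.basisFun (Fin n) ℝ)]
  refine Finset.sum_congr rfl fun k _ => ?_
  simp [EuclideanSpace.inner_single_left]

/-- The curvature `R(u,v)w` as a linear function of `u`. -/
def curvatureLin (Γ : Euc n → Euc n →L[ℝ] Euc n →L[ℝ] Euc n) (y v w : Euc n) : Euc n →L[ℝ] Euc n :=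
  ((fderiv ℝ Γ y).flip v).flip w - (fderiv ℝ Γ y v).flip w + (Γ y).flip (Γ y v w)
    - (Γ y v).comp ((Γ y).flip w)

lemma curvatureLin_apply (Γ : Euc n → Euc n →L[ℝ] Euc n →L[ℝ] Euc n) (y u v w : Euc n) :
    curvatureLin Γ y v w u = curvatureOf Γ y u v w := by
  simp [curvatureLin, curvatureOf]

lemma ricciOf_eq_trace (Γ : Euc n → Euc n →L[ℝ] Euc n →L[ℝ] Euc n) (y v w : Euc n) :
    ricciOf Γ y v w = LinearMap.trace ℝ (Euc n) (curvatureLin Γ y v w).toLinearMap := by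
  rw [← sum_apply_stdVec_eq_trace]
  simp only [ricciOf, curvatureLin_apply]

lemma ricciOf_linear_left (Γ : Euc n → Euc n →L[ℝ] Euc n →L[ℝ] Euc n) (y : Euc n) (c : Fin n → ℝ)
    (v : Fin n → Euc n) (w : Euc n) :
    ricciOf Γ y (∑ a, c a • v a) w = ∑ a, c a * ricciOf Γ y (v a) w := by
  simp only [ricciOf, curvatureOf, Finset.mul_sum]
  rw [Finset.sum_comm]
  refine Finset.sum_congr rfl fun k _ => ?_
  simp only [map_sum, map_smul, _root_.sum_apply, _root_.smul_apply,
    PiLp.add_apply, PiLp.sub_apply, PiLp.smul_apply, WithLp.ofLp_sum, Finset.sum_apply,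
    smul_eq_mul, mul_add, mul_sub, Finset.sum_add_distrib, Finset.sum_sub_distrib]

lemma ricciOf_linear_right (Γ : Euc n → Euc n →L[ℝ] Euc n →L[ℝ] Euc n) (y : Euc n) (c : Fin n → ℝ)
    (v : Euc n) (w : Fin n → Euc n) :
    ricciOf Γ y v (∑ a, c a • w a) = ∑ a, c a * ricciOf Γ y v (w a) := by
  simp only [ricciOf, curvatureOf, Finset.mul_sum]
  rw [Finset.sum_comm]
  refine Finset.sum_congr rfl fun k _ => ?_
  simp only [map_sum, map_smul, 
    PiLp.add_apply, PiLp.sub_apply, PiLp.smul_apply, WithLp.ofLp_sum, Finset.sum_apply,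
    smul_eq_mul, mul_add, mul_sub, Finset.sum_add_distrib, Finset.sum_sub_distrib]

/-- The matrix of a linear endomorphism of `ℝⁿ`. -/
def jacobian (J : Euc n →L[ℝ] Euc n) : Matrix (Fin n) (Fin n) ℝ := fun a i => J (stdVec i) a

lemma map_stdVec_eq_sum (J : Euc n →L[ℝ] Euc n) (i : Fin n) :
    J (stdVec i) = ∑ a, jacobian J a i • stdVec a := by
  ext k
  simp [jacobian, Finset.sum_apply, Pi.single_apply]

lemma eq_transpose_mul_mul_of_bilinOf {A B : Matrix (Fin n) (Fin n) ℝ} {J : Euc n →L[ℝ] Euc n}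
    (h : ∀ u v, bilinOf A u v = bilinOf B (J u) (J v)) :
    A = (jacobian J).transpose * B * jacobian J := by
  ext i j
  rw [← bilinOf_stdVec A i j, h, bilinOf_apply]
  simp only [Matrix.mul_apply, Matrix.transpose_apply, Finset.sum_mul]
  rw [Finset.sum_comm]
  refine Finset.sum_congr rfl fun a _ => Finset.sum_congr rfl fun b _ => ?_
  simp only [jacobian]; ring

/-- With `P` the Jacobian matrix, `A = Pᵀ B P` and the matrices of `R` and `S` are related in the
same way. Hence `A⁻¹ R` and `B⁻¹ S` are conjugate by `P`, which is invertible because `A` is. -/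
lemma metricTrace_transform {A B : Matrix (Fin n) (Fin n) ℝ} {J : Euc n →L[ℝ] Euc n}
    (hA : A.det ≠ 0) (h : ∀ u v, bilinOf A u v = bilinOf B (J u) (J v))
    {R S : Euc n → Euc n → ℝ} (hRS : ∀ v w, R v w = S (J v) (J w))
    (hS1 : ∀ (c : Fin n → ℝ) (v : Fin n → Euc n) w, S (∑ a, c a • v a) w = ∑ a, c a * S (v a) w)
    (hS2 : ∀ (c : Fin n → ℝ) v (w : Fin n → Euc n), S v (∑ a, c a • w a) = ∑ a, c a * S v (w a)) :
    metricTrace A R = metricTrace B S := by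
  have hAB := eq_transpose_mul_mul_of_bilinOf h
  set P := jacobian J with hP
  have hdet : P.det ≠ 0 := by
    intro h0
    apply hA
    rw [hAB]; simp [h0]
  have hPu : IsUnit P.det := isUnit_iff_ne_zero.2 hdet
  have hPtu : IsUnit P.transpose.det := by rwa [Matrix.det_transpose]
  have htr : ∀ (C : Matrix (Fin n) (Fin n) ℝ) (X : Euc n → Euc n → ℝ),
      metricTrace C X = Matrix.trace (C⁻¹ * Matrix.of fun j i => X (stdVec j) (stdVec i)) := by
    intro C X
    simp [metricTrace, Matrix.trace, Matrix.mul_apply]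
  have hR : (Matrix.of fun j i => R (stdVec j) (stdVec i)) =
      P.transpose * (Matrix.of fun j i => S (stdVec j) (stdVec i)) * P := by
    ext j i
    simp only [Matrix.of_apply, hRS, Matrix.mul_apply, Matrix.transpose_apply, Finset.sum_mul]
    rw [map_stdVec_eq_sum J j, map_stdVec_eq_sum J i, hS2]
    refine Finset.sum_congr rfl fun a _ => ?_
    rw [hS1, Finset.mul_sum]
    refine Finset.sum_congr rfl fun b _ => ?_
    ring
  rw [htr, htr, hR, hAB, Matrix.mul_inv_rev, Matrix.mul_inv_rev]
  calc Matrix.trace (P⁻¹ * (B⁻¹ * P.transpose⁻¹) *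
        (P.transpose * (Matrix.of fun j i => S (stdVec j) (stdVec i)) * P))
      = Matrix.trace (P⁻¹ * (B⁻¹ * (P.transpose⁻¹ * P.transpose) *
          (Matrix.of fun j i => S (stdVec j) (stdVec i))) * P) := by
        simp only [Matrix.mul_assoc]
    _ = _ := by
        rw [Matrix.nonsing_inv_mul _ hPtu, Matrix.mul_one, Matrix.trace_mul_comm,
          ← Matrix.mul_assoc, Matrix.mul_nonsing_inv _ hPu, Matrix.one_mul]

variable {Ω₁ Ω₂ : Set (Euc n)} {G₁ G₂ : Euc n → Matrix (Fin n) (Fin n) ℝ} {φ : Euc n → Euc n}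

lemma exists_hasFDerivAt_apply_apply {F : Type*} [NormedAddCommGroup F] [NormedSpace ℝ F]
    {B : Euc n → Euc n →L[ℝ] Euc n →L[ℝ] F} {p q : Euc n → Euc n} {x : Euc n}
    {B' : Euc n →L[ℝ] Euc n →L[ℝ] Euc n →L[ℝ] F} {p' q' : Euc n →L[ℝ] Euc n}
    (hB : HasFDerivAt B B' x) (hp : HasFDerivAt p p' x) (hq : HasFDerivAt q q' x) :
    ∃ L : Euc n →L[ℝ] F, HasFDerivAt (fun z => B z (p z) (q z)) L x ∧
      ∀ u, L u = B' u (p x) (q x) + B x (p' u) (q x) + B x (p x) (q' u) := by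
  refine ⟨_, (hB.clm_apply hp).clm_apply hq, fun u => ?_⟩
  simp; abel

lemma hasFDerivAt_bilin_comp {F : Type*} [NormedAddCommGroup F] [NormedSpace ℝ F]
    {B : Euc n → Euc n →L[ℝ] Euc n →L[ℝ] F} {φ : Euc n → Euc n} {x : Euc n}
    {B' : Euc n →L[ℝ] Euc n →L[ℝ] Euc n →L[ℝ] F} {J : Euc n →L[ℝ] Euc n}
    (hB : HasFDerivAt B B' (φ x)) (hφ : HasFDerivAt φ J x) :
    HasFDerivAt (fun z => B (φ z)) (B'.comp J) x :=
  hB.comp x hφ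

lemma hasFDerivAt_apply_const {φ' : Euc n → Euc n →L[ℝ] Euc n} {x : Euc n}
    {H : Euc n →L[ℝ] Euc n →L[ℝ] Euc n} (h : HasFDerivAt φ' H x) (v : Euc n) :
    HasFDerivAt (fun z => φ' z v) (H.flip v) x := by
  refine (h.clm_apply (hasFDerivAt_const v x)).congr_fderiv ?_
  ext u; simp

/-- Transformation law of the Levi-Civita connection under a change of coordinates. -/
lemma leviCivita_transform (hΩ₁ : IsOpen Ω₁) (hΩ₂ : IsOpen Ω₂) (h₁ : IsMetricOn Ω₁ G₁)
    (h₂ : IsMetricOn Ω₂ G₂) (hφ : ContDiffOn ℝ 3 φ Ω₁) (hmap : Set.MapsTo φ Ω₁ Ω₂)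
    (hG : ∀ z ∈ Ω₁, ∀ u v, bilinOf (G₁ z) u v = bilinOf (G₂ (φ z)) (fderiv ℝ φ z u) (fderiv ℝ φ z v))
    {z : Euc n} (hz : z ∈ Ω₁) (u v : Euc n) :
    fderiv ℝ φ z (leviCivita Ω₁ G₁ z u v) =
      leviCivita Ω₂ G₂ (φ z) (fderiv ℝ φ z u) (fderiv ℝ φ z v) +
        fderiv ℝ (fderiv ℝ φ) z u v := by
  set J := fderiv ℝ φ z with hJ
  have hzn : Ω₁ ∈ 𝓝 z := hΩ₁.mem_nhds hz
  have hz2 : φ z ∈ Ω₂ := hmap hz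
  have hzn2 : Ω₂ ∈ 𝓝 (φ z) := hΩ₂.mem_nhds hz2
  have hφz : ContDiffAt ℝ 3 φ z := hφ.contDiffAt hzn
  have hφd : HasFDerivAt φ J z := (hφz.differentiableAt (by norm_num)).hasFDerivAt
  have hJd : HasFDerivAt (fderiv ℝ φ) (fderiv ℝ (fderiv ℝ φ) z) z :=
    ((hφz.fderiv_right (m := 2) (by norm_num)).differentiableAt (by norm_num)).hasFDerivAt
  set H := fderiv ℝ (fderiv ℝ φ) z with hH
  have hHs : ∀ u v, H u v = H v u := fun u v =>
    (hφz.of_le (by norm_num : (2 : ℕ∞ω) ≤ 3)).isSymmSndFDerivAt (by simp) u v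
  have hinj : Function.Injective J := by
    rw [injective_iff_map_eq_zero]
    intro x hx
    refine bilinOf_nondegenerate (h₁.det_ne_zero z hz) x fun w => ?_
    rw [hG z hz, ← hJ, hx]; simp
  have hsurj : Function.Surjective J :=
    (LinearMap.injective_iff_surjective (f := J.toLinearMap)).1 hinj
  -- The product rule applied to the isometry relation `hG`; the Hessian `H` of the change of
  -- coordinates is the inhomogeneous part.
  have hD : ∀ u v w, metricDeriv Ω₁ G₁ z u v w = metricDeriv Ω₂ G₂ (φ z) (J u) (J v) (J w) +
      bilinOf (G₂ (φ z)) (H u v) (J w) + bilinOf (G₂ (φ z)) (J v) (H u w) := by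
    intro u v w
    obtain ⟨L₁, d1, e1⟩ := exists_hasFDerivAt_apply_apply (h₁.hasFDerivAt hzn)
      (hasFDerivAt_const v z) (hasFDerivAt_const w z)
    have d0 := hasFDerivAt_bilin_comp (h₂.hasFDerivAt hzn2) hφd
    obtain ⟨L₂, d2, e2⟩ := exists_hasFDerivAt_apply_apply d0
      (hasFDerivAt_apply_const hJd v) (hasFDerivAt_apply_const hJd w)
    have he : (fun z => bilinOf (G₁ z) v w) =ᶠ[𝓝 z]
        fun z => bilinOf (G₂ (φ z)) (fderiv ℝ φ z v) (fderiv ℝ φ z w) := by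
      filter_upwards [hzn] with z' hz'
      exact hG z' hz' v w
    have d4 := congrArg (fun L => L u) (d1.unique (d2.congr_of_eventuallyEq he))
    simp only [e1, e2] at d4
    simpa using d4
  set Γ₂ := leviCivita Ω₂ G₂ (φ z)
  have hlc₂ := h₂.isLeviCivita hz2
  set K := Function.surjInv hsurj
  have hK : ∀ x, J (K x) = x := Function.surjInv_eq hsurj
  -- The pulled-back connection `J⁻¹(Γ₂(J u, J v) + H(u, v))` satisfies both axioms for `G₁`, so
  -- uniqueness identifies it with the Levi-Civita connection.
  have hlc : IsLeviCivita (bilinOf (G₁ z)) (metricDeriv Ω₁ G₁ z)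
      (fun u v => K (Γ₂ (J u) (J v) + H u v)) := by
    refine ⟨fun u v => ?_, fun u v w => ?_⟩
    · rw [hlc₂.symm (J u) (J v), hHs u v]
    · rw [hD, hG z hz, hG z hz, ← hJ, hK, hK, hlc₂.compat]
      simp only [map_add, _root_.add_apply]
      ring
  rw [(h₁.isLeviCivita hz).unique hlc (bilinOf_symm (h₁.symm z hz))
    (bilinOf_nondegenerate (h₁.det_ne_zero z hz)) u v, hK]

/-- The scalar curvature does not depend on the coordinates. -/
theorem scalarCoeff_transform (hΩ₁ : IsOpen Ω₁) (hΩ₂ : IsOpen Ω₂) (h₁ : IsMetricOn Ω₁ G₁)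
    (h₂ : IsMetricOn Ω₂ G₂) (hφ : ContDiffOn ℝ 3 φ Ω₁) (hmap : Set.MapsTo φ Ω₁ Ω₂)
    (hG : ∀ z ∈ Ω₁, ∀ u v, bilinOf (G₁ z) u v = bilinOf (G₂ (φ z)) (fderiv ℝ φ z u) (fderiv ℝ φ z v))
    {y : Euc n} (hy : y ∈ Ω₁) : scalarCoeff G₁ y = scalarCoeff G₂ (φ y) := by
  set J := fderiv ℝ φ y with hJ
  have hyn : Ω₁ ∈ 𝓝 y := hΩ₁.mem_nhds hy
  have hy2 : φ y ∈ Ω₂ := hmap hy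
  have hyn2 : Ω₂ ∈ 𝓝 (φ y) := hΩ₂.mem_nhds hy2
  have hφy : ContDiffAt ℝ 3 φ y := hφ.contDiffAt hyn
  have hφd : HasFDerivAt φ J y := (hφy.differentiableAt (by norm_num)).hasFDerivAt
  have hφ2 : ContDiffAt ℝ 2 (fderiv ℝ φ) y := hφy.fderiv_right (m := 2) (by norm_num)
  have hJd : HasFDerivAt (fderiv ℝ φ) (fderiv ℝ (fderiv ℝ φ) y) y :=
    (hφ2.differentiableAt (by norm_num)).hasFDerivAt
  set H := fderiv ℝ (fderiv ℝ φ) y with hH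
  have hHs : ∀ u v, H u v = H v u := fun u v =>
    (hφy.of_le (by norm_num : (2 : ℕ∞ω) ≤ 3)).isSymmSndFDerivAt (by simp) u v
  have hHd : HasFDerivAt (fderiv ℝ (fderiv ℝ φ)) (fderiv ℝ (fderiv ℝ (fderiv ℝ φ)) y) y :=
    ((hφ2.fderiv_right (m := 1) (by norm_num)).differentiableAt (by norm_num)).hasFDerivAt
  set D3 := fderiv ℝ (fderiv ℝ (fderiv ℝ φ)) y with hD3
  have hD3s : ∀ u v, D3 u v = D3 v u := fun u v => hφ2.isSymmSndFDerivAt (by simp) u v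
  have hinj : Function.Injective J := by
    rw [injective_iff_map_eq_zero]
    intro x hx
    refine bilinOf_nondegenerate (h₁.det_ne_zero y hy) x fun w => ?_
    rw [hG y hy, ← hJ, hx]; simp
  have hsurj : Function.Surjective J :=
    (LinearMap.injective_iff_surjective (f := J.toLinearMap)).1 hinj
  have ht := fun {z} (hz : z ∈ Ω₁) u v => leviCivita_transform hΩ₁ hΩ₂ h₁ h₂ hφ hmap hG hz u v
  have hΓ₁ := (h₁.differentiableAt_leviCivita hyn).hasFDerivAt
  have hΓ₂ := (h₂.differentiableAt_leviCivita hyn2).hasFDerivAt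
  -- The derivative of the transformation law in the direction `u`.
  have hder : ∀ u v w, H u (leviCivita Ω₁ G₁ y v w) +
      J (fderiv ℝ (leviCivita Ω₁ G₁) y u v w) =
      fderiv ℝ (leviCivita Ω₂ G₂) (φ y) (J u) (J v) (J w) +
      leviCivita Ω₂ G₂ (φ y) (H u v) (J w) + leviCivita Ω₂ G₂ (φ y) (J v) (H u w) + D3 u v w := by
    intro u v w
    have d1 := hJd.clm_apply ((hΓ₁.clm_apply (hasFDerivAt_const v y)).clm_apply
      (hasFDerivAt_const w y))
    have d2 := (((hΓ₂.comp y hφd).clm_apply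
      (hJd.clm_apply (hasFDerivAt_const v y))).clm_apply
        (hJd.clm_apply (hasFDerivAt_const w y))).add
      ((hHd.clm_apply (hasFDerivAt_const v y)).clm_apply (hasFDerivAt_const w y))
    have he : (fun z => fderiv ℝ φ z (leviCivita Ω₁ G₁ z v w)) =ᶠ[𝓝 y]
        fun z => leviCivita Ω₂ G₂ (φ z) (fderiv ℝ φ z v) (fderiv ℝ φ z w) +
          fderiv ℝ (fderiv ℝ φ) z v w := by
      filter_upwards [hyn] with z hz
      exact ht hz v w
    have d3 := d1.unique (d2.congr_of_eventuallyEq he)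
    have d4 := congrArg (fun L => L u) d3
    simp at d4
    rw [add_comm, d4]; abel
  -- Antisymmetrising `hder` in `u, v` removes the third derivatives of `φ`, and the transformation
  -- law applied to the quadratic terms of the curvature absorbs all terms in `H`.
  have hcurv : ∀ u v w, J (curvatureOf (leviCivita Ω₁ G₁) y u v w) =
      curvatureOf (leviCivita Ω₂ G₂) (φ y) (J u) (J v) (J w) := by
    intro u v w
    have a1 := hder u v w
    have a2 := hder v u w
    have b1 := ht hy u (leviCivita Ω₁ G₁ y v w)
    have b2 := ht hy v (leviCivita Ω₁ G₁ y u w)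
    rw [ht hy v w] at b1
    rw [ht hy u w] at b2
    rw [hHs v u, hD3s v u] at a2
    simp only [← hJ, ← hH, map_add] at a1 a2 b1 b2
    simp only [curvatureOf, map_add, map_sub, b1, b2]
    rw [eq_sub_of_add_eq' a1, eq_sub_of_add_eq' a2]
    abel
  rw [h₁.scalarCoeff_eq hyn, h₂.scalarCoeff_eq hyn2]
  refine metricTrace_transform (J := J) (h₁.det_ne_zero y hy) (hG y hy) (fun v w => ?_)
    (ricciOf_linear_left _ _) (ricciOf_linear_right _ _)
  rw [ricciOf_eq_trace, ricciOf_eq_trace]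
  -- Conjugation by `J` carries one curvature endomorphism to the other and preserves the trace.
  set e : Euc n ≃ₗ[ℝ] Euc n := LinearEquiv.ofBijective J.toLinearMap ⟨hinj, hsurj⟩
  rw [← LinearMap.trace_conj' (curvatureLin (leviCivita Ω₁ G₁) y v w).toLinearMap e]
  congr 1
  ext1 x
  obtain ⟨u, rfl⟩ := hsurj x
  have he : e.symm (J u) = u := e.symm_apply_apply u
  rw [LinearEquiv.conj_apply]
  simp only [LinearMap.comp_apply, LinearEquiv.coe_coe, he, ContinuousLinearMap.coe_coe,
    curvatureLin_apply]
  exact hcurv u v w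

end Invariance

/-! ### Curvature of `r⁻² G` near the zeros of `r` -/

section Conformal

variable {n : ℕ}

/-- The vector dual to the covector `a` with respect to the bilinear form with matrix `A`. -/
def sharp (A : Matrix (Fin n) (Fin n) ℝ) (a : Euc n →L[ℝ] ℝ) : Euc n :=
  ∑ k, (∑ l, A⁻¹ k l * a (stdVec l)) • stdVec k

lemma sharp_apply (A : Matrix (Fin n) (Fin n) ℝ) (a : Euc n →L[ℝ] ℝ) (k : Fin n) :
    sharp A a k = ∑ l, A⁻¹ k l * a (stdVec l) := by
  simp [sharp, Finset.sum_apply, Pi.single_apply]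

lemma apply_sharp (A : Matrix (Fin n) (Fin n) ℝ) (a : Euc n →L[ℝ] ℝ) :
    a (sharp A a) = ∑ k, ∑ l, A⁻¹ k l * a (stdVec k) * a (stdVec l) := by
  simp only [sharp, map_sum, map_smul, smul_eq_mul, Finset.sum_mul]
  exact Finset.sum_congr rfl fun k _ => Finset.sum_congr rfl fun l _ => by ring

lemma bilinOf_sharp {A : Matrix (Fin n) (Fin n) ℝ} (hdet : A.det ≠ 0) (hs : A.IsSymm)
    (a : Euc n →L[ℝ] ℝ) (v : Euc n) : bilinOf A (sharp A a) v = a v := by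
  induction v using euc_induction with
  | h0 => simp
  | hadd u v hu hv => rw [map_add, map_add, hu, hv]
  | hsmul c u hu => rw [map_smul, map_smul, hu]
  | he j =>
    rw [bilinOf_stdVec_right]
    simp only [sharp_apply]
    set d : Fin n → ℝ := fun l => a (stdVec l)
    have h3 : Matrix.mulVec (A * A⁻¹) d j = d j := by
      rw [Matrix.mul_nonsing_inv _ (isUnit_iff_ne_zero.2 hdet), Matrix.one_mulVec]
    change _ = d j
    rw [← h3, ← Matrix.mulVec_mulVec]
    simp only [Matrix.mulVec, dotProduct]
    refine Finset.sum_congr rfl fun m _ => ?_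
    rw [hs.apply]

/-- The gradient of `r` with respect to the metric `G`, with derivatives taken within `T`. -/
def gradOf (T : Set (Euc n)) (G : Euc n → Matrix (Fin n) (Fin n) ℝ) (r : Euc n → ℝ) (y : Euc n) :
    Euc n := sharp (G y) (fderivWithin ℝ r T y)

lemma bilinOf_gradOf {T : Set (Euc n)} {G : Euc n → Matrix (Fin n) (Fin n) ℝ} {r : Euc n → ℝ}
    {y : Euc n} (hdet : (G y).det ≠ 0) (hs : (G y).IsSymm) (v : Euc n) :
    bilinOf (G y) (gradOf T G r y) v = fderivWithin ℝ r T y v := bilinOf_sharp hdet hs _ v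

lemma contDiffOn_gradOf {T : Set (Euc n)} {G : Euc n → Matrix (Fin n) (Fin n) ℝ} {r : Euc n → ℝ}
    (hG : IsMetricOn T G) (hr : ContDiffOn ℝ 2 r T) : ContDiffOn ℝ 1 (gradOf T G r) T := by
  unfold gradOf sharp
  refine ContDiffOn.sum fun k _ => contDiffOn_smul_fixed (ContDiffOn.sum fun l _ => ?_) _
  refine (contDiffOn_inv (fun i j => (hG.contDiffOn i j).of_le (by norm_num))
    hG.det_ne_zero k l).mul ?_
  exact (hr.fderivWithin hG.uniqueDiffOn (by norm_num)).clm_apply contDiffOn_const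

/-- The bilinear map `(u,v) ↦ dr(u) v + dr(v) u - G(u,v) ∇r`. -/
def conformalCorrection (T : Set (Euc n)) (G : Euc n → Matrix (Fin n) (Fin n) ℝ) (r : Euc n → ℝ)
    (y : Euc n) : Euc n →L[ℝ] Euc n →L[ℝ] Euc n :=
  connOf fun k i j => fderivWithin ℝ r T y (stdVec i) * (stdVec j : Euc n) k +
    fderivWithin ℝ r T y (stdVec j) * (stdVec i : Euc n) k - G y i j * gradOf T G r y k

lemma conformalCorrection_apply (T : Set (Euc n)) (G : Euc n → Matrix (Fin n) (Fin n) ℝ)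
    (r : Euc n → ℝ) (y u v : Euc n) :
    conformalCorrection T G r y u v = fderivWithin ℝ r T y u • v + fderivWithin ℝ r T y v • u -
      bilinOf (G y) u v • gradOf T G r y := by
  induction u using euc_induction with
  | h0 => simp
  | hadd a b ha hb => simp only [map_add, _root_.add_apply, ha, hb, add_smul, smul_add]; abel
  | hsmul c a ha =>
    simp only [map_smul, _root_.smul_apply, ha, smul_sub, smul_add, smul_smul, smul_eq_mul,
      mul_comm c]
  | he i =>
    induction v using euc_induction with
    | h0 => simp
    | hadd a b ha hb => simp only [map_add, ha, hb, add_smul, smul_add]; abel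
    | hsmul c a ha =>
      simp only [map_smul, ha, smul_sub, smul_add, smul_smul, smul_eq_mul,
        mul_comm c]
    | he j =>
      ext k
      rw [conformalCorrection, connOf_stdVec]
      simp [bilinOf_stdVec]

lemma contDiffOn_conformalCorrection {T : Set (Euc n)} {G : Euc n → Matrix (Fin n) (Fin n) ℝ}
    {r : Euc n → ℝ} (hG : IsMetricOn T G) (hr : ContDiffOn ℝ 2 r T) :
    ContDiffOn ℝ 1 (conformalCorrection T G r) T := by
  have ha : ∀ i, ContDiffOn ℝ 1 (fun y => fderivWithin ℝ r T y (stdVec i)) T := fun i =>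
    (hr.fderivWithin hG.uniqueDiffOn (by norm_num)).clm_apply contDiffOn_const
  refine contDiffOn_connOf fun k i j => ?_
  refine (((ha i).mul contDiffOn_const).add ((ha j).mul contDiffOn_const)).sub
    (((hG.contDiffOn i j).of_le (by norm_num)).mul ?_)
  exact (EuclideanSpace.proj k : Euc n →L[ℝ] ℝ).contDiff.comp_contDiffOn (contDiffOn_gradOf hG hr)

/-- The connection of `r⁻² G`, multiplied by `r`. -/
def scaledConnection (T : Set (Euc n)) (G : Euc n → Matrix (Fin n) (Fin n) ℝ) (r : Euc n → ℝ)
    (y : Euc n) : Euc n →L[ℝ] Euc n →L[ℝ] Euc n :=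
  r y • leviCivita T G y - conformalCorrection T G r y

lemma contDiffOn_scaledConnection {T : Set (Euc n)} {G : Euc n → Matrix (Fin n) (Fin n) ℝ}
    {r : Euc n → ℝ} (hG : IsMetricOn T G) (hr : ContDiffOn ℝ 2 r T) :
    ContDiffOn ℝ 1 (scaledConnection T G r) T :=
  ((hr.of_le (by norm_num)).smul hG.contDiffOn_leviCivita).sub
    (contDiffOn_conformalCorrection hG hr)

/-- The curvature of `r⁻² G`, multiplied by `r²`. -/
def scaledCurvature (T : Set (Euc n)) (G : Euc n → Matrix (Fin n) (Fin n) ℝ) (r : Euc n → ℝ)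
    (y u v w : Euc n) : Euc n :=
  r y • (fderivWithin ℝ (scaledConnection T G r) T y u v w -
      fderivWithin ℝ (scaledConnection T G r) T y v u w)
    - fderivWithin ℝ r T y u • scaledConnection T G r y v w
    + fderivWithin ℝ r T y v • scaledConnection T G r y u w
    + scaledConnection T G r y u (scaledConnection T G r y v w)
    - scaledConnection T G r y v (scaledConnection T G r y u w)

lemma continuousOn_scaledCurvature {T : Set (Euc n)} {G : Euc n → Matrix (Fin n) (Fin n) ℝ}
    {r : Euc n → ℝ} (hG : IsMetricOn T G) (hr : ContDiffOn ℝ 2 r T) (u v w : Euc n) :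
    ContinuousOn (fun y => scaledCurvature T G r y u v w) T := by
  have hA := contDiffOn_scaledConnection hG hr
  have c1 := hA.continuousOn
  have c2 := hA.continuousOn_fderivWithin hG.uniqueDiffOn (by norm_num)
  have c3 := hr.continuousOn
  have c4 := hr.continuousOn_fderivWithin hG.uniqueDiffOn (by norm_num)
  have c5 : ∀ u v, ContinuousOn (fun y => scaledConnection T G r y u v) T := fun u v =>
    (c1.clm_apply continuousOn_const).clm_apply continuousOn_const
  have c6 : ∀ u v w, ContinuousOn (fun y => fderivWithin ℝ (scaledConnection T G r) T y u v w) T :=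
    fun u v w => ((c2.clm_apply continuousOn_const).clm_apply continuousOn_const).clm_apply
      continuousOn_const
  have c7 : ∀ u, ContinuousOn (fun y => fderivWithin ℝ r T y u) T := fun u =>
    c4.clm_apply continuousOn_const
  unfold scaledCurvature
  exact ((((c3.smul ((c6 u v w).sub (c6 v u w))).sub ((c7 u).smul (c5 v w))).add
    ((c7 v).smul (c5 u w))).add ((c1.clm_apply continuousOn_const).clm_apply (c5 v w))).sub
    ((c1.clm_apply continuousOn_const).clm_apply (c5 u w))

lemma IsMetricOn.conformal {T Ω : Set (Euc n)} {G Gb : Euc n → Matrix (Fin n) (Fin n) ℝ}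
    {r : Euc n → ℝ} (hb : IsMetricOn T Gb) (hr : ContDiffOn ℝ 2 r T) (hΩ : IsOpen Ω) (hs : Ω ⊆ T)
    (hpos : ∀ y ∈ Ω, 0 < r y) (hG : ∀ y ∈ Ω, G y = (r y ^ 2)⁻¹ • Gb y) : IsMetricOn Ω G := by
  refine ⟨hΩ.uniqueDiffOn, fun i j => ?_, fun y hy => ?_, fun y hy => ?_⟩
  · have h1 : ContDiffOn ℝ 2 (fun y => (r y ^ 2)⁻¹ * Gb y i j) Ω :=
      (((hr.mono hs).pow 2).inv fun y hy => (pow_pos (hpos y hy) 2).ne').mul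
        ((hb.contDiffOn i j).mono hs)
    exact h1.congr fun y hy => by rw [hG y hy]; rfl
  · rw [hG y hy, Matrix.det_smul]
    exact mul_ne_zero (pow_ne_zero _ (inv_ne_zero (pow_pos (hpos y hy) 2).ne'))
      (hb.det_ne_zero y (hs hy))
  · rw [hG y hy]
    exact (hb.symm y (hs hy)).smul _

/-- Uniqueness of the Levi-Civita connection: the candidate `Γ - r⁻¹(dr(u) v + dr(v) u - G(u,v) ∇r)`
is symmetric and compatible, since `r⁻²` contributes `-2 r⁻³ dr` to the derivative of the metric. -/
lemma leviCivita_conformal {T Ω : Set (Euc n)} {G Gb : Euc n → Matrix (Fin n) (Fin n) ℝ}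
    {r : Euc n → ℝ} (hb : IsMetricOn T Gb) (hr : ContDiffOn ℝ 2 r T) (hΩ : IsOpen Ω) (hs : Ω ⊆ T)
    (hpos : ∀ y ∈ Ω, 0 < r y) (hG : ∀ y ∈ Ω, G y = (r y ^ 2)⁻¹ • Gb y) {y : Euc n} (hy : y ∈ Ω) :
    leviCivita Ω G y = (r y)⁻¹ • scaledConnection T Gb r y := by
  have hm := hb.conformal hr hΩ hs hpos hG
  have hT : T ∈ 𝓝 y := mem_of_superset (hΩ.mem_nhds hy) hs
  have hyT := hs hy
  have hr0 : r y ≠ 0 := (hpos y hy).ne'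
  have hrd : HasFDerivAt r (fderivWithin ℝ r T y) y :=
    (hr.differentiableOn (by norm_num) y hyT).hasFDerivWithinAt.hasFDerivAt hT
  have hDb := hb.hasFDerivAt hT
  have hD : ∀ u v w, metricDeriv Ω G y u v w = (r y ^ 2)⁻¹ * metricDeriv T Gb y u v w
      - 2 * (r y ^ 3)⁻¹ * fderivWithin ℝ r T y u * bilinOf (Gb y) v w := by
    intro u v w
    obtain ⟨L₁, d1, e1⟩ := exists_hasFDerivAt_apply_apply (hm.hasFDerivAt (hΩ.mem_nhds hy))
      (hasFDerivAt_const v y) (hasFDerivAt_const w y)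
    obtain ⟨L₂, d2, e2⟩ := exists_hasFDerivAt_apply_apply hDb
      (hasFDerivAt_const v y) (hasFDerivAt_const w y)
    have d3 := ((hasDerivAt_inv (pow_ne_zero 2 hr0)).comp_hasFDerivAt y (hrd.pow 2)).mul d2
    have he : (fun z => bilinOf (G z) v w) =ᶠ[𝓝 y]
        fun z => (r z ^ 2)⁻¹ * bilinOf (Gb z) v w := by
      filter_upwards [hΩ.mem_nhds hy] with z hz
      rw [hG z hz, bilinOf_smul]; simp
    have d4 := congrArg (fun L => L u) (d1.unique (d3.congr_of_eventuallyEq he))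
    simp only [e1] at d4
    simp [e2] at d4
    rw [d4]
    field_simp
    ring
  have hlcb := hb.isLeviCivita hyT
  have hN := bilinOf_gradOf (T := T) (r := r) (hb.det_ne_zero y hyT) (hb.symm y hyT)
  have hGs := bilinOf_symm (hb.symm y hyT)
  have hlc : IsLeviCivita (bilinOf (G y)) (metricDeriv Ω G y)
      (fun u v => (r y)⁻¹ • scaledConnection T Gb r y u v) := by
    refine ⟨fun u v => ?_, fun u v w => ?_⟩
    · simp only [scaledConnection, _root_.sub_apply, _root_.smul_apply, conformalCorrection_apply,
        hlcb.symm u v, hGs u v]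
      congr 2
      abel
    · rw [hD, hlcb.compat, hG y hy, bilinOf_smul]
      simp only [scaledConnection, _root_.sub_apply, _root_.smul_apply, conformalCorrection_apply,
        map_sub, map_smul, map_add, _root_.add_apply, smul_eq_mul]
      rw [hGs v (gradOf T Gb r y), hN, hN, hGs v u]
      field_simp
      ring
  ext1 u; ext1 v
  exact (hm.isLeviCivita hy).unique hlc (bilinOf_symm (hm.symm y hy))
    (bilinOf_nondegenerate (hm.det_ne_zero y hy)) u v

/-- For a connection `r⁻¹ A`, the derivative is `r⁻¹ dA - r⁻² dr ⊗ A` and the quadratic terms carry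
`r⁻²`. The factor `r²` clears every denominator, so the right-hand side makes sense where `r = 0`.
-/
lemma curvatureOf_conformal {T Ω : Set (Euc n)} {G Gb : Euc n → Matrix (Fin n) (Fin n) ℝ}
    {r : Euc n → ℝ} (hb : IsMetricOn T Gb) (hr : ContDiffOn ℝ 2 r T) (hΩ : IsOpen Ω) (hs : Ω ⊆ T)
    (hpos : ∀ y ∈ Ω, 0 < r y) (hG : ∀ y ∈ Ω, G y = (r y ^ 2)⁻¹ • Gb y) {y : Euc n} (hy : y ∈ Ω)
    (u v w : Euc n) :
    r y ^ 2 • curvatureOf (leviCivita Ω G) y u v w = scaledCurvature T Gb r y u v w := by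
  have hT : T ∈ 𝓝 y := mem_of_superset (hΩ.mem_nhds hy) hs
  have hyT := hs hy
  have hr0 : r y ≠ 0 := (hpos y hy).ne'
  have hrd : HasFDerivAt r (fderivWithin ℝ r T y) y :=
    (hr.differentiableOn (by norm_num) y hyT).hasFDerivWithinAt.hasFDerivAt hT
  set A := scaledConnection T Gb r with hA
  have hAd : HasFDerivAt A (fderivWithin ℝ A T y) y :=
    ((contDiffOn_scaledConnection hb hr).differentiableOn (by norm_num) y
      hyT).hasFDerivWithinAt.hasFDerivAt hT
  have he : leviCivita Ω G =ᶠ[𝓝 y] fun z => (r z)⁻¹ • A z := by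
    filter_upwards [hΩ.mem_nhds hy] with z hz
    exact leviCivita_conformal hb hr hΩ hs hpos hG hz
  have hd := (((hasDerivAt_inv hr0).comp_hasFDerivAt y hrd).smul hAd).congr_of_eventuallyEq he
  have hf : ∀ u v w, fderiv ℝ (leviCivita Ω G) y u v w =
      (r y)⁻¹ • fderivWithin ℝ A T y u v w
        - ((r y ^ 2)⁻¹ * fderivWithin ℝ r T y u) • A y v w := by
    intro u v w
    rw [hd.fderiv]
    simp [sub_eq_add_neg]
  simp only [curvatureOf, hf, he.self_of_nhds, scaledCurvature, ← hA]
  simp only [_root_.smul_apply, map_smul, smul_sub, smul_add, smul_smul]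
  have e1 : r y ^ 2 * (r y)⁻¹ = r y := by field_simp
  have e2 : ∀ t, r y ^ 2 * ((r y ^ 2)⁻¹ * t) = t := fun t => by field_simp
  have e3 : r y ^ 2 * ((r y)⁻¹ * (r y)⁻¹) = 1 := by field_simp
  rw [e1, e2, e2, e3, one_smul, one_smul]
  abel

/-- The inverse of `r⁻² Gb` is `r² Gb⁻¹`, which supplies exactly the factor `r²` that makes the
curvature regular. -/
lemma scalarCoeff_conformal {T Ω : Set (Euc n)} {G Gb : Euc n → Matrix (Fin n) (Fin n) ℝ}
    {r : Euc n → ℝ} (hb : IsMetricOn T Gb) (hr : ContDiffOn ℝ 2 r T) (hΩ : IsOpen Ω) (hs : Ω ⊆ T)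
    (hpos : ∀ y ∈ Ω, 0 < r y) (hG : ∀ y ∈ Ω, G y = (r y ^ 2)⁻¹ • Gb y) {y : Euc n} (hy : y ∈ Ω) :
    scalarCoeff G y =
      metricTrace (Gb y) (fun v w => ∑ k, scaledCurvature T Gb r y (stdVec k) v w k) := by
  have hm := hb.conformal hr hΩ hs hpos hG
  have hr0 : r y ^ 2 ≠ 0 := (pow_pos (hpos y hy) 2).ne'
  rw [hm.scalarCoeff_eq (hΩ.mem_nhds hy)]
  have hinv : (G y)⁻¹ = (r y ^ 2) • (Gb y)⁻¹ := by
    rw [hG y hy]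
    refine Matrix.inv_eq_left_inv ?_
    rw [Matrix.smul_mul, Matrix.mul_smul, smul_smul, mul_inv_cancel₀ hr0, one_smul,
      Matrix.nonsing_inv_mul _ (isUnit_iff_ne_zero.2 (hb.det_ne_zero y (hs hy)))]
  simp only [metricTrace, hinv, ricciOf, ← curvatureOf_conformal hb hr hΩ hs hpos hG hy,
    Matrix.smul_apply, smul_eq_mul, PiLp.smul_apply, ← Finset.mul_sum]
  exact Finset.sum_congr rfl fun i _ => Finset.sum_congr rfl fun j _ => by ring

/-- At a zero of `r`, the rescaled curvature is that of a space of constant curvature. -/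
lemma scaledCurvature_of_zero {T : Set (Euc n)} {G : Euc n → Matrix (Fin n) (Fin n) ℝ}
    {r : Euc n → ℝ} {y : Euc n} (hdet : (G y).det ≠ 0) (hs : (G y).IsSymm) (h0 : r y = 0)
    (u v w : Euc n) :
    scaledCurvature T G r y u v w = -(fderivWithin ℝ r T y (gradOf T G r y)) •
      (bilinOf (G y) v w • u - bilinOf (G y) u w • v) := by
  have hN := bilinOf_gradOf (T := T) (r := r) hdet hs
  have hGs := bilinOf_symm hs
  -- At a zero of `r`, the derivatives of the connection drop out and only the explicit correction
  -- built from `dr` and `∇r` remains.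
  have hA : ∀ u v, scaledConnection T G r y u v = -conformalCorrection T G r y u v := by
    intro u v; simp [scaledConnection, h0]
  simp only [scaledCurvature, h0, hA, conformalCorrection_apply, zero_smul, map_neg, map_sub,
    map_add, map_smul]
  rw [hGs u (gradOf T G r y), hGs v (gradOf T G r y), hN, hN, hGs u v]
  module

lemma continuousOn_metricTrace_scaledCurvature {T : Set (Euc n)}
    {Gb : Euc n → Matrix (Fin n) (Fin n) ℝ} {r : Euc n → ℝ} (hb : IsMetricOn T Gb)
    (hr : ContDiffOn ℝ 2 r T) :
    ContinuousOn (fun y =>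
      metricTrace (Gb y) (fun v w => ∑ k, scaledCurvature T Gb r y (stdVec k) v w k)) T := by
  unfold metricTrace
  refine continuousOn_finsetSum _ fun i _ => continuousOn_finsetSum _ fun j _ => ?_
  refine (contDiffOn_inv hb.contDiffOn hb.det_ne_zero i j).continuousOn.mul ?_
  refine continuousOn_finsetSum _ fun k _ => ?_
  exact (EuclideanSpace.proj k : Euc n →L[ℝ] ℝ).continuous.comp_continuousOn
    (continuousOn_scaledCurvature hb hr _ _ _)

/-- The scalar curvature of `r⁻² G` extends continuously to the zeros of `r`, with the value
`-n(n-1) |dr|²` there. -/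
theorem exists_continuousOn_scalarCoeff_conformal {T Ω : Set (Euc n)}
    {G Gb : Euc n → Matrix (Fin n) (Fin n) ℝ}
    {r : Euc n → ℝ} (hb : IsMetricOn T Gb) (hr : ContDiffOn ℝ 2 r T) (hΩ : IsOpen Ω) (hs : Ω ⊆ T)
    (hpos : ∀ y ∈ Ω, 0 < r y) (hG : ∀ y ∈ Ω, G y = (r y ^ 2)⁻¹ • Gb y) :
    ∃ S : Euc n → ℝ, ContinuousOn S T ∧ (∀ y ∈ Ω, scalarCoeff G y = S y) ∧
      ∀ y ∈ T, r y = 0 → S y = -(n * (n - 1) * fderivWithin ℝ r T y (gradOf T Gb r y)) := by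
  refine ⟨_, continuousOn_metricTrace_scaledCurvature hb hr, fun _ hy =>
    scalarCoeff_conformal hb hr hΩ hs hpos hG hy, fun y hy h0 => ?_⟩
  set q := fderivWithin ℝ r T y (gradOf T Gb r y) with hq
  -- Tracing `u ↦ G(v,w) u - G(u,w) v` gives `(n - 1) G(v,w)`; the second trace, taken with `Gb⁻¹`,
  -- gives the factor `n`.
  have hR : ∀ i j, ∑ k, scaledCurvature T Gb r y (stdVec k) (stdVec j) (stdVec i) k =
      -(q * (n - 1)) * Gb y j i := by
    intro i j
    simp only [scaledCurvature_of_zero (hb.det_ne_zero y hy) (hb.symm y hy) h0, ← hq,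
      bilinOf_stdVec]
    simp [Finset.sum_sub_distrib, ← Finset.mul_sum]
    ring
  simp only [metricTrace, hR]
  have h1 : ∑ i, ∑ j, (Gb y)⁻¹ i j * Gb y j i = n := by
    have h2 := congrArg Matrix.trace (Matrix.nonsing_inv_mul (Gb y)
      (isUnit_iff_ne_zero.2 (hb.det_ne_zero y hy)))
    simpa [Matrix.trace, Matrix.mul_apply] using h2
  have h3 : ∑ i, ∑ j, (Gb y)⁻¹ i j * (-(q * (n - 1)) * Gb y j i) =
      -(q * (n - 1)) * ∑ i, ∑ j, (Gb y)⁻¹ i j * Gb y j i := by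
    simp only [Finset.mul_sum]
    exact Finset.sum_congr rfl fun i _ => Finset.sum_congr rfl fun j _ => by ring
  rw [h3, h1]; ring

end Conformal

/-! ### Charts -/

section Charts

variable {n : ℕ} [NeZero n] {M : Type*} [TopologicalSpace M]
  [ChartedSpace (EuclideanHalfSpace n) M]

/-- The bilinear form at `x`, on the model space. -/
def bilinAt (g : BilinField n M) (x : M) : Euc n →L[ℝ] Euc n →L[ℝ] ℝ := g x

/-- The covector at `x`, on the model space. -/
def covectorAt (α : CovectorField n M) (x : M) : Euc n →L[ℝ] ℝ := α x

/-- The derivative of the inverse of the chart around `x₀`. -/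
def chartDeriv (x₀ : M) (y : Euc n) : Euc n →L[ℝ] Euc n :=
  mfderivWithin 𝓘(ℝ, EuclideanSpace ℝ (Fin n)) (𝓡∂ n) (extChartAt (𝓡∂ n) x₀).symm
    (Set.range (𝓡∂ n)) y

lemma coeffMatrix_apply (g : BilinField n M) (x₀ : M) (y : Euc n) (i j : Fin n) :
    coeffMatrix g x₀ y i j = bilinAt g ((extChartAt (𝓡∂ n) x₀).symm y)
      (chartDeriv x₀ y (stdVec i)) (chartDeriv x₀ y (stdVec j)) := rfl

lemma bilinOf_coeffMatrix (g : BilinField n M) (x₀ : M) (y u v : Euc n) :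
    bilinOf (coeffMatrix g x₀ y) u v = bilinAt g ((extChartAt (𝓡∂ n) x₀).symm y)
      (chartDeriv x₀ y u) (chartDeriv x₀ y v) := by
  induction u using euc_induction with
  | h0 => simp
  | hadd a b ha hb => simp only [map_add, _root_.add_apply, ha, hb]
  | hsmul c a ha => simp only [map_smul, _root_.smul_apply, ha]
  | he i =>
    induction v using euc_induction with
    | h0 => simp
    | hadd a b ha hb => simp only [map_add, ha, hb]
    | hsmul c a ha => simp only [map_smul, ha]
    | he j => rw [bilinOf_stdVec, coeffMatrix_apply]

lemma covectorInChart_eq (α : CovectorField n M) (x₀ : M) (i : Fin n) (y : Euc n) :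
    covectorInChart α x₀ i y =
      covectorAt α ((extChartAt (𝓡∂ n) x₀).symm y) (chartDeriv x₀ y (stdVec i)) := rfl

lemma isOpen_chartDomain (x₀ : M) : IsOpen (chartDomain (n := n) x₀) := isOpen_interior

lemma chartDomain_subset (x₀ : M) :
    chartDomain (n := n) x₀ ⊆ (extChartAt (𝓡∂ n) x₀).target := interior_subset

/-- The part of the coordinate domain around `x₀` which lies in the chart around `x₁`. -/
def overlap (x₀ x₁ : M) : Set (Euc n) :=
  chartDomain x₀ ∩ (extChartAt (𝓡∂ n) x₀).symm ⁻¹' (extChartAt (𝓡∂ n) x₁).source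

lemma isOpen_overlap (x₀ x₁ : M) : IsOpen (overlap (n := n) x₀ x₁) :=
  ((continuousOn_extChartAt_symm x₀).mono (chartDomain_subset x₀)).isOpen_inter_preimage
    (isOpen_chartDomain x₀) (isOpen_extChartAt_source x₁)

/-- The change of coordinates from the chart around `x₀` to the chart around `x₁`. -/
def transition (x₀ x₁ : M) (y : Euc n) : Euc n :=
  extChartAt (𝓡∂ n) x₁ ((extChartAt (𝓡∂ n) x₀).symm y)

lemma symm_transition {x₀ x₁ : M} {y : Euc n} (hy : y ∈ overlap x₀ x₁) :
    (extChartAt (𝓡∂ n) x₁).symm (transition x₀ x₁ y) = (extChartAt (𝓡∂ n) x₀).symm y :=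
  (extChartAt (𝓡∂ n) x₁).left_inv hy.2

variable [IsManifold (𝓡∂ n) ∞ M]

/-- Being an interior point of `M` can be tested in any chart of the atlas, not only in the
preferred chart at that point. -/
lemma mem_chartDomain_iff {x₀ : M} {y : Euc n} (hy : y ∈ (extChartAt (𝓡∂ n) x₀).target) :
    y ∈ chartDomain x₀ ↔ (extChartAt (𝓡∂ n) x₀).symm y ∈ (𝓡∂ n).interior M := by
  have hs := (extChartAt (𝓡∂ n) x₀).map_target hy
  rw [extChartAt_source] at hs
  have h := ModelWithCorners.isInteriorPoint_iff_of_mem_atlas (I := 𝓡∂ n) (n := ∞) (M := M)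
    (by simp) (chart_mem_atlas _ x₀) hs
  change _ ↔ (𝓡∂ n).IsInteriorPoint _
  rw [h]
  change _ ↔ extChartAt (𝓡∂ n) x₀ ((extChartAt (𝓡∂ n) x₀).symm y) ∈ _
  rw [(extChartAt (𝓡∂ n) x₀).right_inv hy]
  rfl

lemma symm_mem_interior {x₀ : M} {y : Euc n} (hy : y ∈ chartDomain x₀) :
    (extChartAt (𝓡∂ n) x₀).symm y ∈ (𝓡∂ n).interior M :=
  (mem_chartDomain_iff (chartDomain_subset x₀ hy)).1 hy

lemma extChartAt_mem_chartDomain {x₀ x : M} (hx : x ∈ (extChartAt (𝓡∂ n) x₀).source)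
    (hi : x ∈ (𝓡∂ n).interior M) : extChartAt (𝓡∂ n) x₀ x ∈ chartDomain x₀ := by
  rw [mem_chartDomain_iff ((extChartAt (𝓡∂ n) x₀).map_source hx),
    (extChartAt (𝓡∂ n) x₀).left_inv hx]
  exact hi

lemma chartDeriv_bijective {x₀ : M} {y : Euc n} (hy : y ∈ (extChartAt (𝓡∂ n) x₀).target) :
    Function.Bijective (chartDeriv x₀ y) := by
  have : IsManifold (𝓡∂ n) 1 M := IsManifold.of_le (m := 1) (n := ∞) (by simp)
  exact (isInvertible_mfderivWithin_extChartAt_symm hy).bijective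

lemma mapsTo_transition (x₀ x₁ : M) :
    Set.MapsTo (transition (n := n) x₀ x₁) (overlap x₀ x₁) (overlap x₁ x₀) := by
  intro y hy
  refine ⟨extChartAt_mem_chartDomain hy.2 (symm_mem_interior hy.1), ?_⟩
  rw [Set.mem_preimage, transition, (extChartAt (𝓡∂ n) x₁).left_inv hy.2]
  exact (extChartAt (𝓡∂ n) x₀).map_target (chartDomain_subset x₀ hy.1)

lemma transition_transition {x₀ x₁ : M} {y : Euc n} (hy : y ∈ overlap x₀ x₁) :
    transition x₁ x₀ (transition x₀ x₁ y) = y := by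
  rw [transition, symm_transition hy, (extChartAt (𝓡∂ n) x₀).right_inv (chartDomain_subset x₀ hy.1)]

lemma contDiffOn_transition (x₀ x₁ : M) :
    ContDiffOn ℝ ∞ (transition (n := n) x₀ x₁) (overlap x₀ x₁) := by
  refine (contDiffOn_ext_coord_change (I := 𝓡∂ n) (n := ∞) x₁ x₀).mono fun y hy =>
    ⟨chartDomain_subset x₀ hy.1, hy.2⟩

/-- The chain rule for the identity between inverse charts composed with the change of coordinates.
On the coordinate domain the range of the model is a neighbourhood of `y`, so the derivative within
it is the full derivative. -/
lemma chartDeriv_transition {x₀ x₁ : M} {y : Euc n} (hy : y ∈ overlap x₀ x₁) :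
    chartDeriv x₀ y = (chartDeriv x₁ (transition x₀ x₁ y)).comp
      (fderiv ℝ (transition x₀ x₁) y) := by
  have hI : IsManifold (𝓡∂ n) 1 M := IsManifold.of_le (m := 1) (n := ∞) (by simp)
  have hyT := chartDomain_subset x₀ hy.1
  have hr : Set.range (𝓡∂ n) ∈ 𝓝 y :=
    mem_of_superset ((isOpen_chartDomain x₀).mem_nhds hy.1)
      ((chartDomain_subset x₀).trans (extChartAt_target_subset_range x₀))
  have hU : UniqueMDiffWithinAt 𝓘(ℝ, Euc n) (Set.range (𝓡∂ n)) y :=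
    (𝓡∂ n).uniqueMDiffOn _ (extChartAt_target_subset_range x₀ hyT)
  have hτ : DifferentiableAt ℝ (transition x₀ x₁) y :=
    ((contDiffOn_transition x₀ x₁).contDiffAt ((isOpen_overlap x₀ x₁).mem_nhds hy)).differentiableAt
      (by simp)
  have hmaps : transition x₀ x₁ y ∈ (extChartAt (𝓡∂ n) x₁).target :=
    chartDomain_subset x₁ (mapsTo_transition x₀ x₁ hy).1
  have h1 := mfderivWithin_comp (I := 𝓘(ℝ, Euc n)) (I' := 𝓘(ℝ, Euc n)) (I'' := 𝓡∂ n)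
    (f := transition x₀ x₁) (g := (extChartAt (𝓡∂ n) x₁).symm) (s := Set.range (𝓡∂ n))
    (u := Set.range (𝓡∂ n)) y (mdifferentiableWithinAt_extChartAt_symm hmaps)
    hτ.mdifferentiableAt.mdifferentiableWithinAt (fun z _ => ⟨_, rfl⟩) hU
  have h2 : (extChartAt (𝓡∂ n) x₁).symm ∘ transition x₀ x₁ =ᶠ[𝓝[Set.range (𝓡∂ n)] y]
      (extChartAt (𝓡∂ n) x₀).symm := by
    refine mem_nhdsWithin_of_mem_nhds ?_
    filter_upwards [(isOpen_overlap x₀ x₁).mem_nhds hy] with z hz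
    exact symm_transition hz
  have h3 := h2.mfderivWithin_eq (I := 𝓘(ℝ, Euc n)) (I' := 𝓡∂ n) (symm_transition hy)
  have h4 : mfderivWithin 𝓘(ℝ, Euc n) 𝓘(ℝ, Euc n) (transition x₀ x₁) (Set.range (𝓡∂ n)) y =
      fderiv ℝ (transition x₀ x₁) y := by
    rw [mfderivWithin_eq_fderivWithin, fderivWithin_of_mem_nhds hr]
  rw [h4] at h1
  exact h3.symm.trans h1

lemma bilinOf_coeffMatrix_transition (g : BilinField n M) {x₀ x₁ : M} {y : Euc n}
    (hy : y ∈ overlap x₀ x₁) (u v : Euc n) :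
    bilinOf (coeffMatrix g x₀ y) u v = bilinOf (coeffMatrix g x₁ (transition x₀ x₁ y))
      (fderiv ℝ (transition x₀ x₁) y u) (fderiv ℝ (transition x₀ x₁) y v) := by
  rw [bilinOf_coeffMatrix, bilinOf_coeffMatrix, symm_transition hy, chartDeriv_transition hy]
  rfl

end Charts

/-! ### Norms of covectors -/

section DualNorm

variable {n : ℕ}

/-- `B` is symmetric and positive definite. -/
structure IsInnerForm (B : Euc n →L[ℝ] Euc n →L[ℝ] ℝ) : Prop where
  symm : ∀ u v, B u v = B v u
  pos : ∀ v, v ≠ 0 → 0 < B v v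

lemma IsInnerForm.nonneg {B : Euc n →L[ℝ] Euc n →L[ℝ] ℝ} (hB : IsInnerForm B) (v : Euc n) :
    0 ≤ B v v := by
  rcases eq_or_ne v 0 with rfl | hv
  · simp
  · exact (hB.pos v hv).le

lemma IsInnerForm.sq_le {B : Euc n →L[ℝ] Euc n →L[ℝ] ℝ} (hB : IsInnerForm B) (u v : Euc n) :
    B u v ^ 2 ≤ B u u * B v v := by
  rcases eq_or_ne v 0 with rfl | hv
  · simp
  have hpos := hB.pos v hv
  have h := hB.nonneg (B v v • u - B u v • v)
  simp only [map_sub, map_smul, _root_.sub_apply, _root_.smul_apply, smul_eq_mul, hB.symm v u] at h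
  nlinarith [h]

lemma IsInnerForm.comp {B : Euc n →L[ℝ] Euc n →L[ℝ] ℝ} (hB : IsInnerForm B)
    {L : Euc n →L[ℝ] Euc n} (hL : Function.Injective L) {C : Euc n →L[ℝ] Euc n →L[ℝ] ℝ}
    (hC : ∀ u v, C u v = B (L u) (L v)) : IsInnerForm C :=
  ⟨fun u v => by rw [hC, hC, hB.symm], fun v hv => by
    rw [hC]; exact hB.pos _ fun h => hv (hL (by rw [h, map_zero]))⟩

lemma isSymm_of_isInnerForm {A : Matrix (Fin n) (Fin n) ℝ} (hA : IsInnerForm (bilinOf A)) :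
    A.IsSymm := by
  refine Matrix.IsSymm.ext fun i j => ?_
  rw [← bilinOf_stdVec A j i, ← bilinOf_stdVec A i j, hA.symm]

lemma det_pos_of_isInnerForm {A : Matrix (Fin n) (Fin n) ℝ} (hA : IsInnerForm (bilinOf A)) :
    0 < A.det := by
  refine Matrix.PosDef.det_pos (Matrix.PosDef.of_dotProduct_mulVec_pos ?_ fun x hx => ?_)
  · rw [Matrix.IsHermitian, Matrix.conjTranspose_eq_transpose_of_trivial]
    exact isSymm_of_isInnerForm hA
  · have h := hA.pos (WithLp.toLp 2 x) (by simpa using hx)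
    rw [bilinOf_apply] at h
    refine h.trans_eq ?_
    simp only [star_trivial, dotProduct, Matrix.mulVec, Finset.mul_sum]
    exact Finset.sum_congr rfl fun i _ => Finset.sum_congr rfl fun j _ => by ring

/-- The norm of a linear form with respect to an inner product. -/
def dualNorm (B : Euc n →L[ℝ] Euc n →L[ℝ] ℝ) (a : Euc n →L[ℝ] ℝ) : ℝ :=
  sSup {r : ℝ | ∃ v, B v v ≤ 1 ∧ r = |a v|}

/-- `N` represents `a`. Cauchy–Schwarz bounds the supremum, which is attained at `N / √(a N)`, or at
`0` when `a N = 0`. -/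
lemma dualNorm_eq_sqrt {B : Euc n →L[ℝ] Euc n →L[ℝ] ℝ} (hB : IsInnerForm B) {a : Euc n →L[ℝ] ℝ}
    {N : Euc n} (hN : ∀ v, B N v = a v) : dualNorm B a = √(a N) := by
  have hub : ∀ v, B v v ≤ 1 → |a v| ≤ √(a N) := fun v hv => by
    refine Real.abs_le_sqrt ?_
    have h := hB.sq_le N v
    rw [hN, hN] at h
    have := hB.nonneg N
    rw [hN] at this
    nlinarith
  refine le_antisymm (csSup_le ⟨0, 0, by simp, by simp⟩ ?_) ?_
  · rintro _ ⟨v, hv, rfl⟩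
    exact hub v hv
  · have hbdd : BddAbove {r : ℝ | ∃ v, B v v ≤ 1 ∧ r = |a v|} :=
      ⟨√(a N), by rintro _ ⟨v, hv, rfl⟩; exact hub v hv⟩
    have h0 : 0 ≤ a N := by rw [← hN]; exact hB.nonneg N
    rcases h0.eq_or_lt with h0 | h0
    · rw [← h0, Real.sqrt_zero]
      exact le_csSup hbdd ⟨0, by simp, by simp⟩
    · have hs := Real.sqrt_pos.2 h0
      have hq := Real.sq_sqrt h0.le
      refine le_csSup hbdd ⟨(√(a N))⁻¹ • N, ?_, ?_⟩
      · simp only [map_smul, _root_.smul_apply, smul_eq_mul, hN]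
        rw [← mul_assoc, ← mul_inv, ← sq, hq, inv_mul_cancel₀ h0.ne']
      · rw [map_smul, smul_eq_mul, abs_of_pos (by positivity), inv_mul_eq_div, eq_div_iff hs.ne',
          ← sq, hq]

/-- The formula `|a|² = Aⁱʲ aᵢ aⱼ`, where the components are taken with respect to a frame. -/
lemma dualNorm_sq {B : Euc n →L[ℝ] Euc n →L[ℝ] ℝ} (hB : IsInnerForm B) (a : Euc n →L[ℝ] ℝ)
    {L : Euc n →L[ℝ] Euc n} (hL : Function.Bijective L) {A : Matrix (Fin n) (Fin n) ℝ}
    (hA : ∀ u v, bilinOf A u v = B (L u) (L v)) :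
    dualNorm B a ^ 2 = ∑ i, ∑ j, A⁻¹ i j * a (L (stdVec i)) * a (L (stdVec j)) := by
  have hC := hB.comp hL.1 hA
  have hS := bilinOf_sharp (det_pos_of_isInnerForm hC).ne' (isSymm_of_isInnerForm hC) (a.comp L)
  have h0 : 0 ≤ (a.comp L) (sharp A (a.comp L)) := by rw [← hS]; exact hC.nonneg _
  have h := apply_sharp A (a.comp L)
  rw [dualNorm_eq_sqrt hB (N := L (sharp A (a.comp L))) fun v => ?_]
  · change √((a.comp L) (sharp A (a.comp L))) ^ 2 = _
    rw [Real.sq_sqrt h0, h]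
    rfl
  · obtain ⟨w, rfl⟩ := hL.2 v
    rw [← hA, hS]
    rfl

lemma exists_dual_vector {B : Euc n →L[ℝ] Euc n →L[ℝ] ℝ} (hB : IsInnerForm B) (a : Euc n →L[ℝ] ℝ) :
    ∃ N, ∀ v, B N v = a v := by
  have hinj : Function.Injective (B : Euc n →ₗ[ℝ] Euc n →L[ℝ] ℝ) := by
    rw [← LinearMap.ker_eq_bot, LinearMap.ker_eq_bot']
    intro v hv
    by_contra h
    have := hB.pos v h
    rw [show B v = 0 from hv] at this
    simp at this
  have hsurj := (LinearMap.injective_iff_surjective_of_finrank_eq_finrank (by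
    rw [← LinearEquiv.finrank_eq (LinearMap.toContinuousLinearMap (𝕜 := ℝ) (E := Euc n) (F' := ℝ))]
    exact (Subspace.dual_finrank_eq).symm)).1 hinj
  obtain ⟨N, hN⟩ := hsurj a
  exact ⟨N, fun v => by rw [← hN]; rfl⟩

lemma dualNorm_nonneg (B : Euc n →L[ℝ] Euc n →L[ℝ] ℝ) (a : Euc n →L[ℝ] ℝ) : 0 ≤ dualNorm B a :=
  Real.sSup_nonneg (by rintro _ ⟨v, _, rfl⟩; positivity)

lemma sq_apply_le_dualNorm {B : Euc n →L[ℝ] Euc n →L[ℝ] ℝ} (hB : IsInnerForm B)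
    (a : Euc n →L[ℝ] ℝ) (v : Euc n) : a v ^ 2 ≤ dualNorm B a ^ 2 * B v v := by
  obtain ⟨N, hN⟩ := exists_dual_vector hB a
  have h := hB.sq_le N v
  have h0 := hB.nonneg N
  rw [hN] at h h0
  rw [dualNorm_eq_sqrt hB hN, Real.sq_sqrt h0]
  rwa [hN] at h

end DualNorm

/-! ### Asymptotically hyperbolic metrics in charts -/

section AHCharts

variable {n : ℕ} [NeZero n] {M : Type*} [TopologicalSpace M]
  [ChartedSpace (EuclideanHalfSpace n) M]

/-- `gb = ρ² g` is a metric of class `C²` up to the boundary, with `|dρ| = 1` on the boundary. -/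
structure IsAHPair (ρ : M → ℝ) (gb g : BilinField n M) : Prop where
  defining : IsDefiningFunction (n := n) ρ
  contDiffOn : ∀ (x₀ : M) (i j : Fin n),
    ContDiffOn ℝ 2 (fun y => coeffMatrix gb x₀ y i j) (extChartAt (𝓡∂ n) x₀).target
  inner : ∀ x, IsInnerForm (bilinAt gb x)
  conformal : ∀ x ∈ (𝓡∂ n).interior M, ∀ v w, bilinAt gb x v w = ρ x ^ 2 * bilinAt g x v w
  norm_eq_one : ∀ x ∈ (𝓡∂ n).boundary M,
    dualNorm (bilinAt gb x) (covectorAt (differential ρ) x) = 1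

lemma IsAsymptoticallyHyperbolic.exists_pair {l : ℕ} (hl : 2 ≤ l) {β : ℝ≥0} {g : BilinField n M}
    (hg : IsAsymptoticallyHyperbolic l β g) :
    ∃ (ρ : M → ℝ) (gb : BilinField n M), IsAHPair ρ gb g := by
  obtain ⟨ρ, gb, h1, h2, h3, h4⟩ := hg
  exact ⟨ρ, gb.inner, h1, fun x₀ i j => (h2 x₀ i j).1.of_le (by exact_mod_cast hl),
    fun x => ⟨gb.symm x, gb.pos x⟩, h3, h4⟩

lemma diffNorm_eq (g : BilinField n M) (α : CovectorField n M) (x : M) :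
    diffNorm g α x = dualNorm (bilinAt g x) (covectorAt α x) := rfl

variable {ρ : M → ℝ} {gb g : BilinField n M}

namespace IsAHPair

lemma pos_of_interior (h : IsAHPair ρ gb g) {x : M} (hx : x ∈ (𝓡∂ n).interior M) : 0 < ρ x := by
  refine (h.defining.nonneg x).lt_of_ne' fun h0 => ?_
  rw [h.defining.eq_zero_iff, ← ModelWithCorners.compl_interior] at h0
  exact h0 hx

lemma isInnerForm (h : IsAHPair ρ gb g) {x : M} (hx : x ∈ (𝓡∂ n).interior M) :
    IsInnerForm (bilinAt g x) := by
  have hp := pow_pos (h.pos_of_interior hx) 2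
  refine ⟨fun u v => mul_left_cancel₀ hp.ne' ?_, fun v hv => ?_⟩
  · rw [← h.conformal x hx, ← h.conformal x hx, (h.inner x).symm]
  · have := (h.inner x).pos v hv
    rw [h.conformal x hx] at this
    exact (mul_pos_iff_of_pos_left hp).1 this

variable [IsManifold (𝓡∂ n) ∞ M]

lemma inChart_pos (h : IsAHPair ρ gb g) {x₀ : M} {y : Euc n} (hy : y ∈ chartDomain x₀) :
    0 < inChart (n := n) ρ x₀ y := h.pos_of_interior (symm_mem_interior hy)

lemma inChart_eq_zero (h : IsAHPair ρ gb g) {x₀ : M} {y : Euc n}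
    (hy : y ∈ (extChartAt (𝓡∂ n) x₀).target) (hy' : y ∉ chartDomain x₀) :
    inChart (n := n) ρ x₀ y = 0 := by
  rw [inChart, h.defining.eq_zero_iff, ← ModelWithCorners.compl_interior]
  exact fun hi => hy' ((mem_chartDomain_iff hy).2 hi)

lemma isInnerForm_chart (h : IsAHPair ρ gb g) {x₀ : M} {y : Euc n}
    (hy : y ∈ (extChartAt (𝓡∂ n) x₀).target) : IsInnerForm (bilinOf (coeffMatrix gb x₀ y)) :=
  (h.inner _).comp (chartDeriv_bijective hy).1 (bilinOf_coeffMatrix gb x₀ y)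

lemma isInnerForm_chart' (h : IsAHPair ρ gb g) {x₀ : M} {y : Euc n}
    (hy : y ∈ chartDomain x₀) : IsInnerForm (bilinOf (coeffMatrix g x₀ y)) :=
  (h.isInnerForm (symm_mem_interior hy)).comp (chartDeriv_bijective (chartDomain_subset x₀ hy)).1
    (bilinOf_coeffMatrix g x₀ y)

lemma isMetricOn (h : IsAHPair ρ gb g) (x₀ : M) :
    IsMetricOn (extChartAt (𝓡∂ n) x₀).target (coeffMatrix gb x₀) where
  uniqueDiffOn := uniqueDiffOn_extChartAt_target x₀
  contDiffOn := h.contDiffOn x₀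
  det_ne_zero _ hy := (det_pos_of_isInnerForm (h.isInnerForm_chart hy)).ne'
  symm _ hy := isSymm_of_isInnerForm (h.isInnerForm_chart hy)

lemma contDiffOn_inChart (h : IsAHPair ρ gb g) (x₀ : M) :
    ContDiffOn ℝ ∞ (inChart (n := n) ρ x₀) (extChartAt (𝓡∂ n) x₀).target :=
  contMDiffOn_iff_contDiffOn.1
    (h.defining.contMDiff.comp_contMDiffOn (contMDiffOn_extChartAt_symm x₀))

lemma coeffMatrix_eq (h : IsAHPair ρ gb g) {x₀ : M} {y : Euc n} (hy : y ∈ chartDomain x₀) :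
    coeffMatrix g x₀ y = (inChart (n := n) ρ x₀ y ^ 2)⁻¹ • coeffMatrix gb x₀ y := by
  ext i j
  rw [Matrix.smul_apply, coeffMatrix_apply, coeffMatrix_apply,
    h.conformal _ (symm_mem_interior hy), smul_eq_mul, inChart, inv_mul_cancel_left₀]
  exact (pow_pos (h.inChart_pos hy) 2).ne'

lemma isMetricOn_chartDomain (h : IsAHPair ρ gb g) (x₀ : M) :
    IsMetricOn (chartDomain x₀) (coeffMatrix g x₀) where
  uniqueDiffOn := (isOpen_chartDomain x₀).uniqueDiffOn
  contDiffOn i j := by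
    have h1 : ContDiffOn ℝ 2 (fun y => (inChart (n := n) ρ x₀ y ^ 2)⁻¹ * coeffMatrix gb x₀ y i j)
        (chartDomain x₀) :=
      (((((h.contDiffOn_inChart x₀).of_le (by norm_cast)).mono
        (chartDomain_subset x₀)).pow 2).inv fun y hy => (pow_pos (h.inChart_pos hy) 2).ne').mul
        ((h.contDiffOn x₀ i j).mono (chartDomain_subset x₀))
    exact h1.congr fun y hy => by rw [h.coeffMatrix_eq hy]; rfl
  det_ne_zero _ hy := (det_pos_of_isInnerForm (h.isInnerForm_chart' hy)).ne'
  symm _ hy := isSymm_of_isInnerForm (h.isInnerForm_chart' hy)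

lemma fderivWithin_inChart (h : IsAHPair ρ gb g) {x₀ : M} {y : Euc n}
    (hy : y ∈ (extChartAt (𝓡∂ n) x₀).target) (v : Euc n) :
    fderivWithin ℝ (inChart (n := n) ρ x₀) (extChartAt (𝓡∂ n) x₀).target y v =
      covectorAt (differential ρ) ((extChartAt (𝓡∂ n) x₀).symm y) (chartDeriv x₀ y v) := by
  have hI : IsManifold (𝓡∂ n) 1 M := IsManifold.of_le (m := 1) (n := ∞) (by simp)
  have h1 := mfderiv_comp_mfderivWithin (I := 𝓘(ℝ, Euc n)) (I' := 𝓡∂ n) (I'' := 𝓘(ℝ, ℝ))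
    (f := (extChartAt (𝓡∂ n) x₀).symm) (g := ρ) (s := Set.range (𝓡∂ n)) y
    ((h.defining.contMDiff.mdifferentiable (by simp)) _)
    (mdifferentiableWithinAt_extChartAt_symm hy)
    ((𝓡∂ n).uniqueMDiffOn _ (extChartAt_target_subset_range x₀ hy))
  have h2 : fderivWithin ℝ (inChart (n := n) ρ x₀) (extChartAt (𝓡∂ n) x₀).target y =
      mfderivWithin 𝓘(ℝ, Euc n) 𝓘(ℝ, ℝ) (ρ ∘ (extChartAt (𝓡∂ n) x₀).symm)
        (Set.range (𝓡∂ n)) y := by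
    rw [mfderivWithin_eq_fderivWithin]
    -- The target of the chart and the range of the model agree near `y`, boundary points included,
    -- so derivatives within either set coincide.
    exact fderivWithin_congr_set (nhdsWithin_eq_iff_eventuallyEq.1
      (nhdsWithin_extChartAt_target_eq_of_mem hy))
  rw [h2, h1]
  rfl

/-- `|dρ|²` in a chart. -/
lemma fderivWithin_gradOf (h : IsAHPair ρ gb g) {x₀ : M} {y : Euc n}
    (hy : y ∈ (extChartAt (𝓡∂ n) x₀).target) (h0 : inChart (n := n) ρ x₀ y = 0) :
    fderivWithin ℝ (inChart (n := n) ρ x₀) (extChartAt (𝓡∂ n) x₀).target y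
      (gradOf (extChartAt (𝓡∂ n) x₀).target (coeffMatrix gb x₀) (inChart (n := n) ρ x₀) y) = 1 := by
  have hd := dualNorm_sq (h.inner _) (covectorAt (differential ρ) ((extChartAt (𝓡∂ n) x₀).symm y))
    (chartDeriv_bijective hy) (bilinOf_coeffMatrix gb x₀ y)
  rw [h.norm_eq_one _ ((h.defining.eq_zero_iff _).1 h0), one_pow] at hd
  rw [hd, gradOf, apply_sharp]
  simp only [h.fderivWithin_inChart hy]

/-- The scalar curvature may be computed in any chart. -/
lemma scalarCurvature_eq (h : IsAHPair ρ gb g) {x₀ : M} {y : Euc n} (hy : y ∈ chartDomain x₀) :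
    scalarCurvature g ((extChartAt (𝓡∂ n) x₀).symm y) = scalarCoeff (coeffMatrix g x₀) y := by
  set x := (extChartAt (𝓡∂ n) x₀).symm y with hx
  -- At `x`, the definition uses the chart around `x` itself; it is compared with the chart around
  -- `x₀` by the change of coordinates.
  have hov : y ∈ overlap x₀ x := ⟨hy, mem_extChartAt_source x⟩
  have := scalarCoeff_transform (isOpen_overlap x₀ x) (isOpen_chartDomain x)
    ((h.isMetricOn_chartDomain x₀).mono_open (isOpen_overlap x₀ x) Set.inter_subset_left)
    (h.isMetricOn_chartDomain x) ((contDiffOn_transition x₀ x).of_le (by norm_cast))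
    (fun z hz => (mapsTo_transition x₀ x hz).1)
    (fun z hz u v => bilinOf_coeffMatrix_transition g hz u v) hov
  rw [this, scalarCurvature, transition]

lemma diffNorm_sq (h : IsAHPair ρ gb g) (α : CovectorField n M) {x₀ : M} {y : Euc n}
    (hy : y ∈ chartDomain x₀) :
    diffNorm g α ((extChartAt (𝓡∂ n) x₀).symm y) ^ 2 = ∑ i, ∑ j, (coeffMatrix g x₀ y)⁻¹ i j *
      covectorInChart α x₀ i y * covectorInChart α x₀ j y :=
  dualNorm_sq (h.isInnerForm (symm_mem_interior hy)) _
    (chartDeriv_bijective (chartDomain_subset x₀ hy)) (bilinOf_coeffMatrix g x₀ y)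

end IsAHPair

end AHCharts

/-! ### The volume measure in charts -/

lemma measurableSet_inter_preimage {X Y : Type*} [TopologicalSpace X] [MeasurableSpace X]
    [OpensMeasurableSpace X] [TopologicalSpace Y] [MeasurableSpace Y] [BorelSpace Y] {f : X → Y}
    {s : Set X} (hf : ContinuousOn f s) (hs : MeasurableSet s) {t : Set Y} (ht : MeasurableSet t) :
    MeasurableSet (s ∩ f ⁻¹' t) := by
  have h := (continuousOn_iff_continuous_domRestrict.1 hf).measurable ht
  have := hs.subtype_image h
  rwa [Set.domRestrict_eq, Set.preimage_comp, Subtype.image_preimage_coe] at this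

lemma det_jacobian {n : ℕ} (J : Euc n →L[ℝ] Euc n) : (jacobian J).det = J.det := by
  have h := LinearMap.det_toMatrix (EuclideanSpace.basisFun (Fin n) ℝ).toBasis (J : Euc n →ₗ[ℝ] Euc n)
  rw [ContinuousLinearMap.det, ← h]
  congr 1

section Volume

variable {n : ℕ} [NeZero n] {M : Type*} [TopologicalSpace M]
  [ChartedSpace (EuclideanHalfSpace n) M]

lemma exists_finset_iUnion_source [CompactSpace M] :
    ∃ t : Finset M, ⋃ x₀ : t, (extChartAt (𝓡∂ n) (x₀ : M)).source = Set.univ := by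
  obtain ⟨t, ht⟩ := isCompact_univ.elim_finite_subcover
    (fun x₀ : M => (extChartAt (𝓡∂ n) x₀).source) (fun x₀ => isOpen_extChartAt_source x₀)
    fun x _ => Set.mem_iUnion.2 ⟨x, mem_extChartAt_source x⟩
  refine ⟨t, Set.univ_subset_iff.1 (ht.trans fun x hx => ?_)⟩
  simpa using hx

/-- The density of the volume in the chart around `x₀`. -/
def volDensity (g : BilinField n M) (x₀ : M) (y : Euc n) : ℝ := √(coeffMatrix g x₀ y).det

/-- The Gram matrices are related by `A = Pᵀ B P`, so their determinants differ by `(det P)²`. -/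
lemma volDensity_transition [IsManifold (𝓡∂ n) ∞ M] (g : BilinField n M) {x₀ x₁ : M} {y : Euc n}
    (hy : y ∈ overlap x₀ x₁) :
    volDensity g x₀ y =
      |(fderiv ℝ (transition x₀ x₁) y).det| * volDensity g x₁ (transition x₀ x₁ y) := by
  have h := eq_transpose_mul_mul_of_bilinOf (bilinOf_coeffMatrix_transition g hy)
  rw [volDensity, volDensity, h, Matrix.det_mul, Matrix.det_mul, Matrix.det_transpose, det_jacobian,
    mul_comm (ContinuousLinearMap.det _), mul_assoc, ← sq, mul_comm,
    Real.sqrt_mul (sq_nonneg _), Real.sqrt_sq_eq_abs]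

lemma IsAHPair.volDensity_pos [IsManifold (𝓡∂ n) ∞ M] {ρ : M → ℝ} {gb g : BilinField n M}
    (h : IsAHPair ρ gb g) {x₀ : M} {y : Euc n}
    (hy : y ∈ chartDomain x₀) : 0 < volDensity g x₀ y :=
  Real.sqrt_pos.2 (det_pos_of_isInnerForm (h.isInnerForm_chart' hy))

lemma IsAHPair.continuousOn_volDensity [IsManifold (𝓡∂ n) ∞ M] {ρ : M → ℝ} {gb g : BilinField n M}
    (h : IsAHPair ρ gb g) (x₀ : M) :
    ContinuousOn (volDensity g x₀) (chartDomain x₀) :=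
  (contDiffOn_det (h.isMetricOn_chartDomain x₀).contDiffOn).continuousOn.sqrt

/-- The measure `√(det g) dy` on the coordinate domain. -/
def coordVolume (g : BilinField n M) (x₀ : M) : Measure (Euc n) :=
  (volume.restrict (chartDomain x₀)).withDensity fun y => ENNReal.ofReal (volDensity g x₀ y)

lemma coordVolume_absolutelyContinuous (g : BilinField n M) (x₀ : M) :
    coordVolume g x₀ ≪ volume.restrict (chartDomain x₀) := withDensity_absolutelyContinuous _ _

lemma coordVolume_eq (g : BilinField n M) (x₀ : M) : coordVolume g x₀ =
    (volume.restrict (chartDomain x₀)).withDensity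
      fun y => ((Real.toNNReal (volDensity g x₀ y) : ℝ≥0) : ℝ≥0∞) := rfl

/-- The density is positive, so properties holding almost everywhere for the Riemannian volume hold
almost everywhere in coordinates. -/
lemma IsAHPair.absolutelyContinuous_coordVolume [IsManifold (𝓡∂ n) ∞ M] {ρ : M → ℝ}
    {gb g : BilinField n M} (h : IsAHPair ρ gb g) (x₀ : M) :
    volume.restrict (chartDomain x₀) ≪ coordVolume g x₀ := by
  refine withDensity_absolutelyContinuous' ?_ ?_
  · exact ((h.continuousOn_volDensity x₀).aemeasurable
      (isOpen_chartDomain x₀).measurableSet).ennreal_ofReal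
  · filter_upwards [ae_restrict_mem (isOpen_chartDomain x₀).measurableSet] with y hy
    simpa using h.volDensity_pos hy

variable [MeasurableSpace M]

lemma chartVolume_eq (g : BilinField n M) (x₀ : M) :
    chartVolume g x₀ = (coordVolume g x₀).map (extChartAt (𝓡∂ n) x₀).symm := rfl

variable [BorelSpace M]

lemma aemeasurable_symm (g : BilinField n M) (x₀ : M) :
    AEMeasurable (extChartAt (𝓡∂ n) x₀).symm (coordVolume g x₀) :=
  (((continuousOn_extChartAt_symm x₀).mono (chartDomain_subset x₀)).aemeasurable
    (isOpen_chartDomain x₀).measurableSet).mono_ac (coordVolume_absolutelyContinuous g x₀)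

lemma chartVolume_apply (g : BilinField n M) (x₀ : M) {S : Set M} (hS : MeasurableSet S) :
    chartVolume g x₀ S = ∫⁻ y in chartDomain x₀ ∩ (extChartAt (𝓡∂ n) x₀).symm ⁻¹' S,
      ENNReal.ofReal (volDensity g x₀ y) := by
  have hm := measurableSet_inter_preimage ((continuousOn_extChartAt_symm (I := 𝓡∂ n) x₀).mono
    (chartDomain_subset x₀)) (isOpen_chartDomain x₀).measurableSet hS
  have hae : (extChartAt (𝓡∂ n) x₀).symm ⁻¹' S =ᵐ[coordVolume g x₀]
      (chartDomain x₀ ∩ (extChartAt (𝓡∂ n) x₀).symm ⁻¹' S : Set (Euc n)) := by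
    refine (coordVolume_absolutelyContinuous g x₀).ae_le ?_
    filter_upwards [ae_restrict_mem (isOpen_chartDomain x₀).measurableSet] with y hy
    exact propext ⟨fun h => ⟨hy, h⟩, fun h => h.2⟩
  rw [chartVolume_eq, Measure.map_apply_of_aemeasurable (aemeasurable_symm g x₀) hS,
    measure_congr hae, coordVolume, withDensity_apply _ hm,
    Measure.restrict_restrict hm, Set.inter_right_comm, Set.inter_self]

lemma chartVolume_compl_source (g : BilinField n M) (x₀ : M) :
    chartVolume g x₀ ((extChartAt (𝓡∂ n) x₀).source)ᶜ = 0 := by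
  rw [chartVolume_apply g x₀ (isOpen_extChartAt_source x₀).measurableSet.compl]
  have : chartDomain x₀ ∩ (extChartAt (𝓡∂ n) x₀).symm ⁻¹' ((extChartAt (𝓡∂ n) x₀).source)ᶜ
      = (∅ : Set (Euc n)) :=
    Set.eq_empty_of_forall_notMem fun y hy =>
      hy.2 ((extChartAt (𝓡∂ n) x₀).map_target (chartDomain_subset x₀ hy.1))
  rw [this]
  simp

lemma aemeasurable_chart (g : BilinField n M) (x₀ : M) :
    AEMeasurable (extChartAt (𝓡∂ n) x₀) (chartVolume g x₀) := by
  rw [← Measure.restrict_eq_self_of_ae_mem (s := (extChartAt (𝓡∂ n) x₀).source)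
    (mem_ae_iff.2 (chartVolume_compl_source g x₀))]
  exact (continuousOn_extChartAt x₀).aemeasurable (isOpen_extChartAt_source x₀).measurableSet

lemma map_chart_chartVolume (g : BilinField n M) (x₀ : M) :
    (chartVolume g x₀).map (extChartAt (𝓡∂ n) x₀) = coordVolume g x₀ := by
  have h := aemeasurable_chart g x₀
  rw [chartVolume_eq] at h ⊢
  rw [AEMeasurable.map_map_of_aemeasurable h (aemeasurable_symm g x₀)]
  conv_rhs => rw [← Measure.map_id (μ := coordVolume g x₀)]
  refine Measure.map_congr ((coordVolume_absolutelyContinuous g x₀).ae_le ?_)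
  filter_upwards [ae_restrict_mem (isOpen_chartDomain x₀).measurableSet] with y hy
  exact (extChartAt (𝓡∂ n) x₀).right_inv (chartDomain_subset x₀ hy)

lemma aemeasurable_chartVolume (g : BilinField n M) (x₀ : M) {f : M → ℝ}
    (hf : AEMeasurable (inChart (n := n) f x₀) (volume.restrict (chartDomain x₀))) :
    AEMeasurable f (chartVolume g x₀) := by
  have h1 : AEMeasurable (inChart (n := n) f x₀)
      ((chartVolume g x₀).map (extChartAt (𝓡∂ n) x₀)) := by
    rw [map_chart_chartVolume]
    exact hf.mono_ac (coordVolume_absolutelyContinuous g x₀)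
  refine (h1.comp_aemeasurable (aemeasurable_chart g x₀)).congr ?_
  filter_upwards [mem_ae_iff.2 (chartVolume_compl_source g x₀)] with x hx
  rw [Function.comp_apply, inChart, (extChartAt (𝓡∂ n) x₀).left_inv hx]

variable [IsManifold (𝓡∂ n) ∞ M]

/-- Change of variables: the Jacobian of the transition map is exactly the ratio of the two
densities. One inequality for all pairs of charts suffices, as their roles can be exchanged. -/
lemma chartVolume_le (g : BilinField n M) (x₀ x₁ : M) {S : Set M} (hS : MeasurableSet S)
    (hs : S ⊆ (extChartAt (𝓡∂ n) x₁).source) : chartVolume g x₀ S ≤ chartVolume g x₁ S := by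
  rw [chartVolume_apply g x₀ hS, chartVolume_apply g x₁ hS]
  set A := chartDomain x₀ ∩ (extChartAt (𝓡∂ n) x₀).symm ⁻¹' S with hA
  have hAo : A ⊆ overlap x₀ x₁ := fun y hy => ⟨hy.1, hs hy.2⟩
  have hAm : MeasurableSet A :=
    measurableSet_inter_preimage ((continuousOn_extChartAt_symm (I := 𝓡∂ n) x₀).mono
      (chartDomain_subset x₀)) (isOpen_chartDomain x₀).measurableSet hS
  have hd : ∀ y ∈ A, HasFDerivWithinAt (transition x₀ x₁) (fderiv ℝ (transition x₀ x₁) y) A y :=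
    fun y hy => (((contDiffOn_transition x₀ x₁).contDiffAt
      ((isOpen_overlap x₀ x₁).mem_nhds (hAo hy))).differentiableAt
      (by simp)).hasFDerivAt.hasFDerivWithinAt
  have hinj : Set.InjOn (transition x₀ x₁) A := fun y hy z hz h => by
    rw [← transition_transition (hAo hy), h, transition_transition (hAo hz)]
  have h := lintegral_image_eq_lintegral_abs_det_fderiv_mul volume hAm hd hinj
    fun z => ENNReal.ofReal (volDensity g x₁ z)
  calc ∫⁻ y in A, ENNReal.ofReal (volDensity g x₀ y)
      = ∫⁻ z in transition x₀ x₁ '' A, ENNReal.ofReal (volDensity g x₁ z) := by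
        rw [h]
        refine setLIntegral_congr_fun hAm fun y hy => ?_
        rw [volDensity_transition g (hAo hy), ENNReal.ofReal_mul (abs_nonneg _)]
    _ ≤ _ := by
        refine lintegral_mono_set ?_
        rintro _ ⟨y, hy, rfl⟩
        refine ⟨(mapsTo_transition x₀ x₁ (hAo hy)).1, ?_⟩
        rw [Set.mem_preimage, symm_transition (hAo hy)]
        exact hy.2

/-- The volume measure restricts to the volume of each chart. -/
lemma riemVolume_restrict (g : BilinField n M) (x₁ : M) :
    (riemVolume g).restrict (extChartAt (𝓡∂ n) x₁).source = chartVolume g x₁ := by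
  have hsm : MeasurableSet (extChartAt (𝓡∂ n) x₁).source :=
    (isOpen_extChartAt_source x₁).measurableSet
  refine le_antisymm ?_ ?_
  -- A supremum of measures is bounded by exhibiting an upper bound of the family. Each chart volume
  -- is split along the source of the chart around `x₁`: inside it `chartVolume_le` applies, outside
  -- it the volume itself is a bound.
  · have hle : riemVolume g ≤ chartVolume g x₁ +
        (riemVolume g).restrict ((extChartAt (𝓡∂ n) x₁).source)ᶜ := by
      refine iSup_le fun x₀ => Measure.le_iff.2 fun S hS => ?_
      rw [Measure.add_apply, Measure.restrict_apply hS, ← measure_inter_add_sdiff S hsm]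
      refine add_le_add ((chartVolume_le g x₀ x₁ (hS.inter hsm) Set.inter_subset_right).trans
        (measure_mono Set.inter_subset_left)) ?_
      exact (le_iSup (fun x₀ => chartVolume g x₀) x₀ : chartVolume g x₀ ≤ riemVolume g) _
    refine (Measure.restrict_mono le_rfl hle).trans ?_
    rw [Measure.restrict_add, Measure.restrict_restrict hsm, Set.inter_compl_self,
      Measure.restrict_empty, add_zero]
    exact Measure.restrict_le_self
  · conv_lhs => rw [← Measure.restrict_eq_self_of_ae_mem (s := (extChartAt (𝓡∂ n) x₁).source)
      (mem_ae_iff.2 (chartVolume_compl_source g x₁))]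
    exact Measure.restrict_mono le_rfl (le_iSup (fun x₀ => chartVolume g x₀) x₁)

lemma aemeasurable_riemVolume [CompactSpace M] (g : BilinField n M) {f : M → ℝ}
    (hf : ∀ x₀, AEMeasurable (inChart (n := n) f x₀) (volume.restrict (chartDomain x₀))) :
    AEMeasurable f (riemVolume g) := by
  obtain ⟨t, ht⟩ := exists_finset_iUnion_source (n := n) (M := M)
  rw [← Measure.restrict_univ (μ := riemVolume g), ← ht,
    aemeasurable_iUnion_iff]
  intro x₀
  rw [riemVolume_restrict]
  exact aemeasurable_chartVolume g _ (hf _)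

/-- `g` is an inner product only at interior points, so every pointwise identity about norms of
differentials is used almost everywhere through this fact. -/
lemma ae_mem_interior [CompactSpace M] (g : BilinField n M) :
    ∀ᵐ x ∂riemVolume g, x ∈ (𝓡∂ n).interior M := by
  obtain ⟨t, ht⟩ := exists_finset_iUnion_source (n := n) (M := M)
  rw [← Measure.restrict_univ (μ := riemVolume g), ← ht,
    ae_restrict_iUnion_iff]
  intro x₀
  rw [riemVolume_restrict, chartVolume_eq]
  refine (ae_map_iff (aemeasurable_symm g _)
    ((𝓡∂ n).isOpen_interior (M := M) (n := ∞) (by simp)).measurableSet).2 ?_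
  refine (coordVolume_absolutelyContinuous g _).ae_le ?_
  filter_upwards [ae_restrict_mem (isOpen_chartDomain _).measurableSet] with y hy
  exact symm_mem_interior hy

variable {ρ : M → ℝ} {gb g : BilinField n M}

lemma IsAHPair.aemeasurable_inChart (h : IsAHPair ρ gb g) (x₀ : M) {f : M → ℝ}
    (hf : AEMeasurable f (riemVolume g)) :
    AEMeasurable (inChart (n := n) f x₀) (volume.restrict (chartDomain x₀)) := by
  have h1 := hf.mono_measure (Measure.restrict_le_self (s := (extChartAt (𝓡∂ n) x₀).source))
  rw [riemVolume_restrict, chartVolume_eq] at h1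
  exact (h1.comp_aemeasurable (aemeasurable_symm g x₀)).mono_ac
    (h.absolutelyContinuous_coordVolume x₀)

lemma IsAHPair.integrableOn_source_iff (h : IsAHPair ρ gb g) (x₀ : M) {f : M → ℝ}
    (hf : AEMeasurable f (riemVolume g)) :
    IntegrableOn f (extChartAt (𝓡∂ n) x₀).source (riemVolume g) ↔
      IntegrableOn (fun y => volDensity g x₀ y * inChart (n := n) f x₀ y) (chartDomain x₀) := by
  have h1 := hf.mono_measure (Measure.restrict_le_self (s := (extChartAt (𝓡∂ n) x₀).source))
  rw [IntegrableOn, riemVolume_restrict, chartVolume_eq] at *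
  rw [integrable_map_measure h1.aestronglyMeasurable (aemeasurable_symm g x₀),
    coordVolume_eq, integrable_withDensity_iff_integrable_smul₀]
  · refine integrable_congr ?_
    filter_upwards [ae_restrict_mem (isOpen_chartDomain x₀).measurableSet] with y hy
    rw [NNReal.smul_def, Real.coe_toNNReal _ (h.volDensity_pos hy).le]
    rfl
  · exact ((h.continuousOn_volDensity x₀).aemeasurable
      (isOpen_chartDomain x₀).measurableSet).real_toNNReal

lemma IsAHPair.setIntegral_source (h : IsAHPair ρ gb g) (x₀ : M) {f : M → ℝ}
    (hf : AEMeasurable f (riemVolume g)) :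
    ∫ x in (extChartAt (𝓡∂ n) x₀).source, f x ∂riemVolume g =
      ∫ y in chartDomain x₀, volDensity g x₀ y * inChart (n := n) f x₀ y := by
  have h1 := hf.mono_measure (Measure.restrict_le_self (s := (extChartAt (𝓡∂ n) x₀).source))
  rw [riemVolume_restrict, chartVolume_eq] at *
  rw [integral_map (aemeasurable_symm g x₀) h1.aestronglyMeasurable,
    coordVolume_eq, integral_withDensity_eq_integral_smul₀]
  · refine integral_congr_ae ?_
    filter_upwards [ae_restrict_mem (isOpen_chartDomain x₀).measurableSet] with y hy
    rw [NNReal.smul_def, Real.coe_toNNReal _ (h.volDensity_pos hy).le]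
    rfl
  · exact ((h.continuousOn_volDensity x₀).aemeasurable
      (isOpen_chartDomain x₀).measurableSet).real_toNNReal

end Volume

/-! ### The Sobolev space -/

section LocalAdd

variable {n : ℕ} {Ω : Set (Euc n)} {u v : Euc n → ℝ} {du dv : Fin n → Euc n → ℝ}

lemma HasLocalWeakGrad.add (hu : HasLocalWeakGrad Ω u du) (hv : HasLocalWeakGrad Ω v dv) :
    HasLocalWeakGrad Ω (fun y => u y + v y) (fun i y => du i y + dv i y) where
  memLp K hK hKc := ⟨(hu.memLp K hK hKc).1.add (hv.memLp K hK hKc).1,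
    fun i => ((hu.memLp K hK hKc).2 i).add ((hv.memLp K hK hKc).2 i)⟩
  weak η hη hc hs i := by
    have hd := continuous_partialDeriv (i := i) (hη.of_le (by norm_cast) : ContDiff ℝ 1 η)
    have hds := (tsupport_partialDeriv_subset (i := i) (f := η))
    have hdc : HasCompactSupport (partialDeriv i η) := hc.of_isClosed_subset (isClosed_tsupport _) hds
    have h1 := fun {w dw} (hw : HasLocalWeakGrad Ω w dw) =>
      (hw.integrable_mul hd hdc (hds.trans hs)).1
    have h2 := fun {w dw} (hw : HasLocalWeakGrad Ω w dw) =>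
      (hw.integrable_mul hη.continuous hc hs).2 i
    simp only [mul_comm (partialDeriv i η _)] at h1
    simp only [mul_comm (η _)] at h2
    simp only [add_mul]
    rw [integral_add (h1 hu) (h1 hv), integral_add (h2 hu) (h2 hv), hu.weak η hη hc hs,
      hv.weak η hη hc hs, neg_add]

lemma HasLocalWeakGrad.const_mul (hu : HasLocalWeakGrad Ω u du) (c : ℝ) :
    HasLocalWeakGrad Ω (fun y => c * u y) (fun i y => c * du i y) where
  memLp K hK hKc := ⟨(hu.memLp K hK hKc).1.const_mul c,
    fun i => ((hu.memLp K hK hKc).2 i).const_mul c⟩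
  weak η hη hc hs i := by
    simp only [mul_assoc, integral_const_mul, hu.weak η hη hc hs, mul_neg]

lemma HasLocalWeakGrad.aemeasurable (hΩ : IsOpen Ω) (hu : HasLocalWeakGrad Ω u du) :
    AEMeasurable u (volume.restrict Ω) ∧ ∀ i, AEMeasurable (du i) (volume.restrict Ω) := by
  have h : ∀ f : Euc n → ℝ, (∀ K ⊆ Ω, IsCompact K → MemLp f 2 (volume.restrict K)) →
      AEMeasurable f (volume.restrict Ω) := fun f hf => by
    refine (LocallyIntegrableOn.aestronglyMeasurable ?_).aemeasurable
    rw [locallyIntegrableOn_iff hΩ.isLocallyClosed]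
    intro K hK hKc
    have : IsFiniteMeasure (volume.restrict K) := ⟨by
      rw [Measure.restrict_apply_univ]; exact hKc.measure_lt_top⟩
    exact (hf K hK hKc).integrable (by norm_num)
  exact ⟨h u fun K hK hKc => (hu.memLp K hK hKc).1, fun i => h _ fun K hK hKc =>
    (hu.memLp K hK hKc).2 i⟩

end LocalAdd

/-! ### The inner product of covectors -/

section DualInner

variable {n : ℕ}

/-- The inner product of two linear forms with respect to an inner product on vectors. -/
def dualInner (B : Euc n →L[ℝ] Euc n →L[ℝ] ℝ) (a b : Euc n →L[ℝ] ℝ) : ℝ :=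
  ∑ i, ∑ j, (Matrix.of fun i j => B (stdVec i) (stdVec j))⁻¹ i j * a (stdVec i) * b (stdVec j)

variable {B : Euc n →L[ℝ] Euc n →L[ℝ] ℝ}

lemma bilinOf_self (B : Euc n →L[ℝ] Euc n →L[ℝ] ℝ) (u v : Euc n) :
    bilinOf (Matrix.of fun i j => B (stdVec i) (stdVec j)) u v = B u v := by
  induction u using euc_induction with
  | h0 => simp
  | hadd a b ha hb => simp only [map_add, _root_.add_apply, ha, hb]
  | hsmul c a ha => simp only [map_smul, _root_.smul_apply, ha]
  | he i =>
    induction v using euc_induction with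
    | h0 => simp
    | hadd a b ha hb => simp only [map_add, ha, hb]
    | hsmul c a ha => simp only [map_smul, ha]
    | he j => rw [bilinOf_stdVec, Matrix.of_apply]

lemma dualNorm_sq_eq_dualInner (hB : IsInnerForm B) (a : Euc n →L[ℝ] ℝ) :
    dualNorm B a ^ 2 = dualInner B a a :=
  dualNorm_sq hB a (L := ContinuousLinearMap.id ℝ (Euc n)) Function.bijective_id (bilinOf_self B)

lemma dualInner_add_right (a b c : Euc n →L[ℝ] ℝ) :
    dualInner B a (b + c) = dualInner B a b + dualInner B a c := by
  simp only [dualInner, _root_.add_apply, mul_add, Finset.sum_add_distrib]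

lemma dualInner_smul_right (r : ℝ) (a b : Euc n →L[ℝ] ℝ) :
    dualInner B a (r • b) = r * dualInner B a b := by
  simp only [dualInner, _root_.smul_apply, smul_eq_mul, Finset.mul_sum]
  exact Finset.sum_congr rfl fun i _ => Finset.sum_congr rfl fun j _ => by ring

lemma dualInner_symm (hB : IsInnerForm B) (a b : Euc n →L[ℝ] ℝ) :
    dualInner B a b = dualInner B b a := by
  have hs : (Matrix.of fun i j => B (stdVec i) (stdVec j)).IsSymm :=
    Matrix.IsSymm.ext fun i j => hB.symm _ _
  rw [dualInner, dualInner, Finset.sum_comm]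
  refine Finset.sum_congr rfl fun i _ => Finset.sum_congr rfl fun j _ => ?_
  rw [hs.inv.apply]
  ring

lemma dualNorm_add_sq (hB : IsInnerForm B) (a b : Euc n →L[ℝ] ℝ) :
    dualNorm B (a + b) ^ 2 = dualNorm B a ^ 2 + 2 * dualInner B a b + dualNorm B b ^ 2 := by
  simp only [dualNorm_sq_eq_dualInner hB]
  rw [dualInner_add_right, dualInner_symm hB (a + b) a, dualInner_symm hB (a + b) b,
    dualInner_add_right, dualInner_add_right, dualInner_symm hB b a]
  ring

lemma dualNorm_smul_sq (hB : IsInnerForm B) (r : ℝ) (a : Euc n →L[ℝ] ℝ) :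
    dualNorm B (r • a) ^ 2 = r ^ 2 * dualNorm B a ^ 2 := by
  simp only [dualNorm_sq_eq_dualInner hB]
  rw [dualInner_smul_right, dualInner_symm hB, dualInner_smul_right]
  ring

/-- The quadratic polynomial `t ↦ |a + t b|²` is nonnegative, so its discriminant is not positive.
-/
lemma abs_dualInner_le (hB : IsInnerForm B) (a b : Euc n →L[ℝ] ℝ) :
    |dualInner B a b| ≤ dualNorm B a * dualNorm B b := by
  have key : dualInner B a b ^ 2 ≤ (dualNorm B a * dualNorm B b) ^ 2 := by
    have h : ∀ t : ℝ, 0 ≤ dualNorm B b ^ 2 * (t * t) + 2 * dualInner B a b * t +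
        dualNorm B a ^ 2 := fun t => by
      have := sq_nonneg (dualNorm B (a + t • b))
      rw [dualNorm_add_sq hB, dualNorm_smul_sq hB, dualInner_smul_right] at this
      linarith
    have := discrim_le_zero h
    rw [discrim] at this
    nlinarith
  exact abs_le_of_sq_le_sq key (mul_nonneg (dualNorm_nonneg _ _) (dualNorm_nonneg _ _))

lemma dualNorm_add_sq_le (hB : IsInnerForm B) (a b : Euc n →L[ℝ] ℝ) :
    dualNorm B (a + b) ^ 2 ≤ 2 * dualNorm B a ^ 2 + 2 * dualNorm B b ^ 2 := by
  rw [dualNorm_add_sq hB]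
  nlinarith [(abs_le.1 (abs_dualInner_le hB a b)).2, sq_nonneg (dualNorm B a - dualNorm B b)]

end DualInner

section Sobolev

variable {n : ℕ} [NeZero n] {M : Type*} [TopologicalSpace M]
  [ChartedSpace (EuclideanHalfSpace n) M]

lemma isLocallySobolev_iff {U : FunctionWithDiff n M} : IsLocallySobolev U ↔
    ∀ x₀, HasLocalWeakGrad (chartDomain x₀) (inChart (n := n) U.1 x₀) (covectorInChart U.2 x₀) :=
  ⟨fun h x₀ => ⟨(h x₀).1, (h x₀).2⟩, fun h x₀ => ⟨(h x₀).memLp, (h x₀).weak⟩⟩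

lemma IsLocallySobolev.add {U V : FunctionWithDiff n M} (hU : IsLocallySobolev U)
    (hV : IsLocallySobolev V) : IsLocallySobolev (U + V) := by
  rw [isLocallySobolev_iff] at *
  exact fun x₀ => (hU x₀).add (hV x₀)

lemma IsLocallySobolev.smul {U : FunctionWithDiff n M} (hU : IsLocallySobolev U) (c : ℝ) :
    IsLocallySobolev (c • U) := by
  rw [isLocallySobolev_iff] at *
  exact fun x₀ => (hU x₀).const_mul c

section Norm

variable [MeasurableSpace M] {g : BilinField n M}

lemma sobolevNorm_nonneg (g : BilinField n M) (U : FunctionWithDiff n M) : 0 ≤ sobolevNorm g U :=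
  add_nonneg ENNReal.toReal_nonneg ENNReal.toReal_nonneg

lemma integral_sq_le_sobolevNorm {U : FunctionWithDiff n M} (hU : U ∈ sobolevSpace g) :
    ∫ x, U.1 x ^ 2 ∂riemVolume g ≤ sobolevNorm g U ^ 2 := by
  rw [← toReal_eLpNorm_sq hU.2.1]
  exact pow_le_pow_left₀ ENNReal.toReal_nonneg (le_add_of_nonneg_right ENNReal.toReal_nonneg) 2

lemma integral_diffNorm_sq_le_sobolevNorm {U : FunctionWithDiff n M} (hU : U ∈ sobolevSpace g) :
    ∫ x, diffNorm g U.2 x ^ 2 ∂riemVolume g ≤ sobolevNorm g U ^ 2 := by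
  rw [← toReal_eLpNorm_sq hU.2.2]
  exact pow_le_pow_left₀ ENNReal.toReal_nonneg (le_add_of_nonneg_left ENNReal.toReal_nonneg) 2

end Norm

variable [MeasurableSpace M] [BorelSpace M] [IsManifold (𝓡∂ n) ∞ M]
  {ρ : M → ℝ} {gb g : BilinField n M}

/-- The volume density is continuous and positive, hence bounded below on the compact set `L`. -/
lemma IsAHPair.exists_setIntegral_inChart_le (h : IsAHPair ρ gb g) (x₀ : M) {L : Set (Euc n)}
    (hL : IsCompact L) (hs : L ⊆ chartDomain x₀) :
    ∃ C : ℝ, 0 ≤ C ∧ ∀ f : M → ℝ, (∀ x, 0 ≤ f x) → Integrable f (riemVolume g) →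
      IntegrableOn (inChart (n := n) f x₀) L ∧
      ∫ y in L, inChart (n := n) f x₀ y ≤ C * ∫ x, f x ∂riemVolume g := by
  have hJ : ContinuousOn (fun y => (volDensity g x₀ y)⁻¹) L :=
    ((h.continuousOn_volDensity x₀).mono hs).inv₀ fun y hy => (h.volDensity_pos (hs hy)).ne'
  obtain ⟨C, hC⟩ := hL.exists_bound_of_continuousOn hJ
  refine ⟨max C 0, le_max_right _ _, fun f hf hi => ?_⟩
  have h1 := (h.integrableOn_source_iff x₀ hi.1.aemeasurable).1 hi.integrableOn
  have h2 := h1.mono_set hs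
  have hpt : ∀ y ∈ L, inChart (n := n) f x₀ y ≤
      max C 0 * (volDensity g x₀ y * inChart (n := n) f x₀ y) := fun y hy => by
    have hp := h.volDensity_pos (hs hy)
    have hb : (volDensity g x₀ y)⁻¹ ≤ max C 0 :=
      ((le_abs_self _).trans (hC y hy)).trans (le_max_left _ _)
    rw [← mul_assoc]
    refine le_mul_of_one_le_left (hf _) ?_
    rwa [inv_le_iff_one_le_mul₀ hp] at hb
  have h3 : IntegrableOn (inChart (n := n) f x₀) L := by
    refine (h2.const_mul (max C 0)).mono' ?_ ?_
    · exact ((h.aemeasurable_inChart x₀ hi.1.aemeasurable).mono_measure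
        (Measure.restrict_mono hs le_rfl)).aestronglyMeasurable
    · filter_upwards [ae_restrict_mem hL.measurableSet] with y hy
      rw [Real.norm_of_nonneg (show 0 ≤ inChart (n := n) f x₀ y from hf _)]
      exact hpt y hy
  refine ⟨h3, ?_⟩
  calc ∫ y in L, inChart (n := n) f x₀ y
      ≤ ∫ y in L, max C 0 * (volDensity g x₀ y * inChart (n := n) f x₀ y) :=
        setIntegral_mono_on h3 (h2.const_mul _) hL.measurableSet hpt
    _ = max C 0 * ∫ y in L, volDensity g x₀ y * inChart (n := n) f x₀ y := integral_const_mul _ _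
    _ ≤ max C 0 * ∫ y in chartDomain x₀, volDensity g x₀ y * inChart (n := n) f x₀ y := by
        refine mul_le_mul_of_nonneg_left (setIntegral_mono_set h1 ?_ hs.eventuallyLE)
          (le_max_right _ _)
        filter_upwards [ae_restrict_mem (isOpen_chartDomain x₀).measurableSet] with y hy
        exact mul_nonneg (h.volDensity_pos hy).le (hf _)
    _ ≤ max C 0 * ∫ x, f x ∂riemVolume g := by
        rw [← h.setIntegral_source x₀ hi.1.aemeasurable]
        exact mul_le_mul_of_nonneg_left
          (setIntegral_le_integral hi (Eventually.of_forall hf)) (le_max_right _ _)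

variable [CompactSpace M]

namespace IsAHPair

lemma aemeasurable_of_isLocallySobolev (g : BilinField n M) {U : FunctionWithDiff n M}
    (hU : IsLocallySobolev U) : AEMeasurable U.1 (riemVolume g) :=
  aemeasurable_riemVolume g fun x₀ =>
    ((isLocallySobolev_iff.1 hU x₀).aemeasurable (isOpen_chartDomain x₀)).1

lemma aemeasurable_diffNorm (h : IsAHPair ρ gb g) {U : FunctionWithDiff n M}
    (hU : IsLocallySobolev U) : AEMeasurable (diffNorm g U.2) (riemVolume g) := by
  refine aemeasurable_riemVolume g fun x₀ => ?_
  have hd := ((isLocallySobolev_iff.1 hU x₀).aemeasurable (isOpen_chartDomain x₀)).2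
  have hm := h.isMetricOn_chartDomain x₀
  have h1 : AEMeasurable (fun y => √(∑ i, ∑ j, (coeffMatrix g x₀ y)⁻¹ i j *
      covectorInChart U.2 x₀ i y * covectorInChart U.2 x₀ j y))
      (volume.restrict (chartDomain x₀)) := by
    refine (Finset.aemeasurable_fun_sum _ fun i _ =>
      Finset.aemeasurable_fun_sum _ fun j _ => ?_).sqrt
    exact (((contDiffOn_inv hm.contDiffOn hm.det_ne_zero i j).continuousOn.aemeasurable
      (isOpen_chartDomain x₀).measurableSet).mul (hd i)).mul (hd j)
  refine h1.congr ?_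
  filter_upwards [ae_restrict_mem (isOpen_chartDomain x₀).measurableSet] with y hy
  rw [← h.diffNorm_sq U.2 hy, Real.sqrt_sq (by rw [diffNorm_eq]; exact dualNorm_nonneg _ _)]
  rfl

lemma mem_sobolevSpace_iff (h : IsAHPair ρ gb g) {U : FunctionWithDiff n M} :
    U ∈ sobolevSpace g ↔ IsLocallySobolev U ∧ Integrable (fun x => U.1 x ^ 2) (riemVolume g) ∧
      Integrable (fun x => diffNorm g U.2 x ^ 2) (riemVolume g) := by
  refine and_congr_right fun hU => ?_
  rw [memLp_two_iff_integrable_sq (aemeasurable_of_isLocallySobolev g hU).aestronglyMeasurable,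
    memLp_two_iff_integrable_sq (h.aemeasurable_diffNorm hU).aestronglyMeasurable]

lemma add_mem (h : IsAHPair ρ gb g) {U V : FunctionWithDiff n M} (hU : U ∈ sobolevSpace g)
    (hV : V ∈ sobolevSpace g) : U + V ∈ sobolevSpace g := by
  refine ⟨hU.1.add hV.1, hU.2.1.add hV.2.1, ?_⟩
  have hl := h.aemeasurable_diffNorm (hU.1.add hV.1)
  have hU' := (h.mem_sobolevSpace_iff.1 hU).2.2
  have hV' := (h.mem_sobolevSpace_iff.1 hV).2.2
  rw [memLp_two_iff_integrable_sq hl.aestronglyMeasurable]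
  refine ((hU'.const_mul 2).add (hV'.const_mul 2)).mono' (hl.pow_const 2).aestronglyMeasurable ?_
  filter_upwards [ae_mem_interior g] with x hx
  rw [Real.norm_of_nonneg (sq_nonneg _)]
  exact dualNorm_add_sq_le (h.isInnerForm hx) (covectorAt U.2 x) (covectorAt V.2 x)

lemma smul_mem (h : IsAHPair ρ gb g) {U : FunctionWithDiff n M} (hU : U ∈ sobolevSpace g) (c : ℝ) :
    c • U ∈ sobolevSpace g := by
  refine ⟨hU.1.smul c, hU.2.1.const_mul c, ?_⟩
  have hl := h.aemeasurable_diffNorm (hU.1.smul c)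
  have hU' := (h.mem_sobolevSpace_iff.1 hU).2.2
  rw [memLp_two_iff_integrable_sq hl.aestronglyMeasurable]
  refine (hU'.const_mul (c ^ 2)).congr ?_
  filter_upwards [ae_mem_interior g] with x hx
  exact (dualNorm_smul_sq (h.isInnerForm hx) c (covectorAt U.2 x)).symm

lemma sub_mem (h : IsAHPair ρ gb g) {U V : FunctionWithDiff n M} (hU : U ∈ sobolevSpace g)
    (hV : V ∈ sobolevSpace g) : U - V ∈ sobolevSpace g := by
  have := h.add_mem hU (h.smul_mem hV (-1))
  rwa [neg_one_smul, ← sub_eq_add_neg] at this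

end IsAHPair

namespace IsAHPair

/-- Away from the boundary, the Sobolev norm controls the Euclidean `L²` norms of `u` and of its
partial derivatives: `du(∂ᵢ)² ≤ |du|² g(∂ᵢ, ∂ᵢ)`, and the last factor is bounded on `L`. -/
lemma exists_setIntegral_sq_le (h : IsAHPair ρ gb g) (x₀ : M) {L : Set (Euc n)}
    (hL : IsCompact L) (hs : L ⊆ chartDomain x₀) :
    ∃ C : ℝ, 0 ≤ C ∧ ∀ U ∈ sobolevSpace g,
      ∫ y in L, inChart (n := n) U.1 x₀ y ^ 2 ≤ C * sobolevNorm g U ^ 2 ∧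
      ∀ i, ∫ y in L, covectorInChart U.2 x₀ i y ^ 2 ≤ C * sobolevNorm g U ^ 2 := by
  obtain ⟨C, hC0, hC⟩ := h.exists_setIntegral_inChart_le x₀ hL hs
  have hG : ∀ i : Fin n, ∃ D : ℝ, ∀ y ∈ L, ‖coeffMatrix g x₀ y i i‖ ≤ D := fun i =>
    hL.exists_bound_of_continuousOn (((h.isMetricOn_chartDomain x₀).contDiffOn i i).continuousOn.mono hs)
  choose D hD using hG
  -- Bounds every `D i` and is at least `1`, so that the single constant `C * E` also serves for
  -- `u`.
  set E : ℝ := 1 + ∑ i, |D i| with hE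
  have hE1 : 1 ≤ E := le_add_of_nonneg_right (Finset.sum_nonneg fun i _ => abs_nonneg _)
  have hDE : ∀ i, D i ≤ E := fun i => (le_abs_self _).trans
    ((Finset.single_le_sum (f := fun i => |D i|) (fun i _ => abs_nonneg _)
      (Finset.mem_univ i)).trans (le_add_of_nonneg_left zero_le_one))
  have hCE : 0 ≤ C * E := mul_nonneg hC0 (zero_le_one.trans hE1)
  refine ⟨C * E, hCE, fun U hU => ⟨?_, fun i => ?_⟩⟩
  · have h1 := hC (fun x => U.1 x ^ 2) (fun x => sq_nonneg _) (h.mem_sobolevSpace_iff.1 hU).2.1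
    refine h1.2.trans ((mul_le_mul_of_nonneg_left (integral_sq_le_sobolevNorm hU) hC0).trans ?_)
    exact mul_le_mul_of_nonneg_right (le_mul_of_one_le_right hC0 hE1) (sq_nonneg _)
  · have h1 := hC (fun x => diffNorm g U.2 x ^ 2) (fun x => sq_nonneg _)
      (h.mem_sobolevSpace_iff.1 hU).2.2
    have hl := ((isLocallySobolev_iff.1 hU.1 x₀).memLp L hs hL).2 i
    calc ∫ y in L, covectorInChart U.2 x₀ i y ^ 2
        ≤ ∫ y in L, E * inChart (n := n) (fun x => diffNorm g U.2 x ^ 2) x₀ y := by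
          refine setIntegral_mono_on hl.integrable_sq (h1.1.const_mul E) hL.measurableSet
            fun y hy => ?_
          have h2 := sq_apply_le_dualNorm (h.isInnerForm (symm_mem_interior (hs hy)))
            (covectorAt U.2 ((extChartAt (𝓡∂ n) x₀).symm y)) (chartDeriv x₀ y (stdVec i))
          rw [covectorInChart_eq]
          refine h2.trans ?_
          rw [mul_comm]
          refine mul_le_mul_of_nonneg_right ?_ (sq_nonneg _)
          rw [← coeffMatrix_apply]
          exact (le_abs_self _).trans ((hD i y hy).trans (hDE i))
      _ = E * ∫ y in L, inChart (n := n) (fun x => diffNorm g U.2 x ^ 2) x₀ y :=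
          integral_const_mul _ _
      _ ≤ E * (C * sobolevNorm g U ^ 2) := mul_le_mul_of_nonneg_left (h1.2.trans
          (mul_le_mul_of_nonneg_left (integral_diffNorm_sq_le_sobolevNorm hU) hC0))
          (zero_le_one.trans hE1)
      _ = C * E * sobolevNorm g U ^ 2 := by ring

end IsAHPair

end Sobolev

/-! ### The divergence theorem near the boundary at infinity -/

lemma exists_bound_deriv_smoothTransition :
    ∃ C : ℝ, 0 ≤ C ∧ ∀ t, |deriv Real.smoothTransition t| ≤ C ∧
      (t < 0 ∨ 1 < t → deriv Real.smoothTransition t = 0) := by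
  have hc : Continuous (deriv Real.smoothTransition) :=
    (Real.smoothTransition.contDiff (n := 1)).continuous_deriv (by norm_num)
  have h0 : ∀ t : ℝ, t < 0 ∨ 1 < t → deriv Real.smoothTransition t = 0 := by
    rintro t (ht | ht)
    · have : Real.smoothTransition =ᶠ[𝓝 t] fun _ => 0 := by
        filter_upwards [Iio_mem_nhds ht] with s hs
        exact Real.smoothTransition.zero_of_nonpos (le_of_lt hs)
      rw [this.deriv_eq, deriv_const]
    · have : Real.smoothTransition =ᶠ[𝓝 t] fun _ => 1 := by
        filter_upwards [Ioi_mem_nhds ht] with s hs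
        exact Real.smoothTransition.one_of_one_le (le_of_lt hs)
      rw [this.deriv_eq, deriv_const]
  obtain ⟨C, hC⟩ := isCompact_Icc.exists_bound_of_continuousOn (s := Set.Icc (0 : ℝ) 1)
    hc.continuousOn
  have hC0 : 0 ≤ C := (norm_nonneg _).trans (hC 0 (by simp))
  refine ⟨C, hC0, fun t => ⟨?_, h0 t⟩⟩
  by_cases ht : t < 0 ∨ 1 < t
  · rw [h0 t ht, abs_zero]; exact hC0
  · push Not at ht
    exact hC t ht

section Divergence

variable {n : ℕ} {T Ω K : Set (Euc n)} {r : Euc n → ℝ}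

/-- The cutoff function `σ(m r - 1)`, which vanishes for `m r ≤ 1` and is `1` for `m r ≥ 2`. -/
def boundaryCutoff (r : Euc n → ℝ) (m : ℕ) (y : Euc n) : ℝ :=
  Real.smoothTransition (m * r y - 1)

lemma fderiv_boundaryCutoff {y : Euc n} (hr : DifferentiableAt ℝ r y) (m : ℕ) (v : Euc n) :
    fderiv ℝ (boundaryCutoff r m) y v =
      deriv Real.smoothTransition (m * r y - 1) * (m * fderiv ℝ r y v) := by
  have h1 : HasFDerivAt (fun y => (m : ℝ) * r y - 1) ((m : ℝ) • fderiv ℝ r y) y :=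
    (hr.hasFDerivAt.const_mul (m : ℝ)).sub_const 1
  have h2 : HasDerivAt Real.smoothTransition (deriv Real.smoothTransition (m * r y - 1))
      (m * r y - 1) :=
    ((Real.smoothTransition.contDiff (n := 1)).differentiable (by norm_num) _).hasDerivAt
  have h3 := h2.comp_hasFDerivAt y h1
  have h4 : fderiv ℝ (boundaryCutoff r m) y = _ := h3.fderiv
  rw [h4]
  simp

/-- A `C¹` function on `Ω`, multiplied by a cutoff near the zeros of `r` and extended by zero. -/
def cutoffExt (Ω : Set (Euc n)) (r : Euc n → ℝ) (m : ℕ) (F : Euc n → ℝ) : Euc n → ℝ :=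
  Ω.indicator fun y => F y * boundaryCutoff r m y

/-- The support lies in the part of `K` where `m r ≥ 1`. This set is compact, and it avoids the
complement of `Ω`, where `r` vanishes. -/
lemma cutoffExt_spec (hK : IsCompact K) (hKT : K ⊆ T) (hΩ : IsOpen Ω)
    (hrc : ContinuousOn r T) (hr : ContDiffOn ℝ 1 r Ω) (h0 : ∀ y ∈ T, y ∉ Ω → r y = 0)
    {F : Euc n → ℝ} (hF : ContDiffOn ℝ 1 F Ω) (hFK : ∀ y ∈ Ω, y ∉ K → F y = 0) (m : ℕ) :
    ContDiff ℝ 1 (cutoffExt Ω r m F) ∧ HasCompactSupport (cutoffExt Ω r m F) ∧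
      tsupport (cutoffExt Ω r m F) ⊆ Ω := by
  set L : Set (Euc n) := K ∩ {y | 1 ≤ m * r y} with hL
  have hLc : IsCompact L := by
    have : IsClosed (K ∩ (fun y => (m : ℝ) * r y) ⁻¹' Set.Ici 1) :=
      (continuousOn_const.mul (hrc.mono hKT)).preimage_isClosed_of_isClosed hK.isClosed isClosed_Ici
    exact hK.of_isClosed_subset this Set.inter_subset_left
  have hLΩ : L ⊆ Ω := fun y hy => by
    by_contra h
    have h1 : 1 ≤ m * r y := hy.2
    rw [h0 y (hKT hy.1) h, mul_zero] at h1
    linarith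
  have hz : ∀ y, y ∉ L → cutoffExt Ω r m F y = 0 := fun y hy => by
    by_cases hyΩ : y ∈ Ω
    · rw [cutoffExt, Set.indicator_of_mem hyΩ]
      by_cases hyK : y ∈ K
      · have : ¬ 1 ≤ m * r y := fun h => hy ⟨hyK, h⟩
        rw [boundaryCutoff, Real.smoothTransition.zero_of_nonpos (by linarith), mul_zero]
      · rw [hFK y hyΩ hyK, zero_mul]
    · rw [cutoffExt, Set.indicator_of_notMem hyΩ]
  have hts : tsupport (cutoffExt Ω r m F) ⊆ L := closure_minimal (fun y hy => by
    by_contra h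
    exact hy (hz y h)) hLc.isClosed
  refine ⟨contDiff_iff_contDiffAt.2 fun y => ?_, hLc.of_isClosed_subset (isClosed_tsupport _) hts,
    hts.trans hLΩ⟩
  by_cases hy : y ∈ L
  · have hyΩ := hLΩ hy
    have h1 : ContDiffOn ℝ 1 (fun y => F y * boundaryCutoff r m y) Ω :=
      hF.mul (Real.smoothTransition.contDiff.comp_contDiffOn
        ((contDiffOn_const.mul hr).sub contDiffOn_const))
    refine (h1.contDiffAt (hΩ.mem_nhds hyΩ)).congr_of_eventuallyEq ?_
    filter_upwards [hΩ.mem_nhds hyΩ] with z hz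
    rw [cutoffExt, Set.indicator_of_mem hz]
  · refine (contDiffAt_const (c := (0 : ℝ))).congr_of_eventuallyEq ?_
    filter_upwards [hLc.isClosed.isOpen_compl.mem_nhds hy] with z hz'
    exact hz z hz'

/-- The divergence theorem `∫ ∂ᵢ(u² Fⁱ) = 0` for a vector field `F` which does not necessarily
vanish near the zeros of `r`, provided that the integrands are integrable. -/
lemma HasLocalWeakGrad.integral_div_eq_zero {u : Euc n → ℝ} {du : Fin n → Euc n → ℝ}
    (hK : IsCompact K) (hKT : K ⊆ T) (hΩ : IsOpen Ω)
    (hu : HasLocalWeakGrad Ω u du)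
    (hrc : ContinuousOn r T) (hr : ContDiffOn ℝ 1 r Ω) (h0 : ∀ y ∈ T, y ∉ Ω → r y = 0)
    (hpos : ∀ y ∈ Ω, 0 < r y) {F : Fin n → Euc n → ℝ} (hF : ∀ i, ContDiffOn ℝ 1 (F i) Ω)
    (hFK : ∀ i, ∀ y ∈ Ω, y ∉ K → F i y = 0)
    (hH : IntegrableOn (fun y => ∑ i, (2 * u y * du i y * F i y + u y ^ 2 * partialDeriv i (F i) y))
      Ω)
    (hE : IntegrableOn (fun y => u y ^ 2 * ((∑ i, F i y * partialDeriv i r y) / r y)) Ω) :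
    ∫ y in Ω, ∑ i, (2 * u y * du i y * F i y + u y ^ 2 * partialDeriv i (F i) y) = 0 := by
  set H : Euc n → ℝ := fun y =>
    ∑ i, (2 * u y * du i y * F i y + u y ^ 2 * partialDeriv i (F i) y) with hHdef
  set E : Euc n → ℝ := fun y => u y ^ 2 * ((∑ i, F i y * partialDeriv i r y) / r y) with hEdef
  obtain ⟨C, hC0, hC⟩ := exists_bound_deriv_smoothTransition
  -- The integrand for the cut-off field. The term with the derivative of the cutoff is grouped as
  -- `E` times `r m σ'(m r - 1)`, and this factor is bounded independently of `m`.
  set Z : ℕ → Euc n → ℝ := fun m y => H y * boundaryCutoff r m y +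
    E y * (r y * (deriv Real.smoothTransition (m * r y - 1) * m)) with hZ
  have hzero : ∀ m, ∫ y in Ω, Z m y = 0 := by
    intro m
    have hs := fun i => cutoffExt_spec hK hKT hΩ hrc hr h0 (hF i) (hFK i) m
    have hi := fun i : Fin n => hu.integral_sq_mul_partialDeriv hΩ (hs i).1 (hs i).2.1 (hs i).2.2 i
    have h1 : ∫ y, ∑ i, (2 * u y * du i y * cutoffExt Ω r m (F i) y +
        u y ^ 2 * partialDeriv i (cutoffExt Ω r m (F i)) y) = 0 := by
      rw [integral_finsetSum _ fun i _ => (hi i).1]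
      exact Finset.sum_eq_zero fun i _ => (hi i).2
    refine Eq.trans ?_ ((setIntegral_eq_integral_of_forall_compl_eq_zero (s := Ω) ?_).trans h1)
    · refine setIntegral_congr_fun hΩ.measurableSet fun y hy => ?_
      have hry := hpos y hy
      have hdr : DifferentiableAt ℝ r y :=
        (hr.contDiffAt (hΩ.mem_nhds hy)).differentiableAt (by simp)
      have hdc : DifferentiableAt ℝ (boundaryCutoff r m) y :=
        ((Real.smoothTransition.contDiff (n := 1)).differentiable (by norm_num) _).comp y
          ((hdr.const_mul (m : ℝ)).sub_const 1)
      have hp : ∀ i, partialDeriv i (cutoffExt Ω r m (F i)) y =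
          F i y * (deriv Real.smoothTransition (m * r y - 1) * (m * partialDeriv i r y)) +
            partialDeriv i (F i) y * boundaryCutoff r m y := by
        intro i
        have he : cutoffExt Ω r m (F i) =ᶠ[𝓝 y] fun y => F i y * boundaryCutoff r m y := by
          filter_upwards [hΩ.mem_nhds hy] with z hz
          rw [cutoffExt, Set.indicator_of_mem hz]
        have hdF : DifferentiableAt ℝ (F i) y :=
          ((hF i).contDiffAt (hΩ.mem_nhds hy)).differentiableAt (by simp)
        rw [partialDeriv, he.fderiv_eq]
        have := partialDeriv_mul hdF hdc i
        rw [partialDeriv, partialDeriv, fderiv_boundaryCutoff hdr] at this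
        exact this
      simp only [hZ, hHdef, hEdef, hp]
      have hv : ∀ i, cutoffExt Ω r m (F i) y = F i y * boundaryCutoff r m y := fun i => by
        rw [cutoffExt, Set.indicator_of_mem hy]
      simp only [hv]
      have hsplit : u y ^ 2 * ((∑ i, F i y * partialDeriv i r y) / r y) *
          (r y * (deriv Real.smoothTransition (m * r y - 1) * m)) =
          ∑ i, u y ^ 2 * (F i y * (deriv Real.smoothTransition (m * r y - 1) *
            (m * partialDeriv i r y))) := by
        have : u y ^ 2 * ((∑ i, F i y * partialDeriv i r y) / r y) *
          (r y * (deriv Real.smoothTransition (m * r y - 1) * m)) =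
          u y ^ 2 * (deriv Real.smoothTransition (m * r y - 1) * m) *
            ∑ i, F i y * partialDeriv i r y := by
          field_simp
        rw [this, Finset.mul_sum]
        exact Finset.sum_congr rfl fun i _ => by ring
      rw [hsplit, Finset.sum_mul, ← Finset.sum_add_distrib]
      exact Finset.sum_congr rfl fun i _ => by ring
    · intro y hy
      refine Finset.sum_eq_zero fun i _ => ?_
      have h2 : y ∉ tsupport (cutoffExt Ω r m (F i)) := fun h => hy ((hs i).2.2 h)
      have h3 : y ∉ tsupport (partialDeriv i (cutoffExt Ω r m (F i))) := fun h =>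
        h2 (tsupport_partialDeriv_subset _ i h)
      rw [image_eq_zero_of_notMem_tsupport h2, image_eq_zero_of_notMem_tsupport h3]
      ring
  -- Where `σ'(m r - 1)` is nonzero one has `m r ≤ 2`, so `2 C |E|` dominates the error. Pointwise
  -- the sequence is eventually constant: as soon as `m r > 2` the cutoff is `1` and its derivative
  -- is `0`.
  have hlim : Tendsto (fun m => ∫ y in Ω, Z m y) atTop (𝓝 (∫ y in Ω, H y)) := by
    refine tendsto_integral_of_dominated_convergence (fun y => |H y| + |E y| * (2 * C)) ?_ ?_ ?_ ?_
    · intro m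
      have hrΩ : ContinuousOn r Ω := hr.continuousOn
      have hm : ContinuousOn (fun y => (m : ℝ) * r y - 1) Ω :=
        (continuousOn_const.mul hrΩ).sub continuousOn_const
      refine (hH.aestronglyMeasurable.mul ?_).add (hE.aestronglyMeasurable.mul ?_)
      · exact (Real.smoothTransition.continuous.comp_continuousOn hm).aestronglyMeasurable
          hΩ.measurableSet
      · refine ContinuousOn.aestronglyMeasurable ?_ hΩ.measurableSet
        refine hrΩ.mul (ContinuousOn.mul ?_ continuousOn_const)
        exact ((Real.smoothTransition.contDiff (n := 1)).continuous_deriv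
          (by norm_num)).comp_continuousOn hm
    · exact hH.norm.add (hE.norm.mul_const _)
    · intro m
      filter_upwards [ae_restrict_mem hΩ.measurableSet] with y hy
      have hry := hpos y hy
      refine (norm_add_le _ _).trans (add_le_add ?_ ?_)
      · rw [norm_mul]
        refine mul_le_of_le_one_right (norm_nonneg _) ?_
        rw [boundaryCutoff, Real.norm_of_nonneg (Real.smoothTransition.nonneg _)]
        exact Real.smoothTransition.le_one _
      · rw [norm_mul]
        refine mul_le_mul_of_nonneg_left ?_ (norm_nonneg _)
        rw [Real.norm_eq_abs, abs_mul, abs_mul, Nat.abs_cast, abs_of_pos hry]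
        by_cases ht : (m : ℝ) * r y - 1 < 0 ∨ 1 < (m : ℝ) * r y - 1
        · rw [(hC _).2 ht, abs_zero, zero_mul, mul_zero]
          linarith
        · push Not at ht
          have hb := (hC ((m : ℝ) * r y - 1)).1
          have hm0 : 0 ≤ (m : ℝ) * r y := by positivity
          calc r y * (|deriv Real.smoothTransition (m * r y - 1)| * m)
              = (m * r y) * |deriv Real.smoothTransition (m * r y - 1)| := by ring
            _ ≤ 2 * C := mul_le_mul (by linarith [ht.2]) hb (abs_nonneg _) (by norm_num)
    · filter_upwards [ae_restrict_mem hΩ.measurableSet] with y hy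
      have hry := hpos y hy
      refine tendsto_const_nhds.congr' ?_
      obtain ⟨m₀, hm₀⟩ := exists_nat_gt (2 / r y)
      filter_upwards [eventually_ge_atTop m₀] with m hm
      have h2 : 1 < (m : ℝ) * r y - 1 := by
        have : 2 / r y < m := hm₀.trans_le (by exact_mod_cast hm)
        rw [div_lt_iff₀ hry] at this
        linarith
      simp only [hZ]
      rw [(hC _).2 (Or.inr h2), boundaryCutoff, Real.smoothTransition.one_of_one_le h2.le]
      ring
  simp only [hzero] at hlim
  exact (tendsto_nhds_unique hlim tendsto_const_nhds)

end Divergence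

lemma hasDerivAt_inv_pow (k : ℕ) {x : ℝ} (hx : x ≠ 0) :
    HasDerivAt (fun x : ℝ => (x ^ k)⁻¹) (-k * (x ^ (k + 1))⁻¹) x := by
  have h := hasDerivAt_zpow (-(k : ℤ)) x (Or.inl hx)
  have h1 : (fun x : ℝ => x ^ (-(k : ℤ))) = fun x => (x ^ k)⁻¹ := by
    ext x; rw [zpow_neg, zpow_natCast]
  have h2 : x ^ (-(k : ℤ) - 1) = (x ^ (k + 1))⁻¹ := by
    rw [show -(k : ℤ) - 1 = -((k + 1 : ℕ) : ℤ) by push_cast; ring, zpow_neg, zpow_natCast]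
  rw [h1, h2] at h
  simpa using h

/-- With `A = |du|²`, `t = du(X)` and `Q = |X|²`, this is `|du + u X|² ≥ 0`, deduced from the
Cauchy–Schwarz inequality alone. -/
lemma add_two_mul_add_nonneg {A t Q u : ℝ} (hA : 0 ≤ A) (hQ : 0 ≤ Q) (h : t ^ 2 ≤ A * Q) :
    0 ≤ A + 2 * u * t + u ^ 2 * Q := by
  rcases hQ.eq_or_lt with hQ | hQ
  · rw [← hQ, mul_zero] at h
    have : t = 0 := pow_eq_zero_iff (two_ne_zero) |>.1 (le_antisymm h (sq_nonneg t))
    rw [this, ← hQ]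
    simpa using hA
  · have h1 : 0 ≤ Q * (A + 2 * u * t + u ^ 2 * Q) := by nlinarith [sq_nonneg (t + u * Q)]
    exact (mul_nonneg_iff_of_pos_left hQ).1 h1

lemma exists_bound_of_eq_zero_of_notMem {X : Type*} [TopologicalSpace X] {T K : Set X} {f : X → ℝ}
    (hf : ContinuousOn f T) (hK : IsCompact K) (hKT : K ⊆ T) (h0 : ∀ y ∈ T, y ∉ K → f y = 0) :
    ∃ C : ℝ, 0 ≤ C ∧ ∀ y ∈ T, |f y| ≤ C := by
  obtain ⟨C, hC⟩ := hK.exists_bound_of_continuousOn (hf.mono hKT)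
  refine ⟨max C 0, le_max_right _ _, fun y hy => ?_⟩
  by_cases hyK : y ∈ K
  · exact (hC y hyK).trans (le_max_left _ _)
  · rw [h0 y hy hyK, abs_zero]; exact le_max_right _ _

/-! ### The weighted integral inequality in one chart -/

section Weighted

variable {n : ℕ} {T Ω K : Set (Euc n)} {Gb : Euc n → Matrix (Fin n) (Fin n) ℝ} {r ψ : Euc n → ℝ}

/-- `|dr|²` with respect to the metric `G`. -/
def gradSq (T : Set (Euc n)) (Gb : Euc n → Matrix (Fin n) (Fin n) ℝ) (r : Euc n → ℝ) (y : Euc n) :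
    ℝ := fderivWithin ℝ r T y (gradOf T Gb r y)

/-- The components of the vector field `ψ ∇r`, multiplied by the volume density. -/
def gradFlux (T : Set (Euc n)) (Gb : Euc n → Matrix (Fin n) (Fin n) ℝ) (r ψ : Euc n → ℝ) (i : Fin n)
    (y : Euc n) : ℝ := √(Gb y).det * ψ y * gradOf T Gb r y i

/-- The divergence of the vector field `-a r ψ ∇r`, with respect to the metric `r⁻² G`. -/
def weightedDiv (T : Set (Euc n)) (Gb : Euc n → Matrix (Fin n) (Fin n) ℝ) (r ψ : Euc n → ℝ) (a : ℝ)
    (y : Euc n) : ℝ :=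
  a * (n - 1) * (ψ y * gradSq T Gb r y) -
    a * r y * (√(Gb y).det)⁻¹ * ∑ i, fderivWithin ℝ (gradFlux T Gb r ψ i) T y (stdVec i)

lemma continuousOn_gradSq (hb : IsMetricOn T Gb) (hr : ContDiffOn ℝ 2 r T) :
    ContinuousOn (gradSq T Gb r) T :=
  (hr.continuousOn_fderivWithin hb.uniqueDiffOn (by norm_num)).clm_apply
    (contDiffOn_gradOf hb hr).continuousOn

lemma contDiffOn_gradFlux (hb : IsMetricOn T Gb) (hbi : ∀ y ∈ T, IsInnerForm (bilinOf (Gb y)))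
    (hr : ContDiffOn ℝ 2 r T) (hψ : ContDiffOn ℝ 1 ψ T) (i : Fin n) :
    ContDiffOn ℝ 1 (gradFlux T Gb r ψ i) T := by
  refine (ContDiffOn.mul ?_ hψ).mul ?_
  · refine ContDiffOn.sqrt (contDiffOn_det fun i j => (hb.contDiffOn i j).of_le (by norm_num))
      fun y hy => (det_pos_of_isInnerForm (hbi y hy)).ne'
  · exact (EuclideanSpace.proj i : Euc n →L[ℝ] ℝ).contDiff.comp_contDiffOn (contDiffOn_gradOf hb hr)

lemma continuousOn_weightedDiv (hb : IsMetricOn T Gb)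
    (hbi : ∀ y ∈ T, IsInnerForm (bilinOf (Gb y)))
    (hr : ContDiffOn ℝ 2 r T) (hψ : ContDiffOn ℝ 1 ψ T) (a : ℝ) :
    ContinuousOn (weightedDiv T Gb r ψ a) T := by
  have hs : ContinuousOn (fun y => √(Gb y).det) T := (contDiffOn_det hb.contDiffOn).continuousOn.sqrt
  refine (continuousOn_const.mul (hψ.continuousOn.mul (continuousOn_gradSq hb hr))).sub
    (((continuousOn_const.mul hr.continuousOn).mul (hs.inv₀ fun y hy =>
      (Real.sqrt_pos.2 (det_pos_of_isInnerForm (hbi y hy))).ne')).mul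
      (continuousOn_finsetSum _ fun i _ => ?_))
  exact ((contDiffOn_gradFlux hb hbi hr hψ i).continuousOn_fderivWithin hb.uniqueDiffOn
    (by norm_num)).clm_apply continuousOn_const

lemma weightedDiv_of_zero (a : ℝ) {y : Euc n} (h0 : r y = 0) :
    weightedDiv T Gb r ψ a y = a * (n - 1) * (ψ y * gradSq T Gb r y) := by
  simp [weightedDiv, h0]

lemma weightedDiv_eq_zero (hK : IsClosed K) (hψK : ∀ y, y ∉ K → ψ y = 0) (a : ℝ) {y : Euc n}
    (hy : y ∉ K) : weightedDiv T Gb r ψ a y = 0 := by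
  have h : ∀ i, fderivWithin ℝ (gradFlux T Gb r ψ i) T y = 0 := fun i => by
    have he : gradFlux T Gb r ψ i =ᶠ[𝓝 y] fun _ => 0 := by
      filter_upwards [hK.isOpen_compl.mem_nhds hy] with z hz
      rw [gradFlux, hψK z hz]; ring
    rw [(he.filter_mono nhdsWithin_le_nhds).fderivWithin_eq he.self_of_nhds, fderivWithin_const_apply]
  simp [weightedDiv, h, hψK y hy]

/-- The weighted inequality `∫ ψ |du|² ≥ ∫ (div(ψ X) - ψ |X|²) u²` for `X = -a r ∇r`, where the
divergence, norms and volume are those of the metric `r⁻² G`. -/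
lemma HasLocalWeakGrad.weighted_inequality [NeZero n] {u : Euc n → ℝ} {du : Fin n → Euc n → ℝ}
    {A : Euc n → ℝ} (hu : HasLocalWeakGrad Ω u du)
    (hK : IsCompact K) (hKT : K ⊆ T) (hΩ : IsOpen Ω) (hΩT : Ω ⊆ T) (hb : IsMetricOn T Gb)
    (hbi : ∀ y ∈ T, IsInnerForm (bilinOf (Gb y))) (hr : ContDiffOn ℝ 2 r T)
    (h0 : ∀ y ∈ T, y ∉ Ω → r y = 0) (hpos : ∀ y ∈ Ω, 0 < r y) (hψ : ContDiffOn ℝ 1 ψ T)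
    (hψK : ∀ y, y ∉ K → ψ y = 0) (hψ0 : ∀ y, 0 ≤ ψ y) (a : ℝ) {J : Euc n → ℝ}
    (hJ : ∀ y ∈ Ω, J y = (r y ^ n)⁻¹ * √(Gb y).det)
    (hA0 : ∀ y, 0 ≤ A y)
    (hA : ∀ y ∈ Ω, ∀ v : Euc n,
      (∑ i, v i * du i y) ^ 2 ≤ A y * ((r y ^ 2)⁻¹ * bilinOf (Gb y) v v))
    (hJu : IntegrableOn (fun y => J y * u y ^ 2) Ω) (hJA : IntegrableOn (fun y => J y * A y) Ω) :
    ∫ y in Ω, (weightedDiv T Gb r ψ a y - a ^ 2 * (ψ y * gradSq T Gb r y)) * (J y * u y ^ 2) ≤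
      ∫ y in Ω, ψ y * (J y * A y) := by
  -- The flux involves `r^{-(n-1)}`, which is written as `(r ^ k)⁻¹` to avoid truncated subtraction.
  obtain ⟨k, rfl⟩ : ∃ k, n = k + 1 := ⟨n - 1, by have := NeZero.ne n; omega⟩
  have hΩm := hΩ.measurableSet
  have hcψ := hψ.continuousOn
  have hcq := continuousOn_gradSq hb hr
  have hcD := continuousOn_weightedDiv hb hbi hr hψ a
  have hcN := (contDiffOn_gradOf hb hr).continuousOn
  have hJpos : ∀ y ∈ Ω, 0 < J y := fun y hy => by
    rw [hJ y hy]
    exact mul_pos (inv_pos.2 (pow_pos (hpos y hy) _))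
      (Real.sqrt_pos.2 (det_pos_of_isInnerForm (hbi y (hΩT hy))))
  have hJc : ContinuousOn J Ω := by
    refine ContinuousOn.congr ?_ hJ
    exact ((hr.continuousOn.mono hΩT).pow _ |>.inv₀ fun y hy => (pow_pos (hpos y hy) _).ne').mul
      ((contDiffOn_det hb.contDiffOn).continuousOn.sqrt.mono hΩT)
  obtain ⟨C₁, hC₁0, hC₁⟩ := exists_bound_of_eq_zero_of_notMem hcψ hK hKT fun y _ => hψK y
  obtain ⟨C₂, hC₂0, hC₂⟩ := exists_bound_of_eq_zero_of_notMem (hcψ.mul hcq) hK hKT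
    fun y _ hy => by rw [Pi.mul_apply, hψK y hy, zero_mul]
  obtain ⟨C₃, hC₃0, hC₃⟩ := exists_bound_of_eq_zero_of_notMem hcD hK hKT
    fun y _ hy => weightedDiv_eq_zero hK.isClosed hψK a hy
  have bdd : ∀ {f φ : Euc (k + 1) → ℝ} {C : ℝ}, IntegrableOn φ Ω → ContinuousOn f T →
      (∀ y ∈ T, |f y| ≤ C) → IntegrableOn (fun y => f y * φ y) Ω := fun {f φ C} hφ hf hC =>
    hφ.bdd_mul (c := C) ((hf.mono hΩT).aestronglyMeasurable hΩm) (by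
      filter_upwards [ae_restrict_mem hΩm] with y hy using hC y (hΩT hy))
  have hq0 : ∀ y ∈ T, 0 ≤ gradSq T Gb r y := fun y hy => by
    rw [gradSq, ← bilinOf_gradOf (hb.det_ne_zero y hy) (hb.symm y hy)]
    exact (hbi y hy).nonneg _
  -- the pairing `du(X)`
  set t : Euc (k + 1) → ℝ := fun y => ∑ i, (-a * r y * gradOf T Gb r y i) * du i y with ht
  -- The bound `hA` with `v = X = -a r ∇r`: the factor `r²` cancels the conformal factor `r⁻²`, so
  -- `|X|² = a² |dr|²`.
  have htA : ∀ y ∈ Ω, t y ^ 2 ≤ A y * (a ^ 2 * gradSq T Gb r y) := fun y hy => by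
    have h := hA y hy ((-a * r y) • gradOf T Gb r y)
    have hry := (hpos y hy).ne'
    simp only [map_smul, _root_.smul_apply, smul_eq_mul,
      bilinOf_gradOf (hb.det_ne_zero y (hΩT hy)) (hb.symm y (hΩT hy))] at h
    refine h.trans_eq ?_
    rw [gradSq]
    field_simp
  have htm : AEMeasurable t (volume.restrict Ω) := by
    refine Finset.aemeasurable_fun_sum _ fun i _ => AEMeasurable.mul ?_ ((hu.aemeasurable hΩ).2 i)
    refine ContinuousOn.aemeasurable ?_ hΩm
    exact (continuousOn_const.mul (hr.continuousOn.mono hΩT)).mul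
      ((EuclideanSpace.proj i : Euc (k + 1) →L[ℝ] ℝ).continuous.comp_continuousOn (hcN.mono hΩT))
  have i₁ : IntegrableOn (fun y => ψ y * (J y * A y)) Ω := bdd hJA hcψ hC₁
  have i₂ : IntegrableOn (fun y => weightedDiv T Gb r ψ a y * (J y * u y ^ 2)) Ω := bdd hJu hcD hC₃
  have i₃ : IntegrableOn (fun y => (ψ y * gradSq T Gb r y) * (J y * u y ^ 2)) Ω :=
    bdd hJu (hcψ.mul hcq) hC₂
  have i₄ : IntegrableOn (fun y => J y * (2 * u y * t y * ψ y)) Ω := by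
    refine ((hJu.const_mul C₁).add (hJA.const_mul (a ^ 2 * C₂))).mono' ?_ ?_
    · exact ((hJc.aemeasurable hΩm).mul ((((hu.aemeasurable hΩ).1.const_mul 2).mul htm).mul
        ((hcψ.mono hΩT).aemeasurable hΩm))).aestronglyMeasurable
    · filter_upwards [ae_restrict_mem hΩm] with y hy
      have hJy := hJpos y hy
      rw [Real.norm_eq_abs, abs_mul, abs_of_pos hJy, abs_mul, abs_of_nonneg (hψ0 y)]
      have h1 : |2 * u y * t y| ≤ u y ^ 2 + A y * (a ^ 2 * gradSq T Gb r y) := by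
        have := htA y hy
        rw [abs_le]
        constructor <;> nlinarith [sq_nonneg (u y + t y), sq_nonneg (u y - t y)]
      have h2 : ψ y ≤ C₁ := (le_abs_self _).trans (hC₁ y (hΩT hy))
      have h3 : ψ y * gradSq T Gb r y ≤ C₂ := (le_abs_self _).trans (hC₂ y (hΩT hy))
      calc J y * (|2 * u y * t y| * ψ y)
          ≤ J y * ((u y ^ 2 + A y * (a ^ 2 * gradSq T Gb r y)) * ψ y) := by
            gcongr
            exact hψ0 y
        _ = (J y * u y ^ 2) * ψ y + (J y * A y * a ^ 2) * (ψ y * gradSq T Gb r y) := by ring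
        _ ≤ (J y * u y ^ 2) * C₁ + (J y * A y * a ^ 2) * C₂ := by
            have := hA0 y
            gcongr
        _ = C₁ * (J y * u y ^ 2) + a ^ 2 * C₂ * (J y * A y) := by ring
  -- the divergence theorem
  set F : Fin (k + 1) → Euc (k + 1) → ℝ :=
    fun i y => -a * (r y ^ k)⁻¹ * gradFlux T Gb r ψ i y with hF
  have hFc : ∀ i, ContDiffOn ℝ 1 (F i) Ω := fun i =>
    (contDiffOn_const.mul ((((hr.of_le (by norm_num)).mono hΩT).pow k).inv fun y hy =>
      (pow_pos (hpos y hy) _).ne')).mul ((contDiffOn_gradFlux hb hbi hr hψ i).mono hΩT)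
  have hFK : ∀ i, ∀ y ∈ Ω, y ∉ K → F i y = 0 := fun i y _ hy => by
    simp [hF, gradFlux, hψK y hy]
  have hFJ : ∀ i, ∀ y ∈ Ω, F i y = J y * ψ y * (-a * r y * gradOf T Gb r y i) := fun i y hy => by
    have hry := (hpos y hy).ne'
    rw [hJ y hy, pow_succ]
    simp only [hF, gradFlux]
    field_simp
  have hTn : ∀ y ∈ Ω, T ∈ 𝓝 y := fun y hy => mem_of_superset (hΩ.mem_nhds hy) hΩT
  have hrp : ∀ i, ∀ y ∈ Ω, partialDeriv i r y = fderivWithin ℝ r T y (stdVec i) := fun i y hy => by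
    rw [partialDeriv, fderivWithin_of_mem_nhds (hTn y hy)]
  have hsum : ∀ y ∈ Ω, ∑ i, gradOf T Gb r y i * partialDeriv i r y = gradSq T Gb r y :=
    fun y hy => by
    simp only [hrp _ y hy]
    rw [gradSq, gradOf, apply_sharp]
    refine Finset.sum_congr rfl fun i _ => ?_
    rw [sharp_apply, Finset.sum_mul]
    exact Finset.sum_congr rfl fun j _ => by ring
  -- Differentiating `r⁻ᵏ` produces the leading term `a (n - 1) ψ |dr|²`; differentiating the flux
  -- leaves a term with an extra factor `r`.
  have hdiv : ∀ y ∈ Ω, ∑ i, partialDeriv i (F i) y = J y * weightedDiv T Gb r ψ a y := by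
    intro y hy
    have hry := (hpos y hy).ne'
    have hs := (Real.sqrt_pos.2 (det_pos_of_isInnerForm (hbi y (hΩT hy)))).ne'
    have hdr : HasFDerivAt r (fderiv ℝ r y) y :=
      (((hr.contDiffAt (hTn y hy)).differentiableAt (by simp))).hasFDerivAt
    have hp : ∀ i, partialDeriv i (F i) y =
        a * k * (r y ^ (k + 1))⁻¹ * (gradFlux T Gb r ψ i y * partialDeriv i r y) -
          a * (r y ^ k)⁻¹ * fderivWithin ℝ (gradFlux T Gb r ψ i) T y (stdVec i) := by
      intro i
      have h1 := ((hasDerivAt_inv_pow k hry).comp_hasFDerivAt y hdr).const_mul (-a)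
      have h2 := (((contDiffOn_gradFlux hb hbi hr hψ i).contDiffAt (hTn y hy)).differentiableAt
        (by simp)).hasFDerivAt
      have h3 := (h1.mul h2).fderiv
      have h4 : partialDeriv i (F i) y = _ := congrArg (fun L => L (stdVec i)) h3
      rw [h4, fderivWithin_of_mem_nhds (hTn y hy)]
      simp only [_root_.add_apply, _root_.smul_apply, smul_eq_mul, Function.comp_apply, partialDeriv]
      ring
    simp only [hp]
    rw [Finset.sum_sub_distrib, ← Finset.mul_sum, ← Finset.mul_sum, weightedDiv, hJ y hy]
    have h5 : ∑ i, gradFlux T Gb r ψ i y * partialDeriv i r y =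
        √(Gb y).det * ψ y * gradSq T Gb r y := by
      rw [← hsum y hy, Finset.mul_sum]
      exact Finset.sum_congr rfl fun i _ => by rw [gradFlux]; ring
    rw [h5, pow_succ]
    push_cast
    field_simp
    ring
  have hHeq : ∀ y ∈ Ω, ∑ i, (2 * u y * du i y * F i y + u y ^ 2 * partialDeriv i (F i) y) =
      J y * (2 * u y * t y * ψ y) + weightedDiv T Gb r ψ a y * (J y * u y ^ 2) := by
    intro y hy
    rw [Finset.sum_add_distrib, ← Finset.mul_sum, hdiv y hy]
    simp only [hFJ _ y hy, ht, Finset.mul_sum, Finset.sum_mul]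
    congr 1
    · exact Finset.sum_congr rfl fun i _ => by ring
    · ring
  -- `F` has a factor `r` relative to the volume density, so dividing `F · dr` by `r` still leaves a
  -- bounded multiple of the integrable function `J u²`.
  have hEeq : ∀ y ∈ Ω, u y ^ 2 * ((∑ i, F i y * partialDeriv i r y) / r y) =
      -a * ((ψ y * gradSq T Gb r y) * (J y * u y ^ 2)) := by
    intro y hy
    have hry := (hpos y hy).ne'
    have h1 : ∑ i, F i y * partialDeriv i r y = J y * ψ y * (-a * r y) * gradSq T Gb r y := by
      rw [← hsum y hy, Finset.mul_sum]
      exact Finset.sum_congr rfl fun i _ => by rw [hFJ i y hy]; ring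
    rw [h1]
    field_simp
  have hzero := hu.integral_div_eq_zero hK hKT hΩ hr.continuousOn
    ((hr.of_le (by norm_num)).mono hΩT) h0 hpos hFc hFK
    (IntegrableOn.congr_fun (i₄.add i₂) (fun y hy => (hHeq y hy).symm) hΩm)
    (IntegrableOn.congr_fun (i₃.const_mul (-a)) (fun y hy => (hEeq y hy).symm) hΩm)
  rw [setIntegral_congr_fun hΩm hHeq, integral_add i₄ i₂] at hzero
  have i₆ : IntegrableOn (fun y => -(J y * (2 * u y * t y * ψ y))) Ω := i₄.neg
  have i₅ : IntegrableOn (fun y => -(J y * (2 * u y * t y * ψ y)) -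
      a ^ 2 * ((ψ y * gradSq T Gb r y) * (J y * u y ^ 2))) Ω := i₆.sub (i₃.const_mul _)
  calc ∫ y in Ω, (weightedDiv T Gb r ψ a y - a ^ 2 * (ψ y * gradSq T Gb r y)) * (J y * u y ^ 2)
      = (∫ y in Ω, weightedDiv T Gb r ψ a y * (J y * u y ^ 2)) -
          ∫ y in Ω, a ^ 2 * ((ψ y * gradSq T Gb r y) * (J y * u y ^ 2)) := by
        rw [← integral_sub i₂ (i₃.const_mul _)]
        exact integral_congr_ae (Eventually.of_forall fun y => by dsimp only; ring)
    _ = ∫ y in Ω, (-(J y * (2 * u y * t y * ψ y)) -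
          a ^ 2 * ((ψ y * gradSq T Gb r y) * (J y * u y ^ 2))) := by
        rw [integral_sub i₆ (i₃.const_mul _), integral_neg]
        linarith
    _ ≤ ∫ y in Ω, ψ y * (J y * A y) := by
        refine setIntegral_mono_on i₅ i₁ hΩm fun y hy => ?_
        -- Pointwise `|du|² + 2 u du(X) + u² |X|² ≥ 0`, to be multiplied by `J ψ ≥ 0`; the cross
        -- term has been replaced by the divergence using `hzero`.
        have h1 := add_two_mul_add_nonneg (u := u y) (hA0 y)
          (mul_nonneg (sq_nonneg a) (hq0 y (hΩT hy))) (htA y hy)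
        have h2 := mul_nonneg (mul_nonneg (hJpos y hy).le (hψ0 y)) h1
        nlinarith [h2]

end Weighted

/-! ### A lower bound for the Dirichlet energy -/

section Potential

variable {n : ℕ} [NeZero n] {M : Type*} [TopologicalSpace M]
  [ChartedSpace (EuclideanHalfSpace n) M]

/-- The function on `M` which is given by `f` in the chart around `x₀` and vanishes outside it. -/
def fromChart (x₀ : M) (f : Euc n → ℝ) : M → ℝ :=
  (extChartAt (𝓡∂ n) x₀).source.indicator fun x => f (extChartAt (𝓡∂ n) x₀ x)

lemma continuous_fromChart {x₀ : M} {f : Euc n → ℝ} {C : Set M} (hC : IsClosed C)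
    (hCs : C ⊆ (extChartAt (𝓡∂ n) x₀).source)
    (hf : ContinuousOn f (extChartAt (𝓡∂ n) x₀).target)
    (h0 : ∀ y ∈ (extChartAt (𝓡∂ n) x₀).target, y ∉ extChartAt (𝓡∂ n) x₀ '' C → f y = 0) :
    Continuous (fromChart x₀ f) := by
  have hz : ∀ x ∉ C, fromChart x₀ f x = 0 := fun x hx => by
    by_cases hs : x ∈ (extChartAt (𝓡∂ n) x₀).source
    · rw [fromChart, Set.indicator_of_mem hs]
      refine h0 _ ((extChartAt (𝓡∂ n) x₀).map_source hs) ?_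
      rintro ⟨z, hz, hzx⟩
      exact hx ((extChartAt (𝓡∂ n) x₀).injOn (hCs hz) hs hzx ▸ hz)
    · rw [fromChart, Set.indicator_of_notMem hs]
  refine continuous_iff_continuousAt.2 fun x => ?_
  by_cases hx : x ∈ C
  · have h1 : ContinuousAt (fun x => f (extChartAt (𝓡∂ n) x₀ x)) x :=
      (hf.comp (continuousOn_extChartAt x₀) (extChartAt (𝓡∂ n) x₀).mapsTo).continuousAt
        ((isOpen_extChartAt_source x₀).mem_nhds (hCs hx))
    refine h1.congr ?_
    filter_upwards [(isOpen_extChartAt_source x₀).mem_nhds (hCs hx)] with z hz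
    rw [fromChart, Set.indicator_of_mem hz]
  · refine (continuousAt_const (y := (0 : ℝ))).congr ?_
    filter_upwards [hC.isOpen_compl.mem_nhds hx] with z hz'
    exact (hz z hz').symm

/-- `ψ`, read in the chart around `x₀` and extended by zero. -/
def weightInChart (x₀ : M) (ψ : M → ℝ) : Euc n → ℝ :=
  (extChartAt (𝓡∂ n) x₀).target.indicator (inChart (n := n) ψ x₀)

lemma weightInChart_eq_zero {x₀ : M} {ψ : M → ℝ} {y : Euc n}
    (hy : y ∉ extChartAt (𝓡∂ n) x₀ '' tsupport ψ) : weightInChart x₀ ψ y = 0 := by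
  by_cases hT : y ∈ (extChartAt (𝓡∂ n) x₀).target
  · rw [weightInChart, Set.indicator_of_mem hT, inChart]
    by_contra h
    exact hy ⟨_, subset_tsupport _ h, (extChartAt (𝓡∂ n) x₀).right_inv hT⟩
  · rw [weightInChart, Set.indicator_of_notMem hT]

lemma weightInChart_nonneg (x₀ : M) {ψ : M → ℝ} (h : ∀ x, 0 ≤ ψ x) (y : Euc n) :
    0 ≤ weightInChart x₀ ψ y := Set.indicator_nonneg (fun _ _ => h _) _

lemma isCompact_image_tsupport [CompactSpace M] {x₀ : M} {ψ : M → ℝ}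
    (hs : tsupport ψ ⊆ (extChartAt (𝓡∂ n) x₀).source) :
    IsCompact (extChartAt (𝓡∂ n) x₀ '' tsupport ψ) :=
  (isClosed_tsupport ψ).isCompact.image_of_continuousOn ((continuousOn_extChartAt x₀).mono hs)

variable [IsManifold (𝓡∂ n) ∞ M]

lemma contDiffOn_weightInChart (x₀ : M) {ψ : M → ℝ} (hψ : ContMDiff (𝓡∂ n) 𝓘(ℝ, ℝ) ∞ ψ) :
    ContDiffOn ℝ ∞ (weightInChart x₀ ψ) (extChartAt (𝓡∂ n) x₀).target := by
  have h : ContDiffOn ℝ ∞ (inChart (n := n) ψ x₀) (extChartAt (𝓡∂ n) x₀).target :=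
    contMDiffOn_iff_contDiffOn.1 (hψ.comp_contMDiffOn (contMDiffOn_extChartAt_symm x₀))
  exact h.congr fun y hy => by rw [weightInChart, Set.indicator_of_mem hy]

variable {ρ : M → ℝ} {gb g : BilinField n M}

/-- The potential of the weighted inequality, in the chart around `x₀`. -/
def chartPotential (ρ : M → ℝ) (gb : BilinField n M) (x₀ : M) (ψ : M → ℝ) (a : ℝ) (y : Euc n) : ℝ :=
  weightedDiv (extChartAt (𝓡∂ n) x₀).target (coeffMatrix gb x₀) (inChart (n := n) ρ x₀)
      (weightInChart x₀ ψ) a y -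
    a ^ 2 * (weightInChart x₀ ψ y * gradSq (extChartAt (𝓡∂ n) x₀).target (coeffMatrix gb x₀)
      (inChart (n := n) ρ x₀) y)

namespace IsAHPair

lemma contDiffOn_inChart_two (h : IsAHPair ρ gb g) (x₀ : M) :
    ContDiffOn ℝ 2 (inChart (n := n) ρ x₀) (extChartAt (𝓡∂ n) x₀).target :=
  (h.contDiffOn_inChart x₀).of_le (by norm_cast)

/-- The scalar curvature extends continuously to the boundary, with the value `-n(n-1)`. -/
theorem exists_continuous_scalarCurvature (h : IsAHPair ρ gb g) :
    ∃ S : M → ℝ, Continuous S ∧ (∀ x ∈ (𝓡∂ n).interior M, S x = scalarCurvature g x) ∧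
      ∀ x ∈ (𝓡∂ n).boundary M, S x = -(n * (n - 1)) := by
  classical
  set S : M → ℝ := fun x => if x ∈ (𝓡∂ n).interior M then scalarCurvature g x else -(n * (n - 1))
    with hS
  refine ⟨S, continuous_iff_continuousAt.2 fun x₀ => ?_, fun x hx => if_pos hx, fun x hx => ?_⟩
  -- Near `x₀`, the function is read in the single chart around `x₀`; this uses that the scalar
  -- curvature is the same in all charts, and that `|dρ| = 1` on the boundary.
  · obtain ⟨f, hf, hf1, hf2⟩ := exists_continuousOn_scalarCoeff_conformal (h.isMetricOn x₀)
      (h.contDiffOn_inChart_two x₀) (isOpen_chartDomain x₀) (chartDomain_subset x₀)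
      (fun y hy => h.inChart_pos hy) (fun y hy => h.coeffMatrix_eq hy)
    have h1 : ContinuousAt (fun x => f (extChartAt (𝓡∂ n) x₀ x)) x₀ :=
      (hf.comp (continuousOn_extChartAt x₀) (extChartAt (𝓡∂ n) x₀).mapsTo).continuousAt
        (extChartAt_source_mem_nhds x₀)
    refine h1.congr ?_
    filter_upwards [extChartAt_source_mem_nhds (I := 𝓡∂ n) x₀] with x hx
    have hT := (extChartAt (𝓡∂ n) x₀).map_source hx
    have hi := (extChartAt (𝓡∂ n) x₀).left_inv hx
    by_cases hxi : x ∈ (𝓡∂ n).interior M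
    · have hy := extChartAt_mem_chartDomain hx hxi
      simp only [hS]
      rw [if_pos hxi, ← hf1 _ hy, ← h.scalarCurvature_eq hy, hi]
    · have h0 : inChart (n := n) ρ x₀ (extChartAt (𝓡∂ n) x₀ x) = 0 := by
        rw [inChart, hi, h.defining.eq_zero_iff, ← ModelWithCorners.compl_interior]
        exact hxi
      simp only [hS]
      rw [if_neg hxi, hf2 _ hT h0, h.fderivWithin_gradOf hT h0, mul_one]
  · rw [← ModelWithCorners.compl_interior] at hx
    exact if_neg hx

section CompactSupport

variable {x₀ : M} {ψ : M → ℝ}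

/-- At `ρ = 0` the terms of the divergence containing derivatives of `ψ` or second derivatives of
`ρ` vanish, and `|dρ| = 1`. -/
lemma fromChart_chartPotential_of_boundary (h : IsAHPair ρ gb g)
    (hs : tsupport ψ ⊆ (extChartAt (𝓡∂ n) x₀).source) (a : ℝ) {x : M}
    (hx : x ∈ (𝓡∂ n).boundary M) :
    fromChart x₀ (chartPotential ρ gb x₀ ψ a) x = (a * (n - 1) - a ^ 2) * ψ x := by
  by_cases hxs : x ∈ (extChartAt (𝓡∂ n) x₀).source
  · have hT := (extChartAt (𝓡∂ n) x₀).map_source hxs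
    have hi := (extChartAt (𝓡∂ n) x₀).left_inv hxs
    have h0 : inChart (n := n) ρ x₀ (extChartAt (𝓡∂ n) x₀ x) = 0 := by
      rw [inChart, hi]; exact (h.defining.eq_zero_iff x).2 hx
    rw [fromChart, Set.indicator_of_mem hxs, chartPotential, weightedDiv_of_zero a h0, gradSq,
      h.fderivWithin_gradOf hT h0, weightInChart, Set.indicator_of_mem hT, inChart, hi]
    ring
  · rw [fromChart, Set.indicator_of_notMem hxs,
      image_eq_zero_of_notMem_tsupport fun hx => hxs (hs hx), mul_zero]

lemma volDensity_eq (h : IsAHPair ρ gb g) {y : Euc n} (hy : y ∈ chartDomain x₀) :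
    volDensity g x₀ y = (inChart (n := n) ρ x₀ y ^ n)⁻¹ * √(coeffMatrix gb x₀ y).det := by
  rw [volDensity, h.coeffMatrix_eq hy, Matrix.det_smul, Fintype.card_fin, Real.sqrt_mul (by positivity),
    ← inv_pow, ← pow_mul, mul_comm 2 n, pow_mul,
    Real.sqrt_sq (pow_nonneg (inv_nonneg.2 (h.inChart_pos hy).le) n), inv_pow]

variable [CompactSpace M]

lemma continuous_fromChart_chartPotential (h : IsAHPair ρ gb g)
    (hψ : ContMDiff (𝓡∂ n) 𝓘(ℝ, ℝ) ∞ ψ)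
    (hs : tsupport ψ ⊆ (extChartAt (𝓡∂ n) x₀).source) (a : ℝ) :
    Continuous (fromChart x₀ (chartPotential ρ gb x₀ ψ a)) := by
  have hw := contDiffOn_weightInChart x₀ hψ
  refine continuous_fromChart (isClosed_tsupport ψ) hs ?_ fun y _ hy => ?_
  · exact (continuousOn_weightedDiv (h.isMetricOn x₀) (fun y hy => h.isInnerForm_chart hy)
      (h.contDiffOn_inChart_two x₀) (hw.of_le (by norm_cast)) a).sub
      (continuousOn_const.mul (hw.continuousOn.mul
        (continuousOn_gradSq (h.isMetricOn x₀) (h.contDiffOn_inChart_two x₀))))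
  · rw [chartPotential, weightInChart_eq_zero hy,
      weightedDiv_eq_zero (isCompact_image_tsupport hs).isClosed
        (fun y hy => weightInChart_eq_zero hy) a hy]
    ring

variable [MeasurableSpace M] [BorelSpace M]

/-- The weighted inequality in one chart. -/
lemma chart_inequality (h : IsAHPair ρ gb g) (hψ : ContMDiff (𝓡∂ n) 𝓘(ℝ, ℝ) ∞ ψ)
    (hψ0 : ∀ x, 0 ≤ ψ x) (hs : tsupport ψ ⊆ (extChartAt (𝓡∂ n) x₀).source) (a : ℝ)
    {U : FunctionWithDiff n M} (hU : U ∈ sobolevSpace g) :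
    ∫ x, fromChart x₀ (chartPotential ρ gb x₀ ψ a) x * U.1 x ^ 2 ∂riemVolume g ≤
      ∫ x, ψ x * diffNorm g U.2 x ^ 2 ∂riemVolume g := by
  obtain ⟨hl, hi1, hi2⟩ := h.mem_sobolevSpace_iff.1 hU
  have m1 : AEMeasurable (fun x => fromChart x₀ (chartPotential ρ gb x₀ ψ a) x * U.1 x ^ 2)
      (riemVolume g) := (h.continuous_fromChart_chartPotential hψ hs a).measurable.aemeasurable.mul
    hi1.1.aemeasurable
  have m2 : AEMeasurable (fun x => ψ x * diffNorm g U.2 x ^ 2) (riemVolume g) :=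
    hψ.continuous.measurable.aemeasurable.mul hi2.1.aemeasurable
  rw [← setIntegral_eq_integral_of_forall_compl_eq_zero (s := (extChartAt (𝓡∂ n) x₀).source)
      (f := fun x => fromChart x₀ (chartPotential ρ gb x₀ ψ a) x * U.1 x ^ 2) fun x hx => by
        rw [fromChart, Set.indicator_of_notMem hx, zero_mul],
    ← setIntegral_eq_integral_of_forall_compl_eq_zero (s := (extChartAt (𝓡∂ n) x₀).source)
      (f := fun x => ψ x * diffNorm g U.2 x ^ 2) fun x hx => by
        rw [image_eq_zero_of_notMem_tsupport fun h => hx (hs h), zero_mul],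
    h.setIntegral_source x₀ m1, h.setIntegral_source x₀ m2]
  have hΩm := (isOpen_chartDomain (n := n) x₀).measurableSet
  have hw := (isLocallySobolev_iff.1 hl x₀).weighted_inequality
    (A := inChart (n := n) (fun x => diffNorm g U.2 x ^ 2) x₀) (J := volDensity g x₀)
    (isCompact_image_tsupport hs)
    (by rintro _ ⟨x, hx, rfl⟩; exact (extChartAt (𝓡∂ n) x₀).map_source (hs hx))
    (isOpen_chartDomain x₀) (chartDomain_subset x₀) (h.isMetricOn x₀)
    (fun y hy => h.isInnerForm_chart hy) (h.contDiffOn_inChart_two x₀)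
    (fun y hy hy' => h.inChart_eq_zero hy hy') (fun y hy => h.inChart_pos hy)
    ((contDiffOn_weightInChart x₀ hψ).of_le (by norm_cast)) (fun y hy => weightInChart_eq_zero hy)
    (weightInChart_nonneg x₀ hψ0) a (fun y hy => h.volDensity_eq hy)
    (fun y => sq_nonneg _) ?_
    ((h.integrableOn_source_iff x₀ hi1.1.aemeasurable).1 hi1.integrableOn)
    ((h.integrableOn_source_iff x₀ hi2.1.aemeasurable).1 hi2.integrableOn)
  · refine le_trans (le_of_eq ?_) (hw.trans (le_of_eq ?_))
    · refine setIntegral_congr_fun hΩm fun y hy => ?_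
      have hT := chartDomain_subset x₀ hy
      rw [inChart, fromChart, Set.indicator_of_mem ((extChartAt (𝓡∂ n) x₀).map_target hT),
        (extChartAt (𝓡∂ n) x₀).right_inv hT, chartPotential, inChart]
      ring
    · refine setIntegral_congr_fun hΩm fun y hy => ?_
      have hT := chartDomain_subset x₀ hy
      rw [weightInChart, Set.indicator_of_mem hT]
      simp only [inChart]
      ring
  · intro y hy v
    have h1 := sq_apply_le_dualNorm (h.isInnerForm (symm_mem_interior hy))
      (covectorAt U.2 ((extChartAt (𝓡∂ n) x₀).symm y)) (chartDeriv x₀ y v)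
    rw [← bilinOf_coeffMatrix, h.coeffMatrix_eq hy, bilinOf_smul] at h1
    refine le_trans (le_of_eq ?_) h1
    congr 1
    have hv : v = ∑ i, v i • stdVec i := by
      ext k; simp [Finset.sum_apply, Pi.single_apply]
    conv_rhs => rw [hv]
    simp only [map_sum, map_smul, smul_eq_mul]
    rfl

end CompactSupport

variable [CompactSpace M] [T2Space M] [MeasurableSpace M] [BorelSpace M]

/-- The Dirichlet energy is bounded below by `∫ V u²`, for a continuous function `V` whose value on
the boundary is `((n-1)/2)²`. -/
theorem exists_dirichlet_lower_bound (h : IsAHPair ρ gb g) :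
    ∃ V : M → ℝ, Continuous V ∧ (∀ x ∈ (𝓡∂ n).boundary M, V x = ((n - 1) / 2) ^ 2) ∧
      ∀ U ∈ sobolevSpace g, ∫ x, V x * U.1 x ^ 2 ∂riemVolume g ≤
        ∫ x, diffNorm g U.2 x ^ 2 ∂riemVolume g := by
  obtain ⟨t, ht⟩ := exists_finset_iUnion_source (n := n) (M := M)
  obtain ⟨ψ, hψ⟩ := SmoothPartitionOfUnity.exists_isSubordinate (𝓡∂ n) isClosed_univ
    (fun x₀ : t => (extChartAt (𝓡∂ n) (x₀ : M)).source)
    (fun x₀ => isOpen_extChartAt_source (x₀ : M)) ht.symm.subset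
  -- This maximises the boundary value `a(n-1) - a²`; the maximum is `((n-1)/2)²`.
  set a : ℝ := (n - 1) / 2 with ha
  have hsum : ∀ x, ∑ i, ψ i x = 1 := fun x => by
    rw [← finsum_eq_sum_of_fintype]; exact ψ.sum_eq_one (Set.mem_univ x)
  set v : t → M → ℝ := fun i => fromChart (i : M) (chartPotential ρ gb (i : M) (ψ i) a) with hv
  have hvc : ∀ i, Continuous (v i) := fun i =>
    h.continuous_fromChart_chartPotential (ψ i).contMDiff (hψ i) a
  refine ⟨fun x => ∑ i, v i x, continuous_finsetSum _ fun i _ => hvc i, fun x hx => ?_,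
    fun U hU => ?_⟩
  · have h1 : ∀ i, v i x = (a * (n - 1) - a ^ 2) * ψ i x := fun i =>
      h.fromChart_chartPotential_of_boundary (hψ i) a hx
    simp only [h1]
    rw [← Finset.mul_sum, hsum, ha]
    ring
  · obtain ⟨-, hi1, hi2⟩ := h.mem_sobolevSpace_iff.1 hU
    have bdd : ∀ {f φ : M → ℝ}, Continuous f → Integrable φ (riemVolume g) →
        Integrable (fun x => f x * φ x) (riemVolume g) := fun {f φ} hf hφ => by
      obtain ⟨C, hC⟩ := isCompact_univ.exists_bound_of_continuousOn hf.continuousOn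
      exact hφ.bdd_mul hf.measurable.aestronglyMeasurable (c := C)
        (Eventually.of_forall fun x => hC x (Set.mem_univ x))
    calc ∫ x, (∑ i, v i x) * U.1 x ^ 2 ∂riemVolume g
        = ∑ i, ∫ x, v i x * U.1 x ^ 2 ∂riemVolume g := by
          simp only [Finset.sum_mul]
          exact integral_finsetSum _ fun i _ => bdd (hvc i) hi1
      _ ≤ ∑ i, ∫ x, ψ i x * diffNorm g U.2 x ^ 2 ∂riemVolume g :=
          Finset.sum_le_sum fun i _ => h.chart_inequality (ψ i).contMDiff
            (fun x => ψ.nonneg i x) (hψ i) a hU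
      _ = ∫ x, diffNorm g U.2 x ^ 2 ∂riemVolume g := by
          rw [← integral_finsetSum _ fun i _ => bdd (ψ i).contMDiff.continuous hi2]
          refine integral_congr_ae (Eventually.of_forall fun x => ?_)
          dsimp only
          rw [← Finset.sum_mul, hsum, one_mul]

end IsAHPair

end Potential

/-! ### Weak convergence and local compactness -/

/-- A weakly convergent sequence in `L²` is bounded. -/
lemma exists_bound_eLpNorm_of_tendsto {α : Type*} [MeasurableSpace α] {μ : Measure α}
    {f : ℕ → α → ℝ} (hf : ∀ k, MemLp (f k) 2 μ)
    (h : ∀ φ, MemLp φ 2 μ → ∃ l, Tendsto (fun k => ∫ x, f k x * φ x ∂μ) atTop (𝓝 l)) :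
    ∃ C, ∀ k, (eLpNorm (f k) 2 μ).toReal ≤ C := by
  -- The functionals `⟨f k, ·⟩` on `L²` are pointwise bounded, since convergent sequences are
  -- bounded, hence bounded in norm.
  obtain ⟨C, hC⟩ := banach_steinhaus (g := fun k => innerSL ℝ ((hf k).toLp (f k))) fun x => by
    obtain ⟨l, hl⟩ := h x (Lp.memLp x)
    obtain ⟨C, hC⟩ := (Metric.isBounded_range_of_tendsto _ hl).exists_norm_le
    refine ⟨C, fun k => ?_⟩
    have h1 : innerSL ℝ ((hf k).toLp (f k)) x = ∫ y, f k y * x y ∂μ := by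
      rw [innerSL_apply_apply, L2.inner_def]
      refine integral_congr_ae ?_
      filter_upwards [(hf k).coeFn_toLp] with y hy
      rw [hy]
      simp [mul_comm]
    rw [h1]
    exact hC _ ⟨k, rfl⟩
  refine ⟨C, fun k => ?_⟩
  have := hC k
  rwa [innerSL_apply_norm, Lp.norm_toLp] at this

section Weak

variable {n : ℕ} [NeZero n] {M : Type*} [TopologicalSpace M]
  [ChartedSpace (EuclideanHalfSpace n) M] [MeasurableSpace M]

/-- `Λ` is a bounded linear map from the Sobolev space of `g` to `L²(ℝⁿ)`. -/
structure IsBoundedL2Map (g : BilinField n M) (Λ : FunctionWithDiff n M → Euc n → ℝ) : Prop where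
  map_add : ∀ U V y, Λ (U + V) y = Λ U y + Λ V y
  map_smul : ∀ (c : ℝ) U y, Λ (c • U) y = c * Λ U y
  memLp : ∀ U ∈ sobolevSpace g, MemLp (Λ U) 2 volume
  bound : ∃ C : ℝ, 0 ≤ C ∧ ∀ U ∈ sobolevSpace g,
    (eLpNorm (Λ U) 2 volume).toReal ≤ C * sobolevNorm g U

variable {g : BilinField n M}

lemma IsBoundedL2Map.add {Λ Λ' : FunctionWithDiff n M → Euc n → ℝ} (h : IsBoundedL2Map g Λ)
    (h' : IsBoundedL2Map g Λ') : IsBoundedL2Map g (fun U y => Λ U y + Λ' U y) where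
  map_add U V y := by rw [h.map_add, h'.map_add]; ring
  map_smul c U y := by rw [h.map_smul, h'.map_smul]; ring
  memLp U hU := (h.memLp U hU).add (h'.memLp U hU)
  bound := by
    obtain ⟨C, hC0, hC⟩ := h.bound
    obtain ⟨C', hC0', hC'⟩ := h'.bound
    refine ⟨C + C', add_nonneg hC0 hC0', fun U hU => ?_⟩
    have h1 := eLpNorm_add_le (h.memLp U hU).1 (h'.memLp U hU).1 (p := 2) (by norm_num)
    have h2 := ENNReal.toReal_mono (ENNReal.add_ne_top.2 ⟨(h.memLp U hU).2.ne, (h'.memLp U hU).2.ne⟩) h1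
    rw [ENNReal.toReal_add (h.memLp U hU).2.ne (h'.memLp U hU).2.ne] at h2
    rw [add_mul]
    exact h2.trans (add_le_add (hC U hU) (hC' U hU))

/-- Carries weak convergence in the Sobolev space over to weak convergence in `L²(ℝⁿ)` of localised
coordinate expressions. -/
lemma IsBoundedL2Map.isBoundedFunctional {Λ : FunctionWithDiff n M → Euc n → ℝ}
    (h : IsBoundedL2Map g Λ) {φ : Euc n → ℝ} (hφ : MemLp φ 2 volume) :
    IsBoundedFunctional g (fun U => ∫ y, Λ U y * φ y) where
  map_add U hU V hV := by
    have hi : ∀ W ∈ sobolevSpace g, Integrable fun y => Λ W y * φ y :=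
      fun W hW => (h.memLp W hW).integrable_mul hφ
    rw [← integral_add (hi U hU) (hi V hV)]
    exact integral_congr_ae (Eventually.of_forall fun y => by
      simp only [h.map_add]; ring)
  map_smul c U hU := by
    rw [← integral_const_mul]
    exact integral_congr_ae (Eventually.of_forall fun y => by
      simp only [h.map_smul]; ring)
  bound := by
    obtain ⟨C, hC0, hC⟩ := h.bound
    refine ⟨C * (eLpNorm φ 2 volume).toReal, fun U hU => ?_⟩
    refine (abs_integral_mul_le (h.memLp U hU) hφ).trans ?_
    rw [mul_right_comm]
    exact mul_le_mul_of_nonneg_right (hC U hU) ENNReal.toReal_nonneg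

/-- Multiplication by `b` turns an `L²` estimate on the support of `b` into an estimate on the whole
space, at the cost of `sup |b|`. -/
lemma isBoundedL2Map_of_le {Λ : FunctionWithDiff n M → Euc n → ℝ} {b : Euc n → ℝ}
    (hb : Continuous b) (hc : HasCompactSupport b)
    (hadd : ∀ U V y, Λ (U + V) y = Λ U y + Λ V y) (hsmul : ∀ (c : ℝ) U y, Λ (c • U) y = c * Λ U y)
    (hm : ∀ U ∈ sobolevSpace g, MemLp (Λ U) 2 (volume.restrict (tsupport b))) {C : ℝ} (hC0 : 0 ≤ C)
    (hC : ∀ U ∈ sobolevSpace g, ∫ y in tsupport b, Λ U y ^ 2 ≤ C * sobolevNorm g U ^ 2) :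
    IsBoundedL2Map g (fun U y => b y * Λ U y) where
  map_add U V y := by rw [hadd]; ring
  map_smul c U y := by rw [hsmul]; ring
  memLp U hU := memLp_mul_of_tsupport hb hc (hm U hU)
  bound := by
    obtain ⟨B, hB⟩ := hb.bounded_above_of_compact_support hc
    have hB0 : 0 ≤ B := (norm_nonneg _).trans (hB 0)
    refine ⟨B * √C, mul_nonneg hB0 (Real.sqrt_nonneg _), fun U hU => ?_⟩
    have hmem := memLp_mul_of_tsupport hb hc (hm U hU)
    refine (abs_le_of_sq_le_sq' ?_ (mul_nonneg (mul_nonneg hB0 (Real.sqrt_nonneg _))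
      (sobolevNorm_nonneg g U))).2
    rw [toReal_eLpNorm_sq hmem]
    have h1 : ∫ y, (b y * Λ U y) ^ 2 = ∫ y in tsupport b, (b y * Λ U y) ^ 2 :=
      (setIntegral_eq_integral_of_forall_compl_eq_zero fun y hy => by
        rw [image_eq_zero_of_notMem_tsupport hy]; ring).symm
    have hcm : MeasurableSet (tsupport b) := (isClosed_tsupport b).measurableSet
    calc ∫ y, (b y * Λ U y) ^ 2 = ∫ y in tsupport b, (b y * Λ U y) ^ 2 := h1
      _ ≤ ∫ y in tsupport b, B ^ 2 * Λ U y ^ 2 := by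
        refine setIntegral_mono_on hmem.integrable_sq.integrableOn
          ((hm U hU).integrable_sq.const_mul _) hcm fun y _ => ?_
        rw [mul_pow]
        refine mul_le_mul_of_nonneg_right ?_ (sq_nonneg _)
        rw [← sq_abs]
        exact pow_le_pow_left₀ (abs_nonneg _) (hB y) 2
      _ = B ^ 2 * ∫ y in tsupport b, Λ U y ^ 2 := integral_const_mul _ _
      _ ≤ B ^ 2 * (C * sobolevNorm g U ^ 2) := mul_le_mul_of_nonneg_left (hC U hU) (sq_nonneg _)
      _ = (B * √C * sobolevNorm g U) ^ 2 := by rw [mul_pow, mul_pow, Real.sq_sqrt hC0]; ring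

variable [BorelSpace M] [IsManifold (𝓡∂ n) ∞ M] [CompactSpace M]
  {ρ : M → ℝ} {gb : BilinField n M}

namespace IsAHPair

lemma tendsto_sub_zero (h : IsAHPair ρ gb g) {U : ℕ → FunctionWithDiff n M}
    {V : FunctionWithDiff n M} (hUV : WeaklyConverges g U V) {l : FunctionWithDiff n M → ℝ}
    (hl : IsBoundedFunctional g l) : Tendsto (fun k => l (U k - V)) atTop (𝓝 0) := by
  have h1 : ∀ k, l (U k - V) = l (U k) - l V := fun k => by
    rw [sub_eq_add_neg, ← neg_one_smul ℝ V,
      hl.map_add _ (hUV.mem k) _ (h.smul_mem hUV.mem_limit _), hl.map_smul _ _ hUV.mem_limit]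
    ring
  simp only [h1]
  simpa using (hUV.tendsto l hl).sub_const (l V)

lemma isBoundedL2Map_inChart (h : IsAHPair ρ gb g) {x₀ : M} {b : Euc n → ℝ} (hb : Continuous b)
    (hc : HasCompactSupport b) (hs : tsupport b ⊆ chartDomain x₀) :
    IsBoundedL2Map g (fun U y => b y * inChart (n := n) U.1 x₀ y) := by
  obtain ⟨C, hC0, hC⟩ := h.exists_setIntegral_sq_le x₀ hc.isCompact hs
  exact isBoundedL2Map_of_le (Λ := fun U => inChart (n := n) U.1 x₀) hb hc (fun U V y => rfl)
    (fun c U y => rfl) (fun U hU => ((isLocallySobolev_iff.1 hU.1 x₀).memLp _ hs hc.isCompact).1)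
    hC0 fun U hU => (hC U hU).1

lemma isBoundedL2Map_covectorInChart (h : IsAHPair ρ gb g) {x₀ : M} {b : Euc n → ℝ}
    (hb : Continuous b) (hc : HasCompactSupport b) (hs : tsupport b ⊆ chartDomain x₀) (i : Fin n) :
    IsBoundedL2Map g (fun U y => b y * covectorInChart U.2 x₀ i y) := by
  obtain ⟨C, hC0, hC⟩ := h.exists_setIntegral_sq_le x₀ hc.isCompact hs
  exact isBoundedL2Map_of_le (Λ := fun U => covectorInChart U.2 x₀ i) hb hc (fun U V y => rfl)
    (fun c U y => rfl)
    (fun U hU => ((isLocallySobolev_iff.1 hU.1 x₀).memLp _ hs hc.isCompact).2 i)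
    hC0 fun U hU => (hC U hU).2 i

/-- The theorem of Rellich in a chart. -/
lemma tendsto_setIntegral_inChart_sq (h : IsAHPair ρ gb g) {U : ℕ → FunctionWithDiff n M}
    {V : FunctionWithDiff n M} (hUV : WeaklyConverges g U V) (x₀ : M) {L : Set (Euc n)}
    (hL : IsCompact L) (hLs : L ⊆ chartDomain x₀) :
    Tendsto (fun k => ∫ y in L, inChart (n := n) (U k - V).1 x₀ y ^ 2) atTop (𝓝 0) := by
  obtain ⟨ζ, hζ, hζc, hζs, hζ1, hζ01⟩ := exists_smooth_cutoff hL (isOpen_chartDomain x₀) hLs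
  have hmem : ∀ k, U k - V ∈ sobolevSpace g := fun k => h.sub_mem (hUV.mem k) hUV.mem_limit
  have hw := fun k => (isLocallySobolev_iff.1 (hmem k).1 x₀).cutoff hζ hζc hζs
  have hts : ∀ k, tsupport (fun y => ζ y * inChart (n := n) (U k - V).1 x₀ y) ⊆ tsupport ζ :=
    fun k => closure_mono fun y hy hz => hy (by simp [hz])
  have hpc : ∀ i, HasCompactSupport (partialDeriv i ζ) := fun i =>
    hζc.of_isClosed_subset (isClosed_tsupport _) (tsupport_partialDeriv_subset ζ i)
  have B0 := h.isBoundedL2Map_inChart hζ.continuous hζc hζs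
  have B1 : ∀ i, IsBoundedL2Map g fun U y => ζ y * covectorInChart U.2 x₀ i y +
      partialDeriv i ζ y * inChart (n := n) U.1 x₀ y := fun i =>
    (h.isBoundedL2Map_covectorInChart hζ.continuous hζc hζs i).add
      (h.isBoundedL2Map_inChart (contDiff_partialDeriv hζ i).continuous (hpc i)
        ((tsupport_partialDeriv_subset ζ i).trans hζs))
  -- The uniform boundedness principle is applied to the images in `L²(ℝⁿ)`, which is complete,
  -- rather than in the Sobolev space itself.
  obtain ⟨C₀, hC₀⟩ := exists_bound_eLpNorm_of_tendsto (fun k => B0.memLp _ (hmem k))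
    fun φ hφ => ⟨0, h.tendsto_sub_zero hUV (B0.isBoundedFunctional hφ)⟩
  have hC₁ := fun i => exists_bound_eLpNorm_of_tendsto (fun k => (B1 i).memLp _ (hmem k))
    fun φ hφ => ⟨0, h.tendsto_sub_zero hUV ((B1 i).isBoundedFunctional hφ)⟩
  choose C₁ hC₁ using hC₁
  have hR := tendsto_integral_sq_of_hasWeakGrad hζc.isCompact hw hts
    (C := |C₀| + ∑ i, |C₁ i|)
    (fun k => (hC₀ k).trans ((le_abs_self _).trans (le_add_of_nonneg_right
      (Finset.sum_nonneg fun i _ => abs_nonneg _))))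
    (fun k i => (hC₁ i k).trans ((le_abs_self _).trans
      ((Finset.single_le_sum (f := fun i => |C₁ i|) (fun i _ => abs_nonneg _)
        (Finset.mem_univ i)).trans (le_add_of_nonneg_left (abs_nonneg _)))))
    fun φ hφ => h.tendsto_sub_zero hUV (B0.isBoundedFunctional hφ)
  refine squeeze_zero (fun k => integral_nonneg fun y => sq_nonneg _) (fun k => ?_) hR
  have h1 : ∫ y in L, inChart (n := n) (U k - V).1 x₀ y ^ 2 =
      ∫ y in L, (ζ y * inChart (n := n) (U k - V).1 x₀ y) ^ 2 :=
    setIntegral_congr_fun hL.measurableSet fun y hy => by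
      have : ζ y = 1 := hζ1.self_of_nhdsSet y hy
      simp only [this, one_mul]
  rw [h1]
  exact setIntegral_le_integral (hw k).memLp.integrable_sq
    (Eventually.of_forall fun y => sq_nonneg _)

/-- The reverse comparison to `exists_setIntegral_inChart_le`: on the compact set `L` the volume
density is bounded above. -/
lemma exists_setIntegral_preimage_le (h : IsAHPair ρ gb g) (x₀ : M) {L : Set (Euc n)}
    (hL : IsCompact L) (hs : L ⊆ chartDomain x₀) :
    ∃ C : ℝ, ∀ f : M → ℝ, (∀ x, 0 ≤ f x) → Integrable f (riemVolume g) →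
      ∫ x in (extChartAt (𝓡∂ n) x₀).source ∩ extChartAt (𝓡∂ n) x₀ ⁻¹' L, f x ∂riemVolume g ≤
        C * ∫ y in L, inChart (n := n) f x₀ y := by
  obtain ⟨C, hC⟩ := hL.exists_bound_of_continuousOn ((h.continuousOn_volDensity x₀).mono hs)
  obtain ⟨_, _, hint⟩ := h.exists_setIntegral_inChart_le x₀ hL hs
  refine ⟨C, fun f hf hi => ?_⟩
  have hSm : MeasurableSet (extChartAt (𝓡∂ n) x₀).source :=
    (isOpen_extChartAt_source x₀).measurableSet
  set N := (extChartAt (𝓡∂ n) x₀).source ∩ extChartAt (𝓡∂ n) x₀ ⁻¹' L with hN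
  have hNm : MeasurableSet N :=
    measurableSet_inter_preimage (continuousOn_extChartAt x₀) hSm hL.measurableSet
  have h1 : ∫ x in N, f x ∂riemVolume g =
      ∫ x in (extChartAt (𝓡∂ n) x₀).source, N.indicator f x ∂riemVolume g := by
    rw [setIntegral_indicator hNm, ← Set.inter_assoc, Set.inter_self]
  have h2 : ∀ y ∈ chartDomain x₀, volDensity g x₀ y * inChart (n := n) (N.indicator f) x₀ y =
      L.indicator (fun y => volDensity g x₀ y * inChart (n := n) f x₀ y) y := fun y hy => by
    have hT := chartDomain_subset x₀ hy
    have hiff : (extChartAt (𝓡∂ n) x₀).symm y ∈ N ↔ y ∈ L := by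
      rw [hN, Set.mem_inter_iff, Set.mem_preimage, (extChartAt (𝓡∂ n) x₀).right_inv hT]
      exact and_iff_right ((extChartAt (𝓡∂ n) x₀).map_target hT)
    by_cases hyL : y ∈ L
    · rw [Set.indicator_of_mem hyL, inChart, Set.indicator_of_mem (hiff.2 hyL), inChart]
    · rw [Set.indicator_of_notMem hyL, inChart, Set.indicator_of_notMem (mt hiff.1 hyL), mul_zero]
  rw [h1, h.setIntegral_source x₀ (hi.1.aemeasurable.indicator hNm),
    setIntegral_congr_fun (isOpen_chartDomain x₀).measurableSet h2,
    setIntegral_indicator hL.measurableSet, Set.inter_eq_self_of_subset_right hs,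
    ← integral_const_mul]
  refine setIntegral_mono_on
    (((h.integrableOn_source_iff x₀ hi.1.aemeasurable).1 hi.integrableOn).mono_set hs)
    ((hint f hf hi).1.const_mul C) hL.measurableSet fun y hy => ?_
  exact mul_le_mul_of_nonneg_right ((le_abs_self _).trans (hC y hy)) (hf _)

/-- The theorem of Rellich on compact subsets of the interior. -/
theorem tendsto_setIntegral_sq (h : IsAHPair ρ gb g) {U : ℕ → FunctionWithDiff n M}
    {V : FunctionWithDiff n M} (hUV : WeaklyConverges g U V) {K : Set M} (hK : IsCompact K)
    (hKs : K ⊆ (𝓡∂ n).interior M) :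
    Tendsto (fun k => ∫ x in K, (U k - V).1 x ^ 2 ∂riemVolume g) atTop (𝓝 0) := by
  have hmem : ∀ k, Integrable (fun x => (U k - V).1 x ^ 2) (riemVolume g) := fun k =>
    (h.mem_sobolevSpace_iff.1 (h.sub_mem (hUV.mem k) hUV.mem_limit)).2.1
  have mono : ∀ {S S' : Set M}, S ⊆ S' → ∀ k, ∫ x in S, (U k - V).1 x ^ 2 ∂riemVolume g ≤
      ∫ x in S', (U k - V).1 x ^ 2 ∂riemVolume g := fun hS k =>
    setIntegral_mono_set (hmem k).integrableOn (Eventually.of_forall fun x => sq_nonneg _)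
      hS.eventuallyLE
  have nonneg : ∀ {S : Set M} k, 0 ≤ ∫ x in S, (U k - V).1 x ^ 2 ∂riemVolume g :=
    fun k => integral_nonneg fun x => sq_nonneg _
  -- Convergence to zero passes to subsets and finite unions, so by compactness it is enough to
  -- treat a coordinate ball around each point.
  refine hK.induction_on (p := fun S =>
    Tendsto (fun k => ∫ x in S, (U k - V).1 x ^ 2 ∂riemVolume g) atTop (𝓝 0)) ?_ ?_ ?_ ?_
  · simp
  · exact fun S S' hS hS' => squeeze_zero nonneg (mono hS) hS'
  · intro S S' hS hS'
    refine squeeze_zero nonneg (fun k => ?_) (by have := hS.add hS'; rwa [add_zero] at this)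
    rw [← integral_add_measure (hmem k).integrableOn (hmem k).integrableOn]
    exact integral_mono_measure (Measure.restrict_union_le _ _)
      (Eventually.of_forall fun x => sq_nonneg _)
      (integrable_add_measure.2 ⟨(hmem k).integrableOn, (hmem k).integrableOn⟩)
  · intro x hx
    have hy := extChartAt_mem_chartDomain (mem_extChartAt_source x) (hKs hx)
    obtain ⟨ε, hε, hball⟩ := Metric.nhds_basis_closedBall.mem_iff.1
      ((isOpen_chartDomain x).mem_nhds hy)
    have hL := isCompact_closedBall (extChartAt (𝓡∂ n) x x) ε
    refine ⟨_, mem_nhdsWithin_of_mem_nhds (inter_mem (extChartAt_source_mem_nhds (I := 𝓡∂ n) x)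
      ((continuousAt_extChartAt (I := 𝓡∂ n) x).preimage_mem_nhds (Metric.closedBall_mem_nhds _ hε))), ?_⟩
    obtain ⟨C, hC⟩ := h.exists_setIntegral_preimage_le x hL hball
    refine squeeze_zero nonneg (fun k => hC _ (fun x => sq_nonneg _) (hmem k)) ?_
    have := (h.tendsto_setIntegral_inChart_sq hUV x hL hball).const_mul C
    rwa [mul_zero] at this

end IsAHPair

end Weak

/-! ### The conformal energy -/

section Energy

variable {n : ℕ} [NeZero n] {M : Type*} [TopologicalSpace M] [CompactSpace M]
  [ChartedSpace (EuclideanHalfSpace n) M] [IsManifold (𝓡∂ n) ∞ M] [MeasurableSpace M]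
  [BorelSpace M] {ρ : M → ℝ} {gb g : BilinField n M}

lemma integrable_continuous_mul {f φ : M → ℝ} {μ : Measure M} (hf : Continuous f)
    (hφ : Integrable φ μ) : Integrable (fun x => f x * φ x) μ := by
  obtain ⟨C, hC⟩ := isCompact_univ.exists_bound_of_continuousOn hf.continuousOn
  exact hφ.bdd_mul hf.measurable.aestronglyMeasurable (c := C)
    (Eventually.of_forall fun x => hC x (Set.mem_univ x))

lemma memLp_continuous_mul {f φ : M → ℝ} {μ : Measure M} (hf : Continuous f)
    (hφ : MemLp φ 2 μ) : MemLp (fun x => f x * φ x) 2 μ := by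
  obtain ⟨C, hC⟩ := isCompact_univ.exists_bound_of_continuousOn hf.continuousOn
  refine (hφ.const_mul C).mono (hf.measurable.aestronglyMeasurable.mul hφ.1)
    (Eventually.of_forall fun x => ?_)
  rw [norm_mul, norm_mul]
  exact mul_le_mul_of_nonneg_right ((hC x (Set.mem_univ x)).trans (le_abs_self C)) (norm_nonneg _)

/-- The factor `4(n-1)/(n-2)` of the conformal energy. -/
def conformalFactor (n : ℕ) : ℝ := 4 * ((n : ℝ) - 1) / ((n : ℝ) - 2)

/-- The bilinear form associated with the conformal energy. -/
def energyForm (S : M → ℝ) (g : BilinField n M) (V U : FunctionWithDiff n M) (x : M) : ℝ :=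
  conformalFactor n * dualInner (bilinAt g x) (covectorAt V.2 x) (covectorAt U.2 x) +
    S x * V.1 x * U.1 x

namespace IsAHPair

variable {S : M → ℝ}

lemma energyDensity_ae_eq (hS : ∀ x ∈ (𝓡∂ n).interior M, S x = scalarCurvature g x)
    (U : FunctionWithDiff n M) : energyDensity g U =ᵐ[riemVolume g]
      fun x => conformalFactor n * diffNorm g U.2 x ^ 2 + S x * U.1 x ^ 2 := by
  filter_upwards [ae_mem_interior g] with x hx
  rw [energyDensity, hS x hx, conformalFactor]

lemma integrable_energyDensity (h : IsAHPair ρ gb g) (hSc : Continuous S)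
    (hS : ∀ x ∈ (𝓡∂ n).interior M, S x = scalarCurvature g x) {U : FunctionWithDiff n M}
    (hU : U ∈ sobolevSpace g) : Integrable (energyDensity g U) (riemVolume g) := by
  obtain ⟨-, hi1, hi2⟩ := h.mem_sobolevSpace_iff.1 hU
  exact ((hi2.const_mul _).add (integrable_continuous_mul hSc hi1)).congr
    (energyDensity_ae_eq hS U).symm

lemma energyDensity_add (h : IsAHPair ρ gb g)
    (hS : ∀ x ∈ (𝓡∂ n).interior M, S x = scalarCurvature g x) (V U : FunctionWithDiff n M) :
    ∀ᵐ x ∂riemVolume g, energyDensity g (V + U) x =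
      energyDensity g V x + 2 * energyForm S g V U x + energyDensity g U x := by
  filter_upwards [ae_mem_interior g] with x hx
  have h1 : diffNorm g (V + U).2 x ^ 2 = diffNorm g V.2 x ^ 2 +
      2 * dualInner (bilinAt g x) (covectorAt V.2 x) (covectorAt U.2 x) + diffNorm g U.2 x ^ 2 :=
    dualNorm_add_sq (h.isInnerForm hx) (covectorAt V.2 x) (covectorAt U.2 x)
  have h2 : (V + U).1 x = V.1 x + U.1 x := rfl
  rw [energyDensity, energyDensity, energyDensity, energyForm, conformalFactor, h1, h2, hS x hx]
  ring

/-- By polarisation, integrability of the mixed term follows from that of the energy densities of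
`V`, `U` and `V + U`. -/
lemma integrable_energyForm (h : IsAHPair ρ gb g) (hSc : Continuous S)
    (hS : ∀ x ∈ (𝓡∂ n).interior M, S x = scalarCurvature g x) {V U : FunctionWithDiff n M}
    (hV : V ∈ sobolevSpace g) (hU : U ∈ sobolevSpace g) :
    Integrable (energyForm S g V U) (riemVolume g) := by
  have hi := (((h.integrable_energyDensity hSc hS (h.add_mem hV hU)).sub
    (h.integrable_energyDensity hSc hS hV)).sub
    (h.integrable_energyDensity hSc hS hU)).const_mul (1 / 2)
  refine hi.congr ?_
  filter_upwards [h.energyDensity_add hS V U] with x hx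
  simp only [Pi.sub_apply, hx]
  ring

lemma integrable_dualInner (h : IsAHPair ρ gb g) {V U : FunctionWithDiff n M}
    (hV : V ∈ sobolevSpace g) (hU : U ∈ sobolevSpace g) :
    Integrable (fun x => dualInner (bilinAt g x) (covectorAt V.2 x) (covectorAt U.2 x))
      (riemVolume g) := by
  have hi := fun {W} (hW : W ∈ sobolevSpace g) => (h.mem_sobolevSpace_iff.1 hW).2.2
  refine ((((hi (h.add_mem hV hU)).sub (hi hV)).sub (hi hU)).const_mul (1 / 2)).congr ?_
  filter_upwards [ae_mem_interior g] with x hx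
  have h1 : diffNorm g (V + U).2 x ^ 2 = diffNorm g V.2 x ^ 2 +
      2 * dualInner (bilinAt g x) (covectorAt V.2 x) (covectorAt U.2 x) + diffNorm g U.2 x ^ 2 :=
    dualNorm_add_sq (h.isInnerForm hx) (covectorAt V.2 x) (covectorAt U.2 x)
  simp only [Pi.sub_apply, h1]
  ring

/-- Cauchy–Schwarz for covectors and then in `L²`; the scalar curvature is harmless because its
extension to the compact `M` is bounded. -/
lemma isBoundedFunctional_energyForm (h : IsAHPair ρ gb g) (hSc : Continuous S)
    (hS : ∀ x ∈ (𝓡∂ n).interior M, S x = scalarCurvature g x) {V : FunctionWithDiff n M}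
    (hV : V ∈ sobolevSpace g) :
    IsBoundedFunctional g (fun U => ∫ x, energyForm S g V U x ∂riemVolume g) where
  map_add U hU W hW := by
    rw [← integral_add (h.integrable_energyForm hSc hS hV hU)
      (h.integrable_energyForm hSc hS hV hW)]
    refine integral_congr_ae (Eventually.of_forall fun x => ?_)
    have h1 : dualInner (bilinAt g x) (covectorAt V.2 x) (covectorAt (U + W).2 x) = _ :=
      dualInner_add_right (covectorAt V.2 x) (covectorAt U.2 x) (covectorAt W.2 x)
    have h2 : (U + W).1 x = U.1 x + W.1 x := rfl
    simp only [energyForm, h1, h2]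
    ring
  map_smul c U hU := by
    rw [← integral_const_mul]
    refine integral_congr_ae (Eventually.of_forall fun x => ?_)
    have h1 : dualInner (bilinAt g x) (covectorAt V.2 x) (covectorAt (c • U).2 x) = _ :=
      dualInner_smul_right c (covectorAt V.2 x) (covectorAt U.2 x)
    have h2 : (c • U).1 x = c * U.1 x := rfl
    simp only [energyForm, h1, h2]
    ring
  bound := by
    set a := (eLpNorm (diffNorm g V.2) 2 (riemVolume g)).toReal
    have hSV := memLp_continuous_mul hSc hV.2.1
    set b := (eLpNorm (fun x => S x * V.1 x) 2 (riemVolume g)).toReal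
    refine ⟨|conformalFactor n| * a + b, fun U hU => ?_⟩
    have hdi := h.integrable_dualInner hV hU
    have h1 : |∫ x, dualInner (bilinAt g x) (covectorAt V.2 x) (covectorAt U.2 x) ∂riemVolume g| ≤
        a * (eLpNorm (diffNorm g U.2) 2 (riemVolume g)).toReal := by
      refine (abs_integral_le_integral_abs).trans (le_trans ?_
        ((le_abs_self _).trans (abs_integral_mul_le hV.2.2 hU.2.2)))
      refine integral_mono_ae hdi.abs (hV.2.2.integrable_mul hU.2.2) ?_
      filter_upwards [ae_mem_interior g] with x hx
      exact abs_dualInner_le (h.isInnerForm hx) _ _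
    have h2 := abs_integral_mul_le hSV hU.2.1
    have h3 : Integrable (fun x => S x * V.1 x * U.1 x) (riemVolume g) := hSV.integrable_mul hU.2.1
    have h4 : ∫ x, energyForm S g V U x ∂riemVolume g =
        conformalFactor n *
          (∫ x, dualInner (bilinAt g x) (covectorAt V.2 x) (covectorAt U.2 x) ∂riemVolume g) +
        ∫ x, S x * V.1 x * U.1 x ∂riemVolume g := by
      rw [← integral_const_mul, ← integral_add (hdi.const_mul _) h3]
      rfl
    have ha : 0 ≤ a := ENNReal.toReal_nonneg
    have hb : 0 ≤ b := ENNReal.toReal_nonneg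
    have hu : 0 ≤ (eLpNorm U.1 2 (riemVolume g)).toReal := ENNReal.toReal_nonneg
    have hdu : 0 ≤ (eLpNorm (diffNorm g U.2) 2 (riemVolume g)).toReal := ENNReal.toReal_nonneg
    rw [h4]
    refine (abs_add_le _ _).trans ?_
    rw [abs_mul, sobolevNorm]
    calc _ ≤ |conformalFactor n| * (a * (eLpNorm (diffNorm g U.2) 2 (riemVolume g)).toReal) +
          b * (eLpNorm U.1 2 (riemVolume g)).toReal :=
          add_le_add (mul_le_mul_of_nonneg_left h1 (abs_nonneg _)) h2
      _ ≤ _ := by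
          have hc := abs_nonneg (conformalFactor n)
          nlinarith [mul_nonneg (mul_nonneg hc ha) hu, mul_nonneg hb hdu]

variable [T2Space M]

/-- The conformal energy is bounded below by `∫ W u²`, for a continuous function `W` which is
positive on the boundary. -/
lemma exists_energy_lower_bound (h : IsAHPair ρ gb g) (hn : 3 ≤ n) (hSc : Continuous S)
    (hS : ∀ x ∈ (𝓡∂ n).interior M, S x = scalarCurvature g x)
    (hSb : ∀ x ∈ (𝓡∂ n).boundary M, S x = -(n * (n - 1))) :
    ∃ W : M → ℝ, Continuous W ∧ (∀ x ∈ (𝓡∂ n).boundary M, 0 < W x) ∧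
      ∀ U ∈ sobolevSpace g, ∫ x, W x * U.1 x ^ 2 ∂riemVolume g ≤ conformalEnergy g U := by
  obtain ⟨V, hVc, hVb, hV⟩ := h.exists_dirichlet_lower_bound
  have hn3 : (3 : ℝ) ≤ n := by exact_mod_cast hn
  have hc : 0 ≤ conformalFactor n :=
    div_nonneg (mul_nonneg (by norm_num) (by linarith)) (by linarith)
  refine ⟨fun x => conformalFactor n * V x + S x, (continuous_const.mul hVc).add hSc,
    fun x hx => ?_, fun U hU => ?_⟩
  · dsimp only
    rw [hVb x hx, hSb x hx, conformalFactor]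
    have h2 : (0 : ℝ) < n - 2 := by linarith
    -- The positivity comes down to `(n-1)² - n(n-2) = 1`.
    have : 4 * ((n : ℝ) - 1) / (n - 2) * ((n - 1) / 2) ^ 2 + -(n * (n - 1)) = (n - 1) / (n - 2) := by
      field_simp
      ring
    rw [this]
    exact div_pos (by linarith) h2
  · obtain ⟨-, hi1, hi2⟩ := h.mem_sobolevSpace_iff.1 hU
    have i1 := integrable_continuous_mul hVc hi1
    have i2 := integrable_continuous_mul hSc hi1
    rw [conformalEnergy, integral_congr_ae (energyDensity_ae_eq hS U),
      integral_add (hi2.const_mul _) i2, integral_const_mul]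
    have : ∫ x, (conformalFactor n * V x + S x) * U.1 x ^ 2 ∂riemVolume g =
        conformalFactor n * (∫ x, V x * U.1 x ^ 2 ∂riemVolume g) +
          ∫ x, S x * U.1 x ^ 2 ∂riemVolume g := by
      rw [← integral_const_mul, ← integral_add (i1.const_mul _) i2]
      exact integral_congr_ae (Eventually.of_forall fun x => by dsimp only; ring)
    rw [this]
    exact add_le_add (mul_le_mul_of_nonneg_left (hV U hU) hc) le_rfl

/-- Expand the energy of `U k` around `V`: the linear term vanishes in the limit by weak
convergence, and the energy of `U k - V` is bounded below by a quantity that tends to zero. -/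
theorem conformalEnergy_le_liminf (h : IsAHPair ρ gb g) (hn : 3 ≤ n) (hSc : Continuous S)
    (hS : ∀ x ∈ (𝓡∂ n).interior M, S x = scalarCurvature g x)
    (hSb : ∀ x ∈ (𝓡∂ n).boundary M, S x = -(n * (n - 1))) {U : ℕ → FunctionWithDiff n M}
    {V : FunctionWithDiff n M} (hUV : WeaklyConverges g U V) :
    (conformalEnergy g V : EReal) ≤
      liminf (fun k => (conformalEnergy g (U k) : EReal)) atTop := by
  obtain ⟨W, hWc, hWb, hW⟩ := h.exists_energy_lower_bound hn hSc hS hSb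
  -- Closed in a compact space and disjoint from the boundary, where `W > 0`: a compact subset of
  -- the interior, to which Rellich's theorem applies.
  set K : Set M := {x | W x ≤ 0} with hK
  have hKc : IsClosed K := isClosed_le hWc continuous_const
  have hKi : K ⊆ (𝓡∂ n).interior M := fun x hx => by
    by_contra hxi
    have hb : x ∈ (𝓡∂ n).boundary M := by rw [← ModelWithCorners.compl_interior]; exact hxi
    exact absurd (hWb x hb) (not_lt.2 hx)
  obtain ⟨B, hB⟩ := isCompact_univ.exists_bound_of_continuousOn hWc.continuousOn
  have hmem : ∀ k, U k - V ∈ sobolevSpace g := fun k => h.sub_mem (hUV.mem k) hUV.mem_limit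
  have hrel := h.tendsto_setIntegral_sq hUV hKc.isCompact hKi
  have hform := h.tendsto_sub_zero hUV (h.isBoundedFunctional_energyForm hSc hS hUV.mem_limit)
  -- `W ≥ -B` on `K` and `W > 0` off `K`.
  have hlow : ∀ k, -B * ∫ x in K, (U k - V).1 x ^ 2 ∂riemVolume g ≤ conformalEnergy g (U k - V) := by
    intro k
    have hi1 := (h.mem_sobolevSpace_iff.1 (hmem k)).2.1
    refine le_trans ?_ (hW _ (hmem k))
    rw [← integral_const_mul, ← integral_indicator hKc.measurableSet]
    refine integral_mono ((hi1.const_mul _).indicator hKc.measurableSet)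
      (integrable_continuous_mul hWc hi1) fun x => ?_
    by_cases hx : x ∈ K
    · rw [Set.indicator_of_mem hx]
      exact mul_le_mul_of_nonneg_right (abs_le.1 (hB x (Set.mem_univ x))).1 (sq_nonneg _)
    · rw [Set.indicator_of_notMem hx]
      exact mul_nonneg (not_le.1 hx).le (sq_nonneg _)
  have hexp : ∀ k, conformalEnergy g (U k) = conformalEnergy g V +
      2 * (∫ x, energyForm S g V (U k - V) x ∂riemVolume g) + conformalEnergy g (U k - V) := by
    intro k
    have i1 := h.integrable_energyDensity hSc hS hUV.mem_limit
    have i2 := (h.integrable_energyForm hSc hS hUV.mem_limit (hmem k)).const_mul 2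
    have i3 := h.integrable_energyDensity hSc hS (hmem k)
    have i12 : Integrable (fun x => energyDensity g V x + 2 * energyForm S g V (U k - V) x)
        (riemVolume g) := i1.add i2
    have e := h.energyDensity_add hS V (U k - V)
    rw [add_sub_cancel] at e
    rw [conformalEnergy, conformalEnergy, conformalEnergy, integral_congr_ae e,
      integral_add i12 i3, integral_add i1 i2, integral_const_mul]
  have hlim : Tendsto (fun k => conformalEnergy g V +
      2 * (∫ x, energyForm S g V (U k - V) x ∂riemVolume g) +
      -B * ∫ x in K, (U k - V).1 x ^ 2 ∂riemVolume g) atTop (𝓝 (conformalEnergy g V)) := by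
    have := (tendsto_const_nhds (x := conformalEnergy g V)).add (hform.const_mul 2) |>.add
      (hrel.const_mul (-B))
    simpa only [mul_zero, add_zero] using this
  -- In the complete lattice `EReal`, the comparison of lower limits needs no bound on the energies.
  have hlimE := (continuous_coe_real_ereal.tendsto _).comp hlim
  rw [← hlimE.liminf_eq]
  refine liminf_le_liminf (Eventually.of_forall fun k => ?_)
  rw [Function.comp_apply, EReal.coe_le_coe_iff, hexp k]
  exact add_le_add le_rfl (hlow k)

end IsAHPair

end Energy

end AsympHyp

end

theorem proposition3p2 {n : ℕ} [NeZero n] (hn : 3 ≤ n)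
    {M : Type*} [TopologicalSpace M] [T2Space M] [CompactSpace M]
    [ChartedSpace (EuclideanHalfSpace n) M] [IsManifold (𝓡∂ n) ∞ M]
    [MeasurableSpace M] [BorelSpace M]
    (l : ℕ) (hl : 2 ≤ l) (β : ℝ≥0) (hβ : β < 1)
    (g : AsympHyp.BilinField n M) (hg : AsympHyp.IsAsymptoticallyHyperbolic l β g) :
    (∀ U ∈ AsympHyp.sobolevSpace g,
      Integrable (AsympHyp.energyDensity g U) (AsympHyp.riemVolume g)) ∧
    ∀ (U : ℕ → AsympHyp.FunctionWithDiff n M) (V : AsympHyp.FunctionWithDiff n M),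
      AsympHyp.WeaklyConverges g U V →
        (AsympHyp.conformalEnergy g V : EReal) ≤
          liminf (fun k => (AsympHyp.conformalEnergy g (U k) : EReal)) atTop := by
  obtain ⟨ρ, gb, h⟩ := hg.exists_pair hl
  obtain ⟨S, hSc, hS, hSb⟩ := h.exists_continuous_scalarCurvature
  exact ⟨fun U hU => h.integrable_energyDensity hSc hS hU,
    fun U V hUV => h.conformalEnergy_le_liminf hn hSc hS hSb hUV⟩
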